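/- **Setting.** There are schools $\mathcal J=\{1,\dots,J\}$ with cutoffs $c_1,\dots,c_J\in\mathbb R$ and options $\mathcal J^0=\mathcal J\cup\{0\}$, where $0$ is an outside option. Let $\mathcal Y\subseteq\mathbb R$ be compact. An *economy* is a probability space $(\Omega,\mathbb P)$ with measurable maps: a true preference $Q$ (a strict linear order on $\mathcal J^0$ that ranks at least one school above $0$), scores $S_1,\dots,S_J\in\mathbb R$, potential outcomes $Y(d)\in\mathcal Y$ ($d\in\mathcal J^0$), and a random set $\mathbf Q_j\subseteq\mathcal J^0\times\mathcal J^0$ (the constructed set of local preferences). Each $S_m$ has an absolutely continuous law whose support contains $c_m$ in its interior, and for any $l,m$ either $\mathbb P[S_l=S_m]=1$ or $\mathbb P[f(S_l)=S_m]<1$ for every measurable $f$. For $C\subseteq\mathcal J^0$ let $Q(C)$ be the $Q$-best element of $C$. Let $B(\mathbf S)=\{0\}\cup\{m:S_m\ge c_m\}$. The student is matched to $Q(B(\mathbf S))$ and her observed outcome is $Y=Y(Q(B(\mathbf S)))$. Fix a school $j$. Let $T_j=\{m\in\mathcal J: S_m=S_j \text{ a.s. and } c_m=c_j\}$, $B_j^+=B(\mathbf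 S)\cup T_j$, $B_j^-=B(\mathbf S)\setminus T_j$, and let the local preference be $Q_j=(Q(B_j^+),Q(B_j^-))$. All probabilities and expectations given $S_j=s$ refer to a fixed version of the conditional distribution given $S_j$. Conditioning on $S_j=c_j^+$ and $S_j=c_j^-$ denotes the limits as $s\downarrow c_j$ and $s\uparrow c_j$. Let $\mathcal G$ be a set of measurable functions $g:\mathbb R\to\mathbb R$, bounded on $\mathcal Y$, that contains $1$, the identity, and the indicator of every Borel subset of $\mathcal Y$. **Assumptions at $j$.** * *Continuity of types.* Let $A_0$ be any event that specifies which of the schools outside $T_j$ are available ($S_m\ge c_m$). For every such $A_0$, every preference $Q_0$, every $d\in\mathcal J^0$ and every $g\in\mathcal G$, the functions $s\mapsto\mathbb P[A_0,Q=Q_0\mid S_j=s]$ and $s\mapsto\mathbb E[g(Y(d))\,1\{A_0,Q=Q_0\}\mid S_j=s]$ are continuous at $s=c_j$. * *Sharp local preference sets.* (i) $Q_j\in\mathbf Q_j$ a.s. (ii) For almost every $s$ and every $B$ with $\mathbb P[\mathbf Q_j=B\mid S_j=s]>0$, the set of $q$ with $\mathbb P[Q_j=q,\mathbf Q_j=B\mid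 S_j=s]>0$ is $B$. * *Distribution of local preference sets.* (i) Put $\Lambda_j(s)=\{B:\mathbb P[\mathbf Q_j=B\mid S_j=s]>0\}$. There are $\varepsilon>0$ and collections $\Lambda_j^+,\Lambda_j^-$ with $\Lambda_j(c_j+e)=\Lambda_j^+$ for $0\le e<\varepsilon$ and $\Lambda_j(c_j-e)=\Lambda_j^-$ for $0<e<\varepsilon$. (ii) For all $g\in\mathcal G$ and $-\infty\le\tau_1<\tau_2\le\infty$, the limits $\mathbb E[g(Y)1\{\mathbf Q_j=B,\tau_1<g(Y)<\tau_2\}\mid S_j=c_j^{\pm}]$ exist for all $B\in\Lambda_j^{\pm}$, respectively. Let $\Lambda_j^{\cup+}$ and $\Lambda_j^{\cup-}$ be the collections of all unions of one or more members of $\Lambda_j^+$ and $\Lambda_j^-$, respectively. **Theorem.** Suppose an economy satisfies the three assumptions at $j$. Suppose also that $(j,k)$, with $j\neq k$ in $\mathcal J$, is a comparable pair: $\mathbb P[Q_j=(j,k)\mid S_j=s]$ is bounded away from $0$ for $s$ in a neighbourhood of $c_j$. A *candidate* is a family of measures $\nu_{(b,b'),d}$ on $\mathcal Y$, for $(b,b')\in\mathcal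 J^0\times\mathcal J^0$ and $d\in\{b,b'\}$, with $\nu_{(b,b'),b}(\mathcal Y)=\nu_{(b,b'),b'}(\mathcal Y)$ and $\sum_{(b,b')}\nu_{(b,b'),b}(\mathcal Y)=1$. Consider the inequalities $$\mathbb P[Y\in A,\ \mathbf Q_j\subseteq B\mid S_j=c_j^+]\le\sum_{(b,b')\in B}\nu_{(b,b'),b}(A)\quad\text{for all Borel }A\subseteq\mathcal Y,\ B\in\Lambda_j^{\cup+},$$ $$\mathbb P[Y\in A,\ \mathbf Q_j\subseteq B\mid S_j=c_j^-]\le\sum_{(b,b')\in B}\nu_{(b,b'),b'}(A)\quad\text{for all Borel }A\subseteq\mathcal Y,\ B\in\Lambda_j^{\cup-}.$$ 1. All limits on the left-hand sides exist, and the true values $\nu_{(b,b'),d}(A)=\mathbb P[Y(d)\in A,\,Q_j=(b,b')\mid S_j=c_j]$ form a candidate that satisfies the inequalities. 2. The inequalities characterize the sharp set given the law of $(Y,\mathbf Q_j,S_j)$. That is, a family $\nu$ is a candidate satisfying all the inequalities if and only if there is an economy, with the same cutoffs and outcome space, that generates the same law of $(Y,\mathbf Q_j,S_j)$, satisfies the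 three assumptions at $j$ for some version of its conditional distributions given $S_j$ (with the same $\mathcal G,\Lambda_j^+,\Lambda_j^-$), and has $\mathbb P[Y(d)\in A,\,Q_j=(b,b')\mid S_j=c_j]=\nu_{(b,b'),d}(A)$ for all $(b,b')$, all $d\in\{b,b'\}$ and all Borel $A\subseteq\mathcal Y$. -/

import Mathlib

open MeasureTheory ProbabilityTheory Filter Topology
open scoped ENNReal

noncomputable section

namespace LocalPref

/-- The options: `none` is the outside option `0`, `some m` is the school `m`. -/
abbrev Choice (J : ℕ) : Type := Option (Fin J)

/-- A strict preference relation over the options with at least one acceptable school,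
given by the rank of every option (rank `0` is the best): `k` is preferred to `l` iff
`rank k < rank l`. -/
structure Preference (J : ℕ) where
  rank : Choice J ≃ Fin (J + 1)
  acceptable : ∃ m : Fin J, rank (some m) < rank none

/-- The best option `Q(B)` in a set `B` of options (used for sets that contain `0`). -/
def Preference.best {J : ℕ} (Q : Preference J) (B : Finset (Choice J)) : Choice J :=
  open Classical in
  if h : B.Nonempty then (B.exists_min_image Q.rank h).choose else none

theorem Preference.best_eq_iff {J : ℕ} (Q : Preference J) {B : Finset (Choice J)}
    (hB : B.Nonempty) (m : Choice J) :
    Q.best B = m ↔ m ∈ B ∧ ∀ n ∈ B, m = n ∨ Q.rank m < Q.rank n := by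
  have hs := (B.exists_min_image Q.rank hB).choose_spec
  have he : Q.best B = (B.exists_min_image Q.rank hB).choose := by
    simp [Preference.best, hB]
  rw [← he] at hs
  constructor
  · rintro rfl
    refine ⟨hs.1, fun n hn => ?_⟩
    rcases (hs.2 n hn).lt_or_eq with h | h
    · exact Or.inr h
    · exact Or.inl (Q.rank.injective h)
  · rintro ⟨hm, h⟩
    rcases h _ hs.1 with h | h
    · exact h.symm
    · exact absurd (hs.2 m hm) (not_le.mpr h)

/-- A population of students with `J` schools, cutoffs `c` and outcome space `𝒴`: a probability
measure on the student types together with true preferences, placement scores, potential outcomes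
and (constructed) sets of local preferences, and the maintained assumptions on the scores. -/
structure Economy (J : ℕ) (c : Fin J → ℝ) (𝒴 : Set ℝ) (Ω : Type*) [MeasurableSpace Ω] where
  P : Measure Ω
  prob : IsProbabilityMeasure P
  /-- true preference relation -/
  pref : Ω → Preference J
  /-- placement scores -/
  score : Fin J → Ω → ℝ
  /-- potential outcomes -/
  potential : Choice J → Ω → 𝒴
  /-- the set of local preferences constructed for the student -/
  prefSet : Ω → Finset (Choice J × Choice J)
  measurableSet_pref : ∀ Q₀, MeasurableSet {ω | pref ω = Q₀}
  measurable_score : ∀ m, Measurable (score m)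
  measurable_potential : ∀ d, Measurable (potential d)
  measurableSet_prefSet : ∀ B, MeasurableSet {ω | prefSet ω = B}
  score_absolutelyContinuous : ∀ m, P.map (score m) ≪ volume
  cutoff_mem_interior : ∀ m, c m ∈ interior (P.map (score m)).support
  score_dichotomy : ∀ l m, (∀ᵐ ω ∂P, score l ω = score m ω) ∨
    ∀ f : ℝ → ℝ, Measurable f → P {ω | f (score l ω) = score m ω} < 1

namespace Economy

variable {J : ℕ} {c : Fin J → ℝ} {𝒴 : Set ℝ} {Ω : Type*} [MeasurableSpace Ω]

/-- The schools that use the same score and have the same cutoff as school `j`. -/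
def tied (M : Economy J c 𝒴 Ω) (j : Fin J) : Finset (Fin J) :=
  open Classical in
  Finset.univ.filter fun m => (∀ᵐ ω ∂M.P, M.score m ω = M.score j ω) ∧ c m = c j

/-- The tied schools, as options. -/
def tiedChoices (M : Economy J c 𝒴 Ω) (j : Fin J) : Finset (Choice J) :=
  open Classical in (M.tied j).image some

/-- The budget set `B(S)`. -/
def budget (M : Economy J c 𝒴 Ω) (ω : Ω) : Finset (Choice J) :=
  open Classical in
  insert none ((Finset.univ.filter fun m => c m ≤ M.score m ω).image some)

/-- The right-counterfactual budget set at the cutoff of `j`. -/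
def budgetRight (M : Economy J c 𝒴 Ω) (j : Fin J) (ω : Ω) : Finset (Choice J) :=
  open Classical in M.budget ω ∪ M.tiedChoices j

/-- The left-counterfactual budget set at the cutoff of `j`. -/
def budgetLeft (M : Economy J c 𝒴 Ω) (j : Fin J) (ω : Ω) : Finset (Choice J) :=
  open Classical in M.budget ω \ M.tiedChoices j

/-- The matching: every student gets her best feasible option (cutoff characterization). -/
def matching (M : Economy J c 𝒴 Ω) (ω : Ω) : Choice J := (M.pref ω).best (M.budget ω)

/-- The observed outcome `Y`. -/
def outcome (M : Economy J c 𝒴 Ω) (ω : Ω) : 𝒴 := M.potential (M.matching ω) ω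

/-- The true local preference `Q_j`. -/
def localPref (M : Economy J c 𝒴 Ω) (j : Fin J) (ω : Ω) : Choice J × Choice J :=
  ((M.pref ω).best (M.budgetRight j ω), (M.pref ω).best (M.budgetLeft j ω))

/-- `κ s` is a version of the conditional probability given `S_j = s`. -/
def IsCondVersion (M : Economy J c 𝒴 Ω) (j : Fin J) (κ : Kernel ℝ Ω) : Prop :=
  IsMarkovKernel κ ∧ ∀ F : Set ℝ, MeasurableSet F → ∀ E : Set Ω, MeasurableSet E →
    M.P (M.score j ⁻¹' F ∩ E) = ∫⁻ s in F, κ s E ∂(M.P.map (M.score j))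

/-- `(j, k)` is a comparable pair of alternatives. -/
def Comparable (M : Economy J c 𝒴 Ω) (κ : Kernel ℝ Ω) (j k : Fin J) : Prop :=
  j ≠ k ∧ c j ∈ interior (M.P.map (M.score j)).support ∧
    ∃ δ : ℝ, 0 < δ ∧ ∀ᶠ s in 𝓝 (c j), δ ≤ (κ s).real {ω | M.localPref j ω = (some j, some k)}

/-- The event that, among the schools not tied to `j`, exactly those in `R` are available. -/
def availEvent (M : Economy J c 𝒴 Ω) (j : Fin J) (R : Finset (Fin J)) : Set Ω :=
  {ω | ∀ m, m ∉ M.tied j → (c m ≤ M.score m ω ↔ m ∈ R)}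

/-- Continuity of types at the cutoff of `j`. -/
def ContinuousTypes (M : Economy J c 𝒴 Ω) (κ : Kernel ℝ Ω) (j : Fin J) (𝒢 : Set (ℝ → ℝ)) : Prop :=
  (∀ (R : Finset (Fin J)) (Q₀ : Preference J),
    ContinuousAt (fun s => (κ s).real (M.availEvent j R ∩ {ω | M.pref ω = Q₀})) (c j)) ∧
  (∀ (R : Finset (Fin J)) (Q₀ : Preference J) (d : Choice J), ∀ g ∈ 𝒢,
    ContinuousAt (fun s => ∫ ω in M.availEvent j R ∩ {ω | M.pref ω = Q₀},
      g (M.potential d ω) ∂(κ s)) (c j))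

/-- Sharp local preference sets: `Q_j` belongs to the local preference set almost surely, and the
support of `Q_j` given the local preference set and `S_j` is the local preference set. -/
def SharpSets (M : Economy J c 𝒴 Ω) (κ : Kernel ℝ Ω) (j : Fin J) : Prop :=
  (∀ᵐ ω ∂M.P, M.localPref j ω ∈ M.prefSet ω) ∧
  (∀ᵐ s ∂(M.P.map (M.score j)), ∀ B : Finset (Choice J × Choice J),
    0 < κ s {ω | M.prefSet ω = B} →
      ∀ q, 0 < κ s {ω | M.localPref j ω = q ∧ M.prefSet ω = B} ↔ q ∈ B)

/-- The support `Λ_j(s)` of the local preference sets given `S_j = s`. -/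
def setSupport (M : Economy J c 𝒴 Ω) (κ : Kernel ℝ Ω) (s : ℝ) :
    Set (Finset (Choice J × Choice J)) :=
  {B | 0 < κ s {ω | M.prefSet ω = B}}

/-- The event `{𝐐_j = B, τ₁ < g(Y) < τ₂}`. -/
def truncEvent (M : Economy J c 𝒴 Ω) (B : Finset (Choice J × Choice J)) (g : ℝ → ℝ)
    (τ₁ τ₂ : EReal) : Set Ω :=
  {ω | M.prefSet ω = B ∧ τ₁ < (g (M.outcome ω) : EReal) ∧ (g (M.outcome ω) : EReal) < τ₂}

/-- Regularity of the distribution of the local preference sets near the cutoff of `j`, where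
`Λp` and `Λm` are the supports to the right and to the left of the cutoff. -/
def RegularSets (M : Economy J c 𝒴 Ω) (κ : Kernel ℝ Ω) (j : Fin J) (𝒢 : Set (ℝ → ℝ))
    (Λp Λm : Set (Finset (Choice J × Choice J))) : Prop :=
  (∃ ε : ℝ, 0 < ε ∧ (∀ e, 0 ≤ e → e < ε → M.setSupport κ (c j + e) = Λp) ∧
    (∀ e, 0 < e → e < ε → M.setSupport κ (c j - e) = Λm)) ∧
  (∀ g ∈ 𝒢, ∀ τ₁ τ₂ : EReal, τ₁ < τ₂ →
    (∀ B ∈ Λp, ∃ l : ℝ, Tendsto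
      (fun s => ∫ ω in M.truncEvent B g τ₁ τ₂, g (M.outcome ω) ∂(κ s)) (𝓝[>] (c j)) (𝓝 l)) ∧
    (∀ B ∈ Λm, ∃ l : ℝ, Tendsto
      (fun s => ∫ ω in M.truncEvent B g τ₁ τ₂, g (M.outcome ω) ∂(κ s)) (𝓝[<] (c j)) (𝓝 l)))

/-- The measure `A ↦ P[Y(d) ∈ A, Q_j = q | S_j = c_j]`. -/
def jointLaw (M : Economy J c 𝒴 Ω) (κ : Kernel ℝ Ω) (j : Fin J) (q : Choice J × Choice J)
    (d : Choice J) : Measure 𝒴 :=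
  ((κ (c j)).restrict {ω | M.localPref j ω = q}).map (M.potential d)

/-- Two economies generate the same law of the observed triple `(Y, 𝐐_j, S_j)`. -/
def SameObservables (M : Economy J c 𝒴 Ω) {Ω' : Type*} [MeasurableSpace Ω']
    (M' : Economy J c 𝒴 Ω') (j : Fin J) : Prop :=
  ∀ (A : Set 𝒴) (B : Finset (Choice J × Choice J)) (F : Set ℝ),
    MeasurableSet A → MeasurableSet F →
    M'.P {ω | M'.outcome ω ∈ A ∧ M'.prefSet ω = B ∧ M'.score j ω ∈ F} =
      M.P {ω | M.outcome ω ∈ A ∧ M.prefSet ω = B ∧ M.score j ω ∈ F}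

/-- The event `{Y ∈ A, 𝐐_j ⊆ B}`. -/
def containEvent (M : Economy J c 𝒴 Ω) (A : Set 𝒴) (B : Finset (Choice J × Choice J)) : Set Ω :=
  {ω | M.outcome ω ∈ A ∧ M.prefSet ω ⊆ B}

end Economy

/-- All unions of (one or more) members of `Λ`. -/
def unionClass {X : Type*} (Λ : Set (Finset X)) : Set (Finset X) :=
  {B | ∃ C : Finset (Finset X), C.Nonempty ∧ (∀ D ∈ C, D ∈ Λ) ∧ ∀ x, x ∈ B ↔ ∃ D ∈ C, x ∈ D}

/-- The admissible test functions: a set of measurable functions, bounded on `𝒴`, that contains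
the constant `1`, the identity and the indicators of the Borel subsets of `𝒴`. -/
def IsTestClass (𝒴 : Set ℝ) (𝒢 : Set (ℝ → ℝ)) : Prop :=
  (∀ g ∈ 𝒢, Measurable g ∧ ∃ K : ℝ, ∀ y ∈ 𝒴, |g y| ≤ K) ∧
  (fun _ => (1 : ℝ)) ∈ 𝒢 ∧ (fun y : ℝ => y) ∈ 𝒢 ∧
  ∀ A : Set ℝ, MeasurableSet A → A ⊆ 𝒴 → A.indicator (fun _ => (1 : ℝ)) ∈ 𝒢

/-- Candidate values `ν q d A` for `P[Y(d) ∈ A, Q_j = q | S_j = c_j]`, where only the entries with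
`d ∈ {q.1, q.2}` matter: measures in `A`, whose total masses are the values of a probability
mass function of `Q_j`. -/
def IsCandidate {J : ℕ} {𝒴 : Set ℝ} (ν : Choice J × Choice J → Choice J → Measure 𝒴) : Prop :=
  (∀ q, ν q q.1 Set.univ = ν q q.2 Set.univ) ∧ ∑ q, ν q q.1 Set.univ = 1

/-- The inequalities: the one-sided limits of `P[Y ∈ A, 𝐐_j ⊆ B | S_j = s]` at the cutoff exist and
are bounded by the corresponding sums, on the right for `B` in the union class of `Λp`
and on the left for `B` in the union class of `Λm`. -/
def Inequalities {J : ℕ} {c : Fin J → ℝ} {𝒴 : Set ℝ} {Ω : Type*} [MeasurableSpace Ω]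
    (M : Economy J c 𝒴 Ω) (κ : Kernel ℝ Ω) (j : Fin J)
    (Λp Λm : Set (Finset (Choice J × Choice J)))
    (ν : Choice J × Choice J → Choice J → Measure 𝒴) : Prop :=
  (∀ A : Set 𝒴, MeasurableSet A → ∀ B ∈ unionClass Λp,
    ∃ L : ℝ≥0∞, Tendsto (fun s => κ s (M.containEvent A B)) (𝓝[>] (c j)) (𝓝 L) ∧
      L ≤ ∑ q ∈ B, ν q q.1 A) ∧
  (∀ A : Set 𝒴, MeasurableSet A → ∀ B ∈ unionClass Λm,
    ∃ L : ℝ≥0∞, Tendsto (fun s => κ s (M.containEvent A B)) (𝓝[<] (c j)) (𝓝 L) ∧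
      L ≤ ∑ q ∈ B, ν q q.2 A)

/-- The sharp set: `ν` consists of the values of `P[Y(d) ∈ A, Q_j = q | S_j = c_j]`,
`d ∈ {q.1, q.2}`, in some economy (with some version of its conditional probabilities) that
satisfies the assumptions and generates the same law of `(Y, 𝐐_j, S_j)` as `M`. -/
def InSharpSet {J : ℕ} {c : Fin J → ℝ} {𝒴 : Set ℝ} {Ω : Type*} [MeasurableSpace Ω]
    (M : Economy J c 𝒴 Ω) (j : Fin J) (𝒢 : Set (ℝ → ℝ))
    (Λp Λm : Set (Finset (Choice J × Choice J)))
    (ν : Choice J × Choice J → Choice J → Measure 𝒴) : Prop :=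
  ∃ (Ω' : Type) (_ : MeasurableSpace Ω') (M' : Economy J c 𝒴 Ω') (κ' : Kernel ℝ Ω'),
    M'.IsCondVersion j κ' ∧ M.SameObservables M' j ∧
    M'.ContinuousTypes κ' j 𝒢 ∧ M'.SharpSets κ' j ∧ M'.RegularSets κ' j 𝒢 Λp Λm ∧
    ∀ q, ∀ d, (d = q.1 ∨ d = q.2) → ν q d = M'.jointLaw κ' j q d

end LocalPref

end

/-! Necessity. For almost every score `s`, given `S_j = s` the tied schools are all available if `c
j ≤ s` and all unavailable if `s < c j`. So a student with `Q_j = (b, b')` shows `Y(b)` on the right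
of the cutoff and `Y(b')` on the left. As `Q_j` lies in the constructed set almost surely, `{Y ∈ A,
𝐐_j ⊆ B}` is covered, up to a null set, by the events `{Q_j = q, Y(sel q) ∈ A}` with `q ∈ B`.
Continuity of types carries the resulting bound to the limit (`IsSide.inequality`). An economy with
the same observables has the same one-sided limits: the conditional versions agree a.e., and since
the cutoff is interior to the support, they agree at scores arbitrarily close to it on each side
(`SameObservables.limit_eq`).

Sufficiency. On one side, the limits of `P[Y ∈ ·, 𝐐_j = D | S_j = s]` are measures `μ D`, and the
inequalities are Hall's condition for shipping the supplies `μ D` to the members of `D` within the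
capacities `ν`. At the level of densities this is a finite supply-demand problem at every outcome
`y`, and a greedy solution is measurable in `y` (`exists_shipment`). Supplies and capacities both
have total mass one, so the capacities are exhausted (`exists_transport`). The resulting fractions
`f D q y` split the observed conditional law at every nearby score, and the split laws converge to
`ν` (`IsSide.exists_split`).

Two adjustments give a legitimate version. A uniform component whose weight vanishes at the cutoff
gives every `q ∈ D` positive probability, as sharpness demands, without changing the limits
(`share`). At the cutoff, a null point, the law is set to the right-hand candidate, and on a null
set of exceptional scores the observed law is replaced by the one at the cutoff (`splitKernel`,
`obsKernel`).

A split becomes an economy (`Split.design`, `Design.economy`) as follows. The unobserved one of the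
two local outcomes is drawn independently from the normalized candidate, which makes the law of
every potential outcome continuous across the cutoff (`ConvergesTo.tendsto_potentialLaw`). Each
local preference is spread over preferences and availabilities in the proportions found in `M`.
Untied scores are put on the prescribed side of their cutoffs at an independent noisy distance. -/

noncomputable section

namespace LocalPref

/-! ### Finite supply-demand problems with a measurable parameter. -/

section Transport

variable {ι : Type*} {α : Type*} [MeasurableSpace α]

/-- The excess of the capacity of `B` over the mass that can only be shipped into `B`. -/
def slack (m : Finset ι → ℝ) (n : ι → ℝ) (B : Finset ι) : ℝ :=
  ∑ q ∈ B, n q - ∑ D ∈ B.powerset, m D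

theorem slack_sub (m m' : Finset ι → ℝ) (n n' : ι → ℝ) (B : Finset ι) :
    slack (fun D => m D - m' D) (fun q => n q - n' q) B = slack m n B - slack m' n' B := by
  simp only [slack, Finset.sum_sub_distrib]; ring

theorem measurable_slack {m : Finset ι → α → ℝ} {n : ι → α → ℝ} (hm : ∀ D, Measurable (m D))
    (hn : ∀ q, Measurable (n q)) (B : Finset ι) :
    Measurable fun y => slack (fun D => m D y) (fun q => n q y) B := by
  unfold slack
  fun_prop

variable [DecidableEq ι]

/-- Submodularity of the slack with its defect made explicit: the defect is the mass of the sets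
that fit into the union but into neither piece. -/
theorem slack_union_add_inter (m : Finset ι → ℝ) (n : ι → ℝ) (B₁ B₂ : Finset ι) :
    slack m n (B₁ ∪ B₂) + slack m n (B₁ ∩ B₂) +
      ∑ D ∈ (B₁ ∪ B₂).powerset \ (B₁.powerset ∪ B₂.powerset), m D =
        slack m n B₁ + slack m n B₂ := by
  have hn : ∑ q ∈ B₁ ∪ B₂, n q + ∑ q ∈ B₁ ∩ B₂, n q = ∑ q ∈ B₁, n q + ∑ q ∈ B₂, n q :=
    Finset.sum_union_inter
  have hm : ∑ E ∈ B₁.powerset ∪ B₂.powerset, m E + ∑ E ∈ B₁.powerset ∩ B₂.powerset, m E =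
      ∑ E ∈ B₁.powerset, m E + ∑ E ∈ B₂.powerset, m E := Finset.sum_union_inter
  have hsub : B₁.powerset ∪ B₂.powerset ⊆ (B₁ ∪ B₂).powerset :=
    Finset.union_subset (Finset.powerset_mono.2 Finset.subset_union_left)
      (Finset.powerset_mono.2 Finset.subset_union_right)
  have hd := Finset.sum_sdiff (f := m) hsub
  have hi : B₁.powerset ∩ B₂.powerset = (B₁ ∩ B₂).powerset := by
    ext E; simp only [Finset.mem_inter, Finset.mem_powerset, Finset.subset_inter_iff]
  rw [hi] at hm
  unfold slack
  linarith

/-- If nothing more can be shipped, everything has been shipped. -/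
theorem eq_zero_of_tight {m : Finset ι → ℝ} {n : ι → ℝ} (hm : ∀ D, 0 ≤ m D)
    (hall : ∀ B, 0 ≤ slack m n B) {D : Finset ι}
    (ht : ∀ q ∈ D, m D = 0 ∨ ∃ B, q ∈ B ∧ ¬ D ⊆ B ∧ slack m n B = 0) : m D = 0 := by
  by_contra hne
  have hpos : 0 < m D := lt_of_le_of_ne (hm D) (Ne.symm hne)
  -- The tight sets attached to single members of `D` are merged one at a time; at `S = D` the
  -- merged set would contain `D` and not contain it.
  have key : ∀ S : Finset ι, S ⊆ D → S.Nonempty → ∃ B, S ⊆ B ∧ ¬ D ⊆ B ∧ slack m n B = 0 := by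
    intro S
    induction S using Finset.induction_on with
    | empty => simp
    | insert a S ha ih =>
      intro hS _
      obtain ⟨B₂, haB, hDB₂, h₂⟩ := (ht a (hS (Finset.mem_insert_self a S))).resolve_left hne
      rcases S.eq_empty_or_nonempty with rfl | hSne
      · exact ⟨B₂, by simpa using haB, hDB₂, h₂⟩
      obtain ⟨B₁, hSB, hDB₁, h₁⟩ := ih ((Finset.subset_insert a S).trans hS) hSne
      refine ⟨B₁ ∪ B₂, ?_, ?_, ?_⟩
      · exact Finset.insert_subset (Finset.mem_union_right _ haB)
          (hSB.trans Finset.subset_union_left)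
      -- If the union swallowed `D`, then `m D > 0` would be part of the submodularity defect,
      -- whereas two tight sets leave no room for one.
      · intro hD
        have e := slack_union_add_inter m n B₁ B₂
        have hle := Finset.single_le_sum (f := m) (fun E _ => hm E)
          (show D ∈ (B₁ ∪ B₂).powerset \ (B₁.powerset ∪ B₂.powerset) by
            simp only [Finset.mem_sdiff, Finset.mem_union, Finset.mem_powerset]; tauto)
        have := hall (B₁ ∪ B₂)
        have := hall (B₁ ∩ B₂)
        linarith
      · have e := slack_union_add_inter m n B₁ B₂
        have := Finset.sum_nonneg (s := (B₁ ∪ B₂).powerset \ (B₁.powerset ∪ B₂.powerset))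
          fun E _ => hm E
        have := hall (B₁ ∪ B₂)
        have := hall (B₁ ∩ B₂)
        linarith
  rcases D.eq_empty_or_nonempty with rfl | hDne
  · have := hall ∅
    simp [slack] at this
    linarith
  · obtain ⟨B, h, h', -⟩ := key D subset_rfl hDne
    exact h' h

/-- Shipping `t` from `D` to `q` costs `B` slack only if `B` loses the capacity at `q` without being
relieved of the mass of `D`. These are the only constraints that limit a shipment. -/
theorem slack_single (D : Finset ι) (q : ι) (hq : q ∈ D) (t : ℝ) (B : Finset ι) :
    slack (fun E => if E = D then t else 0) (fun p => if p = q then t else 0) B =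
      if q ∈ B ∧ ¬ D ⊆ B then t else 0 := by
  simp only [slack, Finset.sum_ite_eq', Finset.mem_powerset]
  by_cases h₁ : q ∈ B <;> by_cases h₂ : D ⊆ B <;> simp [h₁, h₂]
  exact absurd (h₂ hq) h₁

variable [Fintype ι]

/-- The mass that is left after shipping `t`. -/
abbrev leftMass (m : Finset ι → α → ℝ) (t : Finset ι → ι → α → ℝ) (y : α) (D : Finset ι) : ℝ :=
  m D y - ∑ q, t D q y

/-- The capacity that is left after shipping `t`. -/
abbrev leftCap (n : ι → α → ℝ) (t : Finset ι → ι → α → ℝ) (y : α) (q : ι) : ℝ :=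
  n q y - ∑ D, t D q y

/-- Greedy shipping: each listed pair `(D, q)` ships as much as Hall's condition on the remainder
permits, so that either `D` is exhausted or some set becomes tight. Left masses and slacks stay
nonnegative and never increase, so earlier pairs stay blocked. Each amount is a minimum of finitely
many measurable functions. -/
theorem exists_partial_shipment {m : Finset ι → α → ℝ} {n : ι → α → ℝ}
    (hm : ∀ D, Measurable (m D)) (hn : ∀ q, Measurable (n q)) (hm0 : ∀ D y, 0 ≤ m D y)
    (hall : ∀ y B, 0 ≤ slack (fun D => m D y) (fun q => n q y) B) (L : List (Finset ι × ι))
    (hL : ∀ p ∈ L, p.2 ∈ p.1) :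
    ∃ t : Finset ι → ι → α → ℝ, (∀ D q, Measurable (t D q)) ∧ (∀ D q y, 0 ≤ t D q y) ∧
      (∀ D q, q ∉ D → ∀ y, t D q y = 0) ∧ (∀ D y, 0 ≤ leftMass m t y D) ∧
      (∀ y B, 0 ≤ slack (leftMass m t y) (leftCap n t y) B) ∧
      ∀ p ∈ L, ∀ y, leftMass m t y p.1 = 0 ∨
        ∃ B, p.2 ∈ B ∧ ¬ p.1 ⊆ B ∧ slack (leftMass m t y) (leftCap n t y) B = 0 := by
  induction L with
  | nil =>
    exact ⟨fun _ _ _ => 0, by simp, by simp, by simp, by simpa [leftMass] using hm0,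
      fun y B => by simpa [slack, leftMass, leftCap] using hall y B, by simp⟩
  | cons p L ih =>
    obtain ⟨t, ht, ht0, hts, hl, hh, htight⟩ := ih fun p hp => hL p (List.mem_cons_of_mem _ hp)
    have hp := hL p List.mem_cons_self
    -- Sets that do not constrain the pair receive the bound `leftMass`, so one infimum over all
    -- sets, `Finset.univ` among them, covers both reasons to stop.
    let h : Finset ι → α → ℝ := fun B y =>
      if p.2 ∈ B ∧ ¬ p.1 ⊆ B then min (leftMass m t y p.1) (slack (leftMass m t y) (leftCap n t y) B)
      else leftMass m t y p.1
    have hmeasM : ∀ D, Measurable fun y => leftMass m t y D := fun D => by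
      unfold leftMass; fun_prop
    have hmeasC : ∀ q, Measurable fun y => leftCap n t y q := fun q => by
      unfold leftCap; fun_prop
    have hmeash : ∀ B, Measurable (h B) := by
      intro B
      by_cases hB : p.2 ∈ B ∧ ¬ p.1 ⊆ B
      · simp only [h, hB, not_false_eq_true, and_self, if_true]
        exact (hmeasM p.1).min (measurable_slack hmeasM hmeasC B)
      · simp only [h, hB, if_false]
        exact hmeasM p.1
    let τ : α → ℝ := fun y => Finset.univ.inf' Finset.univ_nonempty fun B => h B y
    have hτm : Measurable τ := by
      have : Measurable (Finset.univ.inf' Finset.univ_nonempty h) :=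
        Finset.inf'_induction _ _ (fun _ hf _ hg => hf.inf hg) fun B _ => hmeash B
      convert this using 1
      ext y; simp [τ]
    have hτ0 : ∀ y, 0 ≤ τ y := fun y => Finset.le_inf' _ _ fun B _ => by
      simp only [h]; split_ifs
      · exact le_min (hl _ _) (hh _ _)
      · exact hl _ _
    have hτB : ∀ y B, p.2 ∈ B → ¬ p.1 ⊆ B →
        τ y ≤ slack (leftMass m t y) (leftCap n t y) B := fun y B h₁ h₂ =>
      (Finset.inf'_le _ (Finset.mem_univ B)).trans (by simp [h, h₁, h₂])
    have hτD : ∀ y, τ y ≤ leftMass m t y p.1 := fun y =>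
      (Finset.inf'_le _ (Finset.mem_univ Finset.univ)).trans (by simp [h])
    have hτt : ∀ y, τ y = leftMass m t y p.1 ∨ ∃ B, p.2 ∈ B ∧ ¬ p.1 ⊆ B ∧
        τ y = slack (leftMass m t y) (leftCap n t y) B := by
      intro y
      obtain ⟨B, -, hB⟩ := Finset.exists_mem_eq_inf' Finset.univ_nonempty fun B => h B y
      change τ y = h B y at hB
      by_cases hB' : p.2 ∈ B ∧ ¬ p.1 ⊆ B
      · simp only [h, hB', not_false_eq_true, and_self, if_true] at hB
        rcases min_choice (leftMass m t y p.1) (slack (leftMass m t y) (leftCap n t y) B) with e | e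
        · exact Or.inl (hB.trans e)
        · exact Or.inr ⟨B, hB'.1, hB'.2, hB.trans e⟩
      · simp only [h, hB', if_false] at hB
        exact Or.inl hB
    let t' : Finset ι → ι → α → ℝ := fun D q y =>
      t D q y + if D = p.1 ∧ q = p.2 then τ y else 0
    have eM : ∀ y D, leftMass m t' y D = leftMass m t y D - if D = p.1 then τ y else 0 := by
      intro y D
      simp only [leftMass, t', Finset.sum_add_distrib]
      by_cases hD : D = p.1 <;> simp [hD]; ring
    have eC : ∀ y q, leftCap n t' y q = leftCap n t y q - if q = p.2 then τ y else 0 := by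
      intro y D
      simp only [leftCap, t', Finset.sum_add_distrib]
      by_cases hD : D = p.2 <;> simp [hD]; ring
    have eS : ∀ y B, slack (leftMass m t' y) (leftCap n t' y) B =
        slack (leftMass m t y) (leftCap n t y) B - if p.2 ∈ B ∧ ¬ p.1 ⊆ B then τ y else 0 := by
      intro y B
      rw [← slack_single p.1 p.2 hp, ← slack_sub]
      congr 1
      · funext D; exact eM y D
      · funext q; exact eC y q
    have hh' : ∀ y B, 0 ≤ slack (leftMass m t' y) (leftCap n t' y) B := by
      intro y B
      rw [eS]
      split_ifs with hB
      · linarith [hτB y B hB.1 hB.2]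
      · linarith [hh y B]
    have hl' : ∀ D y, 0 ≤ leftMass m t' y D := by
      intro D y
      rw [eM]
      split_ifs with hD
      · subst hD; linarith [hτD y]
      · linarith [hl D y]
    refine ⟨t', ?_, ?_, ?_, hl', hh', ?_⟩
    · intro D q
      by_cases hDq : D = p.1 ∧ q = p.2
      · obtain ⟨rfl, rfl⟩ := hDq
        simpa [t'] using (ht p.1 p.2).fun_add hτm
      · simpa [t', hDq] using ht D q
    · intro D q y
      simp only [t']
      split_ifs
      · exact add_nonneg (ht0 _ _ _) (hτ0 y)
      · simpa using ht0 D q y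
    · intro D q hq y
      have : ¬ (D = p.1 ∧ q = p.2) := by rintro ⟨rfl, rfl⟩; exact hq hp
      simp [t', this, hts D q hq y]
    · intro p' hp' y
      rcases List.mem_cons.1 hp' with rfl | hp'
      · rcases hτt y with e | ⟨B, h₁, h₂, e⟩
        · left; rw [eM]; simp [e]
        · right; refine ⟨B, h₁, h₂, ?_⟩
          rw [eS]; simp [h₁, h₂, e]
      · rcases htight p' hp' y with e | ⟨B, h₁, h₂, e⟩
        · left
          refine le_antisymm ?_ (hl' _ _)
          rw [eM, e]; split_ifs <;> linarith [hτ0 y]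
        · right; refine ⟨B, h₁, h₂, le_antisymm ?_ (hh' _ _)⟩
          rw [eS, e]; split_ifs <;> linarith [hτ0 y]

/-- A measurable supply-demand theorem: under Hall's condition at every point, the supplies `m D`
can be shipped to the members of `D` within the capacities, measurably. -/
theorem exists_shipment {m : Finset ι → α → ℝ} {n : ι → α → ℝ}
    (hm : ∀ D, Measurable (m D)) (hn : ∀ q, Measurable (n q)) (hm0 : ∀ D y, 0 ≤ m D y)
    (hall : ∀ y B, 0 ≤ slack (fun D => m D y) (fun q => n q y) B) :
    ∃ t : Finset ι → ι → α → ℝ, (∀ D q, Measurable (t D q)) ∧ (∀ D q y, 0 ≤ t D q y) ∧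
      (∀ D q, q ∉ D → ∀ y, t D q y = 0) ∧ (∀ D y, ∑ q, t D q y = m D y) ∧
      ∀ q y, ∑ D, t D q y ≤ n q y := by
  obtain ⟨t, ht, ht0, hts, hl, hh, htight⟩ := exists_partial_shipment hm hn hm0 hall
    (Finset.univ.filter fun p : Finset ι × ι => p.2 ∈ p.1).toList (by simp)
  have hz : ∀ D y, leftMass m t y D = 0 := fun D y =>
    eq_zero_of_tight (fun D => hl D y) (hh y) fun q hq => htight (D, q) (by simpa using hq) y
  refine ⟨t, ht, ht0, hts, fun D y => by linarith [hz D y], fun q y => ?_⟩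
  -- With nothing left to ship, the slack of a singleton is just its remaining capacity.
  have := hh y {q}
  rw [slack, Finset.sum_eq_zero (s := Finset.powerset {q}) fun D _ => hz D y] at this
  simp only [Finset.sum_singleton, leftCap] at this
  linarith

end Transport

end LocalPref
namespace LocalPref

/-! ### Transport between measures, setwise limits, and a.e. properties near the cutoff. -/

section MeasureTools

variable {α : Type*} [MeasurableSpace α]

theorem exists_measurable_density {μ Λ : Measure α} [IsFiniteMeasure μ] [IsFiniteMeasure Λ]
    (h : μ ≪ Λ) : ∃ f : α → ℝ, Measurable f ∧ (∀ y, 0 ≤ f y) ∧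
      μ = Λ.withDensity fun y => ENNReal.ofReal (f y) := by
  refine ⟨fun y => (μ.rnDeriv Λ y).toReal, (Measure.measurable_rnDeriv μ Λ).ennreal_toReal,
    fun _ => ENNReal.toReal_nonneg, ?_⟩
  conv_lhs => rw [← Measure.withDensity_rnDeriv_eq μ Λ h]
  refine withDensity_congr_ae ?_
  filter_upwards [Measure.rnDeriv_lt_top μ Λ] with y hy
  rw [ENNReal.ofReal_toReal hy.ne]

/-- A version of the supply-demand theorem for measures: if the measures `μ D` satisfy Hall's
condition for the capacities `n q`, of the same total mass, then each `μ D` can be split among the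
members of `D` so that the capacities are used exactly. -/
theorem exists_transport {ι : Type*} [Fintype ι] [DecidableEq ι] (μ : Finset ι → Measure α)
    (n : ι → Measure α) [∀ D, IsFiniteMeasure (μ D)] [∀ q, IsFiniteMeasure (n q)]
    (hall : ∀ B A, MeasurableSet A → ∑ D ∈ B.powerset, μ D A ≤ ∑ q ∈ B, n q A)
    (mass : ∑ D, μ D Set.univ = ∑ q, n q Set.univ) :
    ∃ f : Finset ι → ι → α → ℝ, (∀ D q, Measurable (f D q)) ∧ (∀ D q y, 0 ≤ f D q y) ∧
      (∀ D q, q ∉ D → ∀ y, f D q y = 0) ∧ (∀ D, D.Nonempty → ∀ y, ∑ q, f D q y = 1) ∧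
      ∀ q A, MeasurableSet A → ∑ D, ∫⁻ y in A, ENNReal.ofReal (f D q y) ∂(μ D) = n q A := by
  classical
  let Λ : Measure α := ∑ D, μ D + ∑ q, n q
  have hμΛ : ∀ D, μ D ≪ Λ := fun D => Measure.absolutelyContinuous_of_le <|
    (Finset.single_le_sum (f := μ) (fun _ _ => Measure.zero_le _) (Finset.mem_univ D)).trans
      (Measure.le_add_right le_rfl)
  have hnΛ : ∀ q, n q ≪ Λ := fun q => Measure.absolutelyContinuous_of_le <|
    (Finset.single_le_sum (f := n) (fun _ _ => Measure.zero_le _) (Finset.mem_univ q)).trans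
      (Measure.le_add_left le_rfl)
  choose m₀ hm₀ hm₀0 hm₀e using fun D => exists_measurable_density (hμΛ D)
  choose n₀ hn₀ hn₀0 hn₀e using fun q => exists_measurable_density (hnΛ q)
  -- Hall's condition for the densities holds off a null set, there being only finitely many `B`.
  -- Setting all densities to zero there makes it hold at every point.
  let H : Set α := {y | ∀ B, 0 ≤ slack (fun D => m₀ D y) (fun q => n₀ q y) B}
  have hH : MeasurableSet H := by
    simp only [H, Set.ofPred_forall]
    exact MeasurableSet.iInter fun B => measurableSet_le measurable_const
      (measurable_slack hm₀ hn₀ B)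
  have hHae : ∀ᵐ y ∂Λ, y ∈ H := by
    simp only [H, Set.mem_ofPred_eq]
    rw [ae_all_iff]
    intro B
    have key : (fun y => ∑ D ∈ B.powerset, ENNReal.ofReal (m₀ D y)) ≤ᵐ[Λ]
        fun y => ∑ q ∈ B, ENNReal.ofReal (n₀ q y) := by
      refine ae_le_of_forall_setLIntegral_le_of_sigmaFinite (by fun_prop) fun A hA _ => ?_
      rw [lintegral_finsetSum _ (by fun_prop), lintegral_finsetSum _ (by fun_prop)]
      have := hall B A hA
      simp_rw [hm₀e, hn₀e, withDensity_apply _ hA] at this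
      exact this
    filter_upwards [key] with y hy
    rw [← ENNReal.ofReal_sum_of_nonneg fun D _ => hm₀0 D y,
      ← ENNReal.ofReal_sum_of_nonneg fun q _ => hn₀0 q y,
      ENNReal.ofReal_le_ofReal_iff (Finset.sum_nonneg fun q _ => hn₀0 q y)] at hy
    unfold slack
    linarith
  let m : Finset ι → α → ℝ := fun D => H.indicator (m₀ D)
  let k : ι → α → ℝ := fun q => H.indicator (n₀ q)
  have hmm : ∀ D, Measurable (m D) := fun D => (hm₀ D).indicator hH
  have hkm : ∀ q, Measurable (k q) := fun q => (hn₀ q).indicator hH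
  have hm0 : ∀ D y, 0 ≤ m D y := fun D y => Set.indicator_nonneg (fun y _ => hm₀0 D y) y
  have hmk : ∀ y B, 0 ≤ slack (fun D => m D y) (fun q => k q y) B := by
    intro y B
    by_cases hy : y ∈ H
    · simpa [m, k, hy] using hy B
    · simp [m, k, hy, slack]
  have hμe : ∀ D, μ D = Λ.withDensity fun y => ENNReal.ofReal (m D y) := fun D => by
    rw [hm₀e D]
    refine withDensity_congr_ae ?_
    filter_upwards [hHae] with y hy
    simp [m, hy]
  have hne : ∀ q, n q = Λ.withDensity fun y => ENNReal.ofReal (k q y) := fun q => by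
    rw [hn₀e q]
    refine withDensity_congr_ae ?_
    filter_upwards [hHae] with y hy
    simp [k, hy]
  obtain ⟨t, ht, ht0, hts, htm, htn⟩ := exists_shipment hmm hkm hm0 hmk
  -- Where the supply density vanishes the fractions are arbitrary; the uniform choice on `D` keeps
  -- their sum equal to one everywhere.
  let f : Finset ι → ι → α → ℝ := fun D q y =>
    if m D y = 0 then (if q ∈ D then (D.card : ℝ)⁻¹ else 0) else t D q y / m D y
  have hf : ∀ D q, Measurable (f D q) := fun D q =>
    Measurable.ite (hmm D (measurableSet_singleton 0)) measurable_const ((ht D q).div (hmm D))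
  have hf0 : ∀ D q y, 0 ≤ f D q y := by
    intro D q y
    simp only [f]
    split_ifs
    · exact inv_nonneg.2 (Nat.cast_nonneg _)
    · exact le_rfl
    · exact div_nonneg (ht0 D q y) (hm0 D y)
  have hft : ∀ D q y, m D y * f D q y = t D q y := by
    intro D q y
    by_cases h : m D y = 0
    · have h1 := htm D y
      rw [h] at h1
      rw [h, zero_mul]
      exact ((Finset.sum_eq_zero_iff_of_nonneg fun q _ => ht0 D q y).1 h1 q
        (Finset.mem_univ q)).symm
    · change m D y * (if m D y = 0 then _ else t D q y / m D y) = _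
      rw [if_neg h, mul_div_cancel₀ _ h]
  have hint : ∀ D q A, MeasurableSet A → ∫⁻ y in A, ENNReal.ofReal (f D q y) ∂(μ D) =
      ∫⁻ y in A, ENNReal.ofReal (t D q y) ∂Λ := by
    intro D q A hA
    rw [hμe D, setLIntegral_withDensity_eq_setLIntegral_mul Λ (hmm D).ennreal_ofReal
      (hf D q).ennreal_ofReal hA]
    refine lintegral_congr fun y => ?_
    rw [Pi.mul_apply, ← ENNReal.ofReal_mul (hm0 D y), hft]
  have hle : ∀ q A, MeasurableSet A →
      ∑ D, ∫⁻ y in A, ENNReal.ofReal (f D q y) ∂(μ D) ≤ n q A := by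
    intro q A hA
    simp_rw [hint _ q A hA]
    rw [← lintegral_finsetSum _ (fun D _ => (ht D q).ennreal_ofReal), hne q,
      withDensity_apply _ hA]
    refine lintegral_mono fun y => ?_
    rw [← ENNReal.ofReal_sum_of_nonneg fun D _ => ht0 D q y]
    exact ENNReal.ofReal_le_ofReal (htn q y)
  have hsum1 : ∀ D, D.Nonempty → ∀ y, ∑ q, f D q y = 1 := by
    intro D hD y
    by_cases h : m D y = 0
    · simp only [f, h, if_true, Finset.sum_ite_mem, Finset.univ_inter, Finset.sum_const,
        nsmul_eq_mul]
      exact mul_inv_cancel₀ (by exact_mod_cast hD.card_ne_zero)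
    · simp only [f, h, if_false]
      rw [← Finset.sum_div, htm, div_self h]
  -- The empty set has no members to ship to and its fractions sum to zero; Hall's condition at `∅`
  -- shows that it carries no mass.
  have hμ0 : μ ∅ = 0 := by
    have := hall ∅ Set.univ MeasurableSet.univ
    simpa using this
  have htot : ∑ q, ∑ D, ∫⁻ y, ENNReal.ofReal (f D q y) ∂(μ D) = ∑ q, n q Set.univ := by
    rw [Finset.sum_comm, ← mass]
    refine Finset.sum_congr rfl fun D _ => ?_
    rcases D.eq_empty_or_nonempty with rfl | hD
    · simp [hμ0]
    · rw [← lintegral_finsetSum _ (fun q _ => (hf D q).ennreal_ofReal)]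
      simp_rw [← ENNReal.ofReal_sum_of_nonneg fun q _ => hf0 D q _, hsum1 D hD]
      simp
  have hfin : ∀ q, n q Set.univ ≠ ∞ := fun q => measure_ne_top _ _
  -- Each received mass is at most its capacity and the finite totals agree, so none falls short.
  have huniv : ∀ q, ∑ D, ∫⁻ y, ENNReal.ofReal (f D q y) ∂(μ D) = n q Set.univ := by
    intro q
    by_contra hne
    have hleu : ∀ q, ∑ D, ∫⁻ y, ENNReal.ofReal (f D q y) ∂(μ D) ≤ n q Set.univ := fun q => by
      simpa using hle q Set.univ MeasurableSet.univ
    refine (?_ : ∑ q, ∑ D, ∫⁻ y, ENNReal.ofReal (f D q y) ∂(μ D) < ∑ q, n q Set.univ).ne htot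
    rw [← Finset.add_sum_erase _ _ (Finset.mem_univ q),
      ← Finset.add_sum_erase _ (fun q => n q Set.univ) (Finset.mem_univ q)]
    refine ENNReal.add_lt_add_of_lt_of_le ?_ (lt_of_le_of_ne (hleu q) hne)
      (Finset.sum_le_sum fun q _ => hleu q)
    exact ne_top_of_le_ne_top (ENNReal.sum_ne_top.2 fun q _ => hfin q)
      (Finset.sum_le_sum fun q _ => hleu q)
  refine ⟨f, hf, hf0, ?_, hsum1, ?_⟩
  · intro D q hq y
    simp only [f, hq, if_false, hts D q hq y, zero_div, ite_self]
  · intro q A hA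
    refine le_antisymm (hle q A hA) ?_
    -- Equality on the whole space, with inequalities on `A` and on its complement, forces equality
    -- on `A`.
    have h1 := hle q Aᶜ hA.compl
    have h2 : ∑ D, ∫⁻ y in A, ENNReal.ofReal (f D q y) ∂(μ D) +
        ∑ D, ∫⁻ y in Aᶜ, ENNReal.ofReal (f D q y) ∂(μ D) = n q A + n q Aᶜ := by
      rw [← Finset.sum_add_distrib, measure_add_measure_compl hA, ← huniv q]
      exact Finset.sum_congr rfl fun D _ => lintegral_add_compl _ hA
    by_contra hlt
    push Not at hlt
    exact (ENNReal.add_lt_add_of_lt_of_le (ne_top_of_le_ne_top (measure_ne_top _ _) h1) hlt h1).ne h2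

/-- Finite additivity survives setwise limits; domination by the finite measure `N` sends the tails
of a disjoint union to zero, which upgrades it to countable additivity. -/
theorem exists_measure_of_tendsto {β : Type*} {l : Filter β} [l.NeBot] {μ : β → Measure α}
    {N : Measure α} [IsFiniteMeasure N] {L : Set α → ℝ≥0∞}
    (h : ∀ A, MeasurableSet A → Tendsto (fun i => μ i A) l (𝓝 (L A)))
    (hle : ∀ A, MeasurableSet A → L A ≤ N A) :
    ∃ ν : Measure α, IsFiniteMeasure ν ∧ ∀ A, MeasurableSet A → ν A = L A := by
  have h0 : L ∅ = 0 := by simpa using hle ∅ MeasurableSet.empty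
  have hadd : ∀ A B, MeasurableSet A → MeasurableSet B → Disjoint A B → L (A ∪ B) = L A + L B := by
    intro A B hA hB hd
    refine tendsto_nhds_unique (h _ (hA.union hB)) ?_
    simp_rw [measure_union hd hB]
    exact (h A hA).add (h B hB)
  have hU : ∀ ⦃f : ℕ → Set α⦄, (∀ i, MeasurableSet (f i)) → Pairwise (Function.onFun Disjoint f) →
      L (⋃ i, f i) = ∑' i, L (f i) := by
    intro f hf hd
    have hacc : ∀ k, MeasurableSet (⋃ i ∈ Finset.range k, f i) := fun k =>
      Finset.measurableSet_biUnion _ fun i _ => hf i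
    have hfin : ∀ k, L (⋃ i ∈ Finset.range k, f i) = ∑ i ∈ Finset.range k, L (f i) := by
      intro k
      refine tendsto_nhds_unique (h _ (hacc k)) ?_
      simp_rw [measure_biUnion_finset (s := Finset.range k) (fun i _ j _ hij => hd hij)
        (fun i _ => hf i)]
      exact tendsto_finsetSum _ fun i _ => h _ (hf i)
    have hfU := MeasurableSet.iUnion hf
    have htail : Tendsto (fun k => L ((⋃ i, f i) \ ⋃ i ∈ Finset.range k, f i)) atTop (𝓝 0) := by
      have hN : Tendsto (fun k => N ((⋃ i, f i) \ ⋃ i ∈ Finset.range k, f i)) atTop (𝓝 0) := by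
        have hanti : Antitone fun k => (⋃ i, f i) \ ⋃ i ∈ Finset.range k, f i := by
          intro a b hab
          exact Set.sdiff_subset_sdiff_right
            (Set.biUnion_subset_biUnion_left (Finset.range_subset_range.2 hab))
        have he : ⋂ k, ((⋃ i, f i) \ ⋃ i ∈ Finset.range k, f i) = ∅ := by
          ext x
          simp only [Set.mem_iInter, Set.mem_sdiff, Set.mem_iUnion, Finset.mem_range,
            Set.mem_empty_iff_false, iff_false]
          intro hx
          obtain ⟨i, hi⟩ := (hx 0).1
          exact (hx (i + 1)).2 ⟨i, Nat.lt_succ_self i, hi⟩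
        have := tendsto_measure_iInter_atTop (μ := N)
          (fun k => (hfU.diff (hacc k)).nullMeasurableSet) hanti ⟨0, measure_ne_top _ _⟩
        rwa [he, measure_empty] at this
      exact tendsto_of_tendsto_of_tendsto_of_le_of_le tendsto_const_nhds hN (fun _ => zero_le)
        fun k => hle _ (hfU.diff (hacc k))
    have hsum : ∀ k, L (⋃ i, f i) =
        ∑ i ∈ Finset.range k, L (f i) + L ((⋃ i, f i) \ ⋃ i ∈ Finset.range k, f i) := by
      intro k
      rw [← hfin, ← hadd _ _ (hacc k) (hfU.diff (hacc k)) Set.disjoint_sdiff_right,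
        Set.union_sdiff_cancel]
      exact Set.iUnion₂_subset fun i _ => Set.subset_iUnion f i
    have hlim := (ENNReal.tendsto_nat_tsum fun i => L (f i)).add htail
    rw [add_zero] at hlim
    refine tendsto_nhds_unique ?_ hlim
    simp_rw [← hsum]
    exact tendsto_const_nhds
  refine ⟨Measure.ofMeasurable (fun A _ => L A) h0 (fun f hf hd => hU hf hd), ⟨?_⟩, fun A hA => ?_⟩
  · rw [Measure.ofMeasurable_apply _ MeasurableSet.univ]
    exact (hle _ MeasurableSet.univ).trans_lt (measure_lt_top _ _)
  · rw [Measure.ofMeasurable_apply _ hA]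

/-- Setwise convergence of finite measures implies the convergence of the integrals of bounded
measurable functions. -/
theorem tendsto_integral_of_tendsto_measure {β : Type*} {l : Filter β} [l.IsCountablyGenerated]
    {μ : β → Measure α} {ν : Measure α} [∀ i, IsFiniteMeasure (μ i)] [IsFiniteMeasure ν]
    (h : ∀ A, MeasurableSet A → Tendsto (fun i => μ i A) l (𝓝 (ν A))) {f : α → ℝ}
    (hf : Measurable f) {K : ℝ} (hK : ∀ y, |f y| ≤ K) :
    Tendsto (fun i => ∫ y, f y ∂(μ i)) l (𝓝 (∫ y, f y ∂ν)) := by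
  have hreal : ∀ A, MeasurableSet A → Tendsto (fun i => (μ i).real A) l (𝓝 (ν.real A)) :=
    fun A hA => (ENNReal.tendsto_toReal (measure_ne_top _ _)).comp (h A hA)
  have hi : ∀ (m : Measure α) [IsFiniteMeasure m], Integrable f m := fun m _ =>
    Integrable.of_bound hf.aestronglyMeasurable K (ae_of_all _ fun y => hK y)
  -- Layer cake for `f + K ≥ 0`: the integral becomes one over levels of measures of sets, which
  -- converge by assumption. Levels above `2 * K` contribute nothing, so dominated convergence
  -- applies.
  have e : ∀ (m : Measure α) [IsFiniteMeasure m], ∫ y, f y ∂m =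
      (∫ t in Set.Ioi 0, m.real {y | t < f y + K}) - m.real Set.univ * K := by
    intro m _
    have := Integrable.integral_eq_integral_meas_lt ((hi m).add (integrable_const K))
      (ae_of_all _ fun y => by have := neg_le_of_abs_le (hK y); simp; linarith)
    simp only [Pi.add_apply] at this
    rw [← this, integral_add (hi m) (integrable_const K), integral_const, smul_eq_mul]
    ring
  simp_rw [e]
  refine Tendsto.sub ?_ ((hreal _ MeasurableSet.univ).mul_const K)
  refine tendsto_integral_filter_of_dominated_convergence
    ((Set.Ioc 0 (2 * K)).indicator fun _ => ν.real Set.univ + 1) ?_ ?_ ?_ ?_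
  · refine Eventually.of_forall fun i => Measurable.aestronglyMeasurable ?_
    refine Antitone.measurable fun s t hst => ?_
    exact measureReal_mono (fun y (hy : t < _) => lt_of_le_of_lt hst hy)
  · have := (hreal _ MeasurableSet.univ).eventually (gt_mem_nhds (lt_add_one (ν.real Set.univ)))
    filter_upwards [this] with i hi'
    refine (ae_restrict_mem measurableSet_Ioi).mono fun t ht => ?_
    rw [Real.norm_of_nonneg measureReal_nonneg]
    by_cases ht2 : t ≤ 2 * K
    · rw [Set.indicator_of_mem (show t ∈ Set.Ioc 0 (2 * K) from ⟨ht, ht2⟩)]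
      exact (measureReal_mono (Set.subset_univ _)).trans hi'.le
    · have : {y | t < f y + K} = ∅ := by
        ext y
        have := le_of_abs_le (hK y)
        simp only [Set.mem_ofPred_eq, Set.mem_empty_iff_false, iff_false, not_lt]
        linarith
      rw [this, measureReal_empty]
      exact Set.indicator_nonneg (fun _ _ => by positivity) _
  · refine (IntegrableOn.integrable_indicator ?_ measurableSet_Ioc).integrableOn
    exact integrableOn_const measure_Ioc_lt_top.ne
  · exact ae_of_all _ fun t => hreal _ (measurableSet_lt measurable_const (hf.add_const K))

/-- Every short interval to the right of `c` has positive measure, so an a.e. property cannot fail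
on all of it. This is how a.e. identities between versions reach one-sided limits. -/
theorem frequently_nhdsGT_of_ae {σ : Measure ℝ} {c : ℝ} (hc : c ∈ interior σ.support)
    {p : ℝ → Prop} (hp : ∀ᵐ s ∂σ, p s) : ∃ᶠ s in 𝓝[>] c, p s := by
  intro hn
  obtain ⟨u, hu, hcu⟩ := mem_nhdsGT_iff_exists_Ioo_subset.1
    (inter_mem hn (mem_nhdsWithin_of_mem_nhds (isOpen_interior.mem_nhds hc)))
  obtain ⟨x, hx⟩ := Set.nonempty_Ioo.2 (Set.mem_Ioi.1 hu)
  have hpos := (Measure.mem_support_iff_forall x).1 (interior_subset (hcu hx).2) _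
    (isOpen_Ioo.mem_nhds hx)
  refine hpos.ne' (measure_mono_null (fun y hy => ?_) hp)
  exact (hcu hy).1

theorem frequently_nhdsLT_of_ae {σ : Measure ℝ} {c : ℝ} (hc : c ∈ interior σ.support)
    {p : ℝ → Prop} (hp : ∀ᵐ s ∂σ, p s) : ∃ᶠ s in 𝓝[<] c, p s := by
  intro hn
  obtain ⟨u, hu, hcu⟩ := mem_nhdsLT_iff_exists_Ioo_subset.1
    (inter_mem hn (mem_nhdsWithin_of_mem_nhds (isOpen_interior.mem_nhds hc)))
  obtain ⟨x, hx⟩ := Set.nonempty_Ioo.2 (Set.mem_Iio.1 hu)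
  have hpos := (Measure.mem_support_iff_forall x).1 (interior_subset (hcu hx).2) _
    (isOpen_Ioo.mem_nhds hx)
  refine hpos.ne' (measure_mono_null (fun y hy => ?_) hp)
  exact (hcu hy).1

end MeasureTools

end LocalPref
namespace LocalPref

/-! ### Local preferences as functions of preference and availability. -/

section Kinds

variable {J : ℕ}

instance : Finite (Preference J) :=
  Finite.of_injective (fun Q : Preference J => Q.rank) fun Q Q' h => by
    cases Q; cases Q'; congr

/-- The local preference relative to the tied schools `T` of a student with preference `Q` for
whom the schools in `R` are available. -/
def localOf (T : Finset (Fin J)) (Q : Preference J) (R : Finset (Fin J)) : Choice J × Choice J :=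
  open Classical in
  (Q.best (insert none (R.image some) ∪ T.image some),
    Q.best (insert none (R.image some) \ T.image some))

/-- Adding all of `T` or removing all of `T` erases the information about which tied schools were
available. -/
theorem localOf_congr {T : Finset (Fin J)} (Q : Preference J) {R R' : Finset (Fin J)}
    (h : R \ T = R' \ T) : localOf T Q R = localOf T Q R' := by
  classical
  have h' : ∀ m, m ∉ T → (m ∈ R ↔ m ∈ R') := fun m hm => by
    have := Finset.ext_iff.1 h m
    simpa [hm] using this
  unfold localOf
  congr 2
  · ext x
    rcases x with - | m
    · simp
    · by_cases hm : m ∈ T <;> simp [hm]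
      exact h' m hm
  · ext x
    rcases x with - | m
    · simp
    · by_cases hm : m ∈ T <;> simp [hm]
      exact h' m hm

end Kinds

/-! ### Measurability, conditional versions, and the match on each side of the cutoff. -/

namespace Economy

variable {J : ℕ} {c : Fin J → ℝ} {𝒴 : Set ℝ} {Ω : Type*} [MeasurableSpace Ω]
  (M : Economy J c 𝒴 Ω)

instance : IsProbabilityMeasure M.P := M.prob

instance (j : Fin J) : IsProbabilityMeasure (M.P.map (M.score j)) :=
  Measure.isProbabilityMeasure_map (M.measurable_score j).aemeasurable

/-- The schools whose cutoffs are met. -/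
def avail (ω : Ω) : Finset (Fin J) :=
  open Classical in Finset.univ.filter fun m => c m ≤ M.score m ω

theorem mem_avail (ω : Ω) (m : Fin J) : m ∈ M.avail ω ↔ c m ≤ M.score m ω := by
  classical
  simp [avail]

theorem localPref_eq (j : Fin J) (ω : Ω) :
    M.localPref j ω = localOf (M.tied j) (M.pref ω) (M.avail ω) := rfl

theorem measurableSet_avail (R : Finset (Fin J)) : MeasurableSet {ω | M.avail ω = R} := by
  have : {ω | M.avail ω = R} = ⋂ m, {ω | c m ≤ M.score m ω ↔ m ∈ R} := by
    ext ω
    simp only [Set.mem_ofPred_eq, Set.mem_iInter, Finset.ext_iff, mem_avail]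
  rw [this]
  exact MeasurableSet.iInter fun m =>
    MeasurableSet.iff (measurableSet_le measurable_const (M.measurable_score m)) (.const _)

theorem measurableSet_kind (p : Preference J → Finset (Fin J) → Prop) :
    MeasurableSet {ω | p (M.pref ω) (M.avail ω)} := by
  have : {ω | p (M.pref ω) (M.avail ω)} =
      ⋃ x : {x : Preference J × Finset (Fin J) // p x.1 x.2},
        {ω | M.pref ω = x.1.1} ∩ {ω | M.avail ω = x.1.2} := by
    ext ω
    simp only [Set.mem_ofPred_eq, Set.mem_iUnion, Set.mem_inter_iff]
    constructor
    · intro h; exact ⟨⟨(_, _), h⟩, rfl, rfl⟩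
    · rintro ⟨⟨x, hx⟩, h, h'⟩
      simp only at h h'
      rw [h, h']; exact hx
  rw [this]
  exact MeasurableSet.iUnion fun x => (M.measurableSet_pref _).inter (M.measurableSet_avail _)

theorem measurableSet_localPref (j : Fin J) (q : Choice J × Choice J) :
    MeasurableSet {ω | M.localPref j ω = q} :=
  M.measurableSet_kind fun Q R => localOf (M.tied j) Q R = q

theorem availEvent_eq (j : Fin J) (R : Finset (Fin J)) :
    M.availEvent j R = {ω | M.avail ω \ M.tied j = R \ M.tied j} := by
  ext ω
  simp only [availEvent, Set.mem_ofPred_eq, Finset.ext_iff, Finset.mem_sdiff, mem_avail]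
  refine forall_congr' fun m => ?_
  by_cases hm : m ∈ M.tied j <;> simp [hm]

theorem measurableSet_availEvent (j : Fin J) (R : Finset (Fin J)) :
    MeasurableSet (M.availEvent j R) := by
  rw [availEvent_eq]
  exact M.measurableSet_kind fun _ R' => R' \ M.tied j = R \ M.tied j

theorem measurableSet_matching (d : Choice J) : MeasurableSet {ω | M.matching ω = d} :=
  M.measurableSet_kind fun Q R => open Classical in Q.best (insert none (R.image some)) = d

theorem measurable_outcome : Measurable M.outcome := by
  intro A hA
  have : M.outcome ⁻¹' A = ⋃ d, {ω | M.matching ω = d} ∩ M.potential d ⁻¹' A := by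
    ext ω
    simp [outcome]
  rw [this]
  exact MeasurableSet.iUnion fun d => (M.measurableSet_matching d).inter
    (M.measurable_potential d hA)

/-- The event `{𝐐_j = D, Y ∈ A}`. -/
def obsEvent (D : Finset (Choice J × Choice J)) (A : Set 𝒴) : Set Ω :=
  {ω | M.prefSet ω = D} ∩ M.outcome ⁻¹' A

theorem measurableSet_obsEvent (D : Finset (Choice J × Choice J)) {A : Set 𝒴}
    (hA : MeasurableSet A) : MeasurableSet (M.obsEvent D A) :=
  (M.measurableSet_prefSet D).inter (M.measurable_outcome hA)

/-- Reduces the containment events of the inequalities to the events `𝐐_j = D`, for which regularity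
supplies limits. -/
theorem measure_containEvent (μ : Measure Ω) {A : Set 𝒴} (hA : MeasurableSet A)
    (B : Finset (Choice J × Choice J)) :
    μ (M.containEvent A B) = ∑ D ∈ B.powerset, μ (M.obsEvent D A) := by
  rw [← measure_biUnion_finset]
  · congr 1
    ext ω
    simp only [containEvent, obsEvent, Set.mem_ofPred_eq, Set.mem_iUnion, Finset.mem_powerset,
      Set.mem_inter_iff, Set.mem_preimage, exists_prop]
    constructor
    · rintro ⟨h, h'⟩; exact ⟨_, h', rfl, h⟩
    · rintro ⟨D, h, rfl, h'⟩; exact ⟨h', h⟩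
  · intro D _ D' _ h
    refine Set.disjoint_left.2 fun ω h₁ h₂ => h (h₁.1.symm.trans h₂.1)
  · exact fun D _ => M.measurableSet_obsEvent D hA

/-- The event `{Q_j = q, Y(d) ∈ A}`. -/
def typeEvent (j : Fin J) (q : Choice J × Choice J) (d : Choice J) (A : Set 𝒴) : Set Ω :=
  {ω | M.localPref j ω = q} ∩ M.potential d ⁻¹' A

theorem jointLaw_apply (κ : Kernel ℝ Ω) (j : Fin J) (q : Choice J × Choice J) (d : Choice J)
    {A : Set 𝒴} (hA : MeasurableSet A) :
    M.jointLaw κ j q d A = κ (c j) (M.typeEvent j q d A) := by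
  rw [jointLaw, Measure.map_apply (M.measurable_potential d) hA,
    Measure.restrict_apply (M.measurable_potential d hA), Set.inter_comm]
  rfl

variable {M} {j : Fin J} {κ : Kernel ℝ Ω}

theorem IsCondVersion.measure_eq (hκ : M.IsCondVersion j κ) {E : Set Ω} (hE : MeasurableSet E) :
    M.P E = ∫⁻ s, κ s E ∂(M.P.map (M.score j)) := by
  simpa using hκ.2 Set.univ MeasurableSet.univ E hE

theorem IsCondVersion.ae_ae (hκ : M.IsCondVersion j κ) {p : Ω → Prop} (hp : ∀ᵐ ω ∂M.P, p ω) :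
    ∀ᵐ s ∂(M.P.map (M.score j)), ∀ᵐ ω ∂(κ s), p ω := by
  obtain ⟨E, hpE, hE, h0⟩ := exists_measurable_superset_of_null hp
  rw [hκ.measure_eq hE, lintegral_eq_zero_iff (κ.measurable_coe hE)] at h0
  filter_upwards [h0] with s hs
  exact measure_mono_null hpE hs

/-- Testing the disintegration on `S_j ∈ Fᶜ` for scores in `F` gives zero; countably many rational
half-lines `F` already pin the score down to `s`. -/
theorem IsCondVersion.ae_score (hκ : M.IsCondVersion j κ) :
    ∀ᵐ s ∂(M.P.map (M.score j)), ∀ᵐ ω ∂(κ s), M.score j ω = s := by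
  have key : ∀ F : Set ℝ, MeasurableSet F →
      ∀ᵐ s ∂(M.P.map (M.score j)), s ∈ F → ∀ᵐ ω ∂(κ s), M.score j ω ∈ F := by
    intro F hF
    have h0 := hκ.2 F hF _ (M.measurable_score j hF.compl)
    rw [Set.preimage_compl, Set.inter_compl_self, measure_empty, eq_comm,
      lintegral_eq_zero_iff (κ.measurable_coe (M.measurable_score j hF).compl)] at h0
    exact (ae_restrict_iff' hF).1 h0
  have h₁ := ae_all_iff.2 fun a : ℚ => key (Set.Ioi (a : ℝ)) measurableSet_Ioi
  have h₂ := ae_all_iff.2 fun a : ℚ => key (Set.Iio (a : ℝ)) measurableSet_Iio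
  filter_upwards [h₁, h₂] with s h₁ h₂
  have h₁' : ∀ᵐ ω ∂(κ s), ∀ a : ℚ, s ∈ Set.Ioi (a : ℝ) → M.score j ω ∈ Set.Ioi (a : ℝ) := by
    rw [ae_all_iff]; exact fun a => eventually_imp_distrib_left.2 (h₁ a)
  have h₂' : ∀ᵐ ω ∂(κ s), ∀ a : ℚ, s ∈ Set.Iio (a : ℝ) → M.score j ω ∈ Set.Iio (a : ℝ) := by
    rw [ae_all_iff]; exact fun a => eventually_imp_distrib_left.2 (h₂ a)
  filter_upwards [h₁', h₂'] with ω h₁ h₂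
  rcases lt_trichotomy (M.score j ω) s with h | h | h
  · obtain ⟨a, ha, ha'⟩ := exists_rat_btwn h
    exact absurd (h₁ a ha') (not_lt.2 ha.le)
  · exact h
  · obtain ⟨a, ha, ha'⟩ := exists_rat_btwn h
    exact absurd (h₂ a ha) (not_lt.2 ha'.le)

theorem budget_eq_insert_avail (ω : Ω) :
    M.budget ω = open Classical in insert none ((M.avail ω).image some) := rfl

theorem mem_tied {m : Fin J} :
    m ∈ M.tied j ↔ (∀ᵐ ω ∂M.P, M.score m ω = M.score j ω) ∧ c m = c j := by
  classical
  simp [tied]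

theorem matching_of_tied_subset {ω : Ω} (h : M.tied j ⊆ M.avail ω) :
    M.matching ω = (M.localPref j ω).1 := by
  classical
  have : M.budgetRight j ω = M.budget ω := by
    unfold budgetRight
    refine Finset.union_eq_left.2 fun x hx => ?_
    obtain ⟨m, hm, rfl⟩ := Finset.mem_image.1 (show x ∈ (M.tied j).image some from hx)
    exact Finset.mem_insert_of_mem (Finset.mem_image_of_mem _ (h hm))
  simp [matching, localPref, this]

theorem matching_of_disjoint_tied {ω : Ω} (h : ∀ m ∈ M.tied j, m ∉ M.avail ω) :
    M.matching ω = (M.localPref j ω).2 := by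
  classical
  have : M.budgetLeft j ω = M.budget ω := by
    unfold budgetLeft
    refine Finset.sdiff_eq_self_of_disjoint (Finset.disjoint_left.2 fun x hx hx' => ?_)
    obtain ⟨m, hm, rfl⟩ := Finset.mem_image.1 (show x ∈ (M.tied j).image some from hx')
    rw [budget_eq_insert_avail] at hx
    refine h m hm ?_
    simpa using hx
  simp [matching, localPref, this]

/-- Tied scores equal `S_j = s` almost surely and share its cutoff, so all tied schools are on the
same side. The actual budget is then one of the two counterfactual budgets. -/
theorem IsCondVersion.ae_outcome (hκ : M.IsCondVersion j κ) :
    ∀ᵐ s ∂(M.P.map (M.score j)), ∀ᵐ ω ∂(κ s),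
      (c j ≤ s → M.outcome ω = M.potential (M.localPref j ω).1 ω) ∧
      (s < c j → M.outcome ω = M.potential (M.localPref j ω).2 ω) := by
  have h : ∀ᵐ ω ∂M.P, ∀ m, m ∈ M.tied j → M.score m ω = M.score j ω := by
    rw [ae_all_iff]
    intro m
    by_cases hm : m ∈ M.tied j
    · filter_upwards [(mem_tied.1 hm).1] with ω hω _ using hω
    · exact ae_of_all _ fun ω h => absurd h hm
  filter_upwards [hκ.ae_ae h, hκ.ae_score] with s h₁ h₂
  filter_upwards [h₁, h₂] with ω h₁ h₂
  constructor
  · intro hs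
    rw [outcome, matching_of_tied_subset fun m hm => ?_]
    rw [mem_avail, h₁ m hm, h₂, (mem_tied.1 hm).2]
    exact hs
  · intro hs
    rw [outcome, matching_of_disjoint_tied fun m hm => ?_]
    rw [mem_avail, h₁ m hm, h₂, (mem_tied.1 hm).2]
    exact not_le.2 hs

end Economy

end LocalPref
namespace LocalPref

/-! ### Necessity: the inequalities hold for the true values. -/

namespace Economy

variable {J : ℕ} {c : Fin J → ℝ} {𝒴 : Set ℝ} {Ω : Type*} [MeasurableSpace Ω]
  {M : Economy J c 𝒴 Ω} {j : Fin J} {κ : Kernel ℝ Ω} {𝒢 : Set (ℝ → ℝ)}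
  {Λp Λm Λ : Set (Finset (Choice J × Choice J))}

/-- Continuity of types in terms of measures of events. -/
theorem tendsto_avail_pref (h𝒴 : IsCompact 𝒴) (h𝒢 : IsTestClass 𝒴 𝒢) [IsMarkovKernel κ]
    (hcont : M.ContinuousTypes κ j 𝒢) (R : Finset (Fin J)) (Q₀ : Preference J) (d : Choice J)
    {A : Set 𝒴} (hA : MeasurableSet A) :
    Tendsto (fun s => κ s (M.availEvent j R ∩ {ω | M.pref ω = Q₀} ∩ M.potential d ⁻¹' A))
      (𝓝 (c j)) (𝓝 (κ (c j) (M.availEvent j R ∩ {ω | M.pref ω = Q₀} ∩ M.potential d ⁻¹' A))) := by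
  have hA' : MeasurableSet (Subtype.val '' A : Set ℝ) :=
    h𝒴.isClosed.measurableSet.subtype_image hA
  have h := hcont.2 R Q₀ d _ (h𝒢.2.2.2 _ hA' (by rintro _ ⟨y, -, rfl⟩; exact y.2))
  have e : ∀ s, ∫ ω in M.availEvent j R ∩ {ω | M.pref ω = Q₀},
      (Subtype.val '' A : Set ℝ).indicator (fun _ => (1 : ℝ)) (M.potential d ω) ∂(κ s) =
      (κ s (M.availEvent j R ∩ {ω | M.pref ω = Q₀} ∩ M.potential d ⁻¹' A)).toReal := by
    intro s
    have : (fun ω => (Subtype.val '' A : Set ℝ).indicator (fun _ => (1 : ℝ)) (M.potential d ω)) =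
        (M.potential d ⁻¹' A).indicator fun _ => (1 : ℝ) := by
      funext ω
      by_cases h : M.potential d ω ∈ A
      · rw [Set.indicator_of_mem (Set.mem_image_of_mem _ h),
          Set.indicator_of_mem (show ω ∈ M.potential d ⁻¹' A from h)]
      · rw [Set.indicator_of_notMem (by simpa using h),
          Set.indicator_of_notMem (show ω ∉ M.potential d ⁻¹' A from h)]
    rw [this, integral_indicator_const _ (M.measurable_potential d hA), smul_eq_mul, mul_one,
      Measure.real, Measure.restrict_apply (M.measurable_potential d hA), Set.inter_comm]
  rw [ContinuousAt] at h
  simp_rw [e] at h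
  exact (ENNReal.tendsto_toReal_iff (fun _ => measure_ne_top _ _) (measure_ne_top _ _)).1 h

/-- Breaks the event into the kinds covered by continuity of types. Taking the availability disjoint
from the tied schools makes each kind occur once. -/
theorem measure_typeEvent (μ : Measure Ω) (j : Fin J) (q : Choice J × Choice J) (d : Choice J)
    {A : Set 𝒴} (hA : MeasurableSet A) :
    μ (M.typeEvent j q d A) = open Classical in
      ∑ x ∈ (Set.toFinite {x : Finset (Fin J) × Preference J |
          Disjoint x.1 (M.tied j) ∧ localOf (M.tied j) x.2 x.1 = q}).toFinset,
        μ (M.availEvent j x.1 ∩ {ω | M.pref ω = x.2} ∩ M.potential d ⁻¹' A) := by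
  classical
  rw [← measure_biUnion_finset]
  · congr 1
    ext ω
    simp only [typeEvent, Set.mem_inter_iff, Set.mem_ofPred_eq, Set.mem_preimage, Set.mem_iUnion,
      exists_prop, Set.Finite.mem_toFinset, availEvent_eq, localPref_eq]
    constructor
    · rintro ⟨h, h'⟩
      refine ⟨(M.avail ω \ M.tied j, M.pref ω), ⟨Finset.sdiff_disjoint, ?_⟩, ⟨?_, rfl⟩, h'⟩
      · rw [← h]; exact localOf_congr _ (by simp)
      · simp
    · rintro ⟨⟨R, Q⟩, ⟨-, h⟩, ⟨h₁, h₂⟩, h₃⟩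
      refine ⟨?_, h₃⟩
      rw [← h, h₂]; exact localOf_congr _ h₁
  · rintro ⟨R, Q⟩ h ⟨R', Q'⟩ h' hne
    simp only [Set.Finite.coe_toFinset, Set.mem_ofPred_eq] at h h'
    refine Set.disjoint_left.2 fun ω h₁ h₂ => hne ?_
    simp only [availEvent_eq] at h₁ h₂
    have e : R \ M.tied j = R' \ M.tied j := h₁.1.1.symm.trans h₂.1.1
    rw [Finset.sdiff_eq_self_of_disjoint h.1, Finset.sdiff_eq_self_of_disjoint h'.1] at e
    have e' : Q = Q' := h₁.1.2.symm.trans h₂.1.2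
    rw [e, e']
  · exact fun x _ => ((M.measurableSet_availEvent j _).inter (M.measurableSet_pref _)).inter
      (M.measurable_potential d hA)

theorem tendsto_typeEvent (h𝒴 : IsCompact 𝒴) (h𝒢 : IsTestClass 𝒴 𝒢) [IsMarkovKernel κ]
    (hcont : M.ContinuousTypes κ j 𝒢) (q : Choice J × Choice J) (d : Choice J)
    {A : Set 𝒴} (hA : MeasurableSet A) :
    Tendsto (fun s => κ s (M.typeEvent j q d A)) (𝓝 (c j)) (𝓝 (M.jointLaw κ j q d A)) := by
  rw [jointLaw_apply _ _ _ _ _ hA]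
  simp_rw [measure_typeEvent _ j q d hA]
  exact tendsto_finsetSum _ fun x _ => tendsto_avail_pref h𝒴 h𝒢 hcont _ _ _ hA

variable (M κ j) in
/-- What the one-sided arguments use about a side `l` of the cutoff, on which the budget sets are
those that define the component `sel` of the local preference. -/
structure IsSide (l : Filter ℝ) (sel : Choice J × Choice J → Choice J)
    (Λ : Set (Finset (Choice J × Choice J))) : Prop where
  le_nhds : l ≤ 𝓝 (c j)
  frequently : ∀ p : ℝ → Prop, (∀ᵐ s ∂(M.P.map (M.score j)), p s) → ∃ᶠ s in l, p s
  ae_outcome : ∃ S ∈ l, ∀ᵐ s ∂(M.P.map (M.score j)), s ∈ S →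
    ∀ᵐ ω ∂(κ s), M.outcome ω = M.potential (sel (M.localPref j ω)) ω
  support : ∀ᶠ s in l, M.setSupport κ s = Λ
  limit : ∀ D ∈ Λ, ∀ A : Set 𝒴, MeasurableSet A →
    ∃ L : ℝ≥0∞, Tendsto (fun s => κ s (M.obsEvent D A)) l (𝓝 L)

/-- For the indicator of `A`, the thresholds `1/2` and `3/2` select the value one, so the regularity
assumption yields limits of probabilities of `{𝐐_j = D, Y ∈ A}`. -/
theorem setIntegral_truncEvent (s : ℝ) (D : Finset (Choice J × Choice J))
    {A : Set 𝒴} (hA : MeasurableSet A) :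
    ∫ ω in M.truncEvent D ((Subtype.val '' A : Set ℝ).indicator fun _ => (1 : ℝ))
      ((1 / 2 : ℝ) : EReal) ((3 / 2 : ℝ) : EReal),
      (Subtype.val '' A : Set ℝ).indicator (fun _ => (1 : ℝ)) (M.outcome ω) ∂(κ s) =
        (κ s (M.obsEvent D A)).toReal := by
  have e : M.truncEvent D ((Subtype.val '' A : Set ℝ).indicator fun _ => (1 : ℝ))
      ((1 / 2 : ℝ) : EReal) ((3 / 2 : ℝ) : EReal) = M.obsEvent D A := by
    ext ω
    simp only [truncEvent, obsEvent, Set.mem_ofPred_eq, Set.mem_inter_iff, Set.mem_preimage]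
    refine and_congr_right fun _ => ?_
    rw [EReal.coe_lt_coe_iff, EReal.coe_lt_coe_iff]
    by_cases h : M.outcome ω ∈ A
    · rw [Set.indicator_of_mem (Set.mem_image_of_mem _ h)]
      norm_num [h]
    · rw [Set.indicator_of_notMem (by simpa using h)]
      norm_num [h]
  rw [e, setIntegral_congr_fun (g := fun _ => (1 : ℝ)) (M.measurableSet_obsEvent D hA) ?_]
  · simp [Measure.real]
  · intro ω hω
    exact Set.indicator_of_mem (Set.mem_image_of_mem Subtype.val hω.2) _

theorem isSide_right (h𝒴 : IsCompact 𝒴) (h𝒢 : IsTestClass 𝒴 𝒢) (hκ : M.IsCondVersion j κ)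
    (hreg : M.RegularSets κ j 𝒢 Λp Λm) : M.IsSide j κ (𝓝[>] (c j)) Prod.fst Λp := by
  have := hκ.1
  obtain ⟨⟨ε, hε, hp, -⟩, hlim⟩ := hreg
  refine ⟨nhdsWithin_le_nhds, fun p hp => frequently_nhdsGT_of_ae (M.cutoff_mem_interior j) hp,
    ⟨Set.Ioi (c j), self_mem_nhdsWithin, ?_⟩, ?_, fun D hD A hA => ?_⟩
  · filter_upwards [hκ.ae_outcome] with s hs hsc
    filter_upwards [hs] with ω hω using hω.1 (le_of_lt hsc)
  · filter_upwards [Ioo_mem_nhdsGT (show c j < c j + ε by linarith)] with s hs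
    have := hp (s - c j) (by linarith [hs.1]) (by linarith [hs.2])
    rwa [add_sub_cancel] at this
  · have hA' : MeasurableSet (Subtype.val '' A : Set ℝ) :=
      h𝒴.isClosed.measurableSet.subtype_image hA
    obtain ⟨L, hL⟩ := (hlim _ (h𝒢.2.2.2 _ hA' (by rintro _ ⟨y, -, rfl⟩; exact y.2))
      ((1 / 2 : ℝ) : EReal) ((3 / 2 : ℝ) : EReal) (by norm_num [EReal.coe_lt_coe_iff])).1 D hD
    simp_rw [setIntegral_truncEvent _ D hA] at hL
    refine ⟨ENNReal.ofReal L, ?_⟩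
    have := ENNReal.tendsto_ofReal hL
    simpa only [ENNReal.ofReal_toReal (measure_ne_top _ _)] using this

theorem isSide_left (h𝒴 : IsCompact 𝒴) (h𝒢 : IsTestClass 𝒴 𝒢) (hκ : M.IsCondVersion j κ)
    (hreg : M.RegularSets κ j 𝒢 Λp Λm) : M.IsSide j κ (𝓝[<] (c j)) Prod.snd Λm := by
  have := hκ.1
  obtain ⟨⟨ε, hε, -, hp⟩, hlim⟩ := hreg
  refine ⟨nhdsWithin_le_nhds, fun p hp => frequently_nhdsLT_of_ae (M.cutoff_mem_interior j) hp,
    ⟨Set.Iio (c j), self_mem_nhdsWithin, ?_⟩, ?_, fun D hD A hA => ?_⟩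
  · filter_upwards [hκ.ae_outcome] with s hs hsc
    filter_upwards [hs] with ω hω using hω.2 hsc
  · filter_upwards [Ioo_mem_nhdsLT (show c j - ε < c j by linarith)] with s hs
    have := hp (c j - s) (by linarith [hs.2]) (by linarith [hs.1])
    rwa [sub_sub_cancel] at this
  · have hA' : MeasurableSet (Subtype.val '' A : Set ℝ) :=
      h𝒴.isClosed.measurableSet.subtype_image hA
    obtain ⟨L, hL⟩ := (hlim _ (h𝒢.2.2.2 _ hA' (by rintro _ ⟨y, -, rfl⟩; exact y.2))
      ((1 / 2 : ℝ) : EReal) ((3 / 2 : ℝ) : EReal) (by norm_num [EReal.coe_lt_coe_iff])).2 D hD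
    simp_rw [setIntegral_truncEvent _ D hA] at hL
    refine ⟨ENNReal.ofReal L, ?_⟩
    have := ENNReal.tendsto_ofReal hL
    simpa only [ENNReal.ofReal_toReal (measure_ne_top _ _)] using this

variable {l : Filter ℝ} {sel : Choice J × Choice J → Choice J}

theorem IsSide.obsEvent_eq_zero (h : M.IsSide j κ l sel Λ) {D : Finset (Choice J × Choice J)}
    (hD : D ∉ Λ) : ∀ᶠ s in l, ∀ A, κ s (M.obsEvent D A) = 0 := by
  filter_upwards [h.support] with s hs A
  rw [← hs] at hD
  exact measure_mono_null Set.inter_subset_left (by simpa [setSupport] using hD)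

theorem IsSide.exists_limit (h : M.IsSide j κ l sel Λ) (D : Finset (Choice J × Choice J))
    {A : Set 𝒴} (hA : MeasurableSet A) :
    ∃ L : ℝ≥0∞, Tendsto (fun s => κ s (M.obsEvent D A)) l (𝓝 L) := by
  by_cases hD : D ∈ Λ
  · exact h.limit D hD A hA
  · refine ⟨0, tendsto_const_nhds.congr' ?_⟩
    filter_upwards [h.obsEvent_eq_zero hD] with s hs using (hs A).symm

theorem IsSide.exists_limit_containEvent (h : M.IsSide j κ l sel Λ)
    (B : Finset (Choice J × Choice J)) {A : Set 𝒴} (hA : MeasurableSet A) :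
    ∃ L : ℝ≥0∞, Tendsto (fun s => κ s (M.containEvent A B)) l (𝓝 L) := by
  choose L hL using fun D => h.exists_limit D hA
  refine ⟨∑ D ∈ B.powerset, L D, ?_⟩
  simp_rw [measure_containEvent _ _ hA]
  exact tendsto_finsetSum _ fun D _ => hL D

/-- When `𝐐_j ⊆ B`, the local preference is some `q ∈ B` and the outcome is `Y(sel q)`; a union
bound gives the inequality for a.e. score. Both sides have limits, so its holding frequently is
enough. -/
theorem IsSide.inequality (h : M.IsSide j κ l sel Λ) (h𝒴 : IsCompact 𝒴) (h𝒢 : IsTestClass 𝒴 𝒢)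
    (hκ : M.IsCondVersion j κ) (hcont : M.ContinuousTypes κ j 𝒢) (hsharp : M.SharpSets κ j)
    (B : Finset (Choice J × Choice J)) {A : Set 𝒴} (hA : MeasurableSet A) :
    ∃ L : ℝ≥0∞, Tendsto (fun s => κ s (M.containEvent A B)) l (𝓝 L) ∧
      L ≤ ∑ q ∈ B, M.jointLaw κ j q (sel q) A := by
  have := hκ.1
  obtain ⟨L, hL⟩ := h.exists_limit_containEvent B hA
  refine ⟨L, hL, ?_⟩
  have hlim : Tendsto (fun s => ∑ q ∈ B, κ s (M.typeEvent j q (sel q) A)) l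
      (𝓝 (∑ q ∈ B, M.jointLaw κ j q (sel q) A)) :=
    tendsto_finsetSum _ fun q _ => (tendsto_typeEvent h𝒴 h𝒢 hcont q (sel q) hA).mono_left h.le_nhds
  obtain ⟨S, hS, hout⟩ := h.ae_outcome
  refine le_of_tendsto_of_tendsto_of_frequently hL hlim ?_
  refine ((h.frequently _ (hout.and (hκ.ae_ae hsharp.1))).and_eventually hS).mono ?_
  rintro s ⟨⟨h₁, h₂⟩, hs⟩
  refine le_trans (measure_mono_ae ?_) (measure_biUnion_finset_le B _)
  filter_upwards [h₁ hs, h₂] with ω h₁ h₂ hω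
  refine Set.mem_iUnion₂.2 ⟨M.localPref j ω, hω.2 h₂, rfl, ?_⟩
  change M.potential _ ω ∈ A
  rw [← h₁]
  exact hω.1

theorem isCandidate_jointLaw (κ : Kernel ℝ Ω) [IsMarkovKernel κ] (j : Fin J) :
    IsCandidate (M.jointLaw κ j) := by
  have e : ∀ q d, M.jointLaw κ j q d Set.univ = κ (c j) {ω | M.localPref j ω = q} := by
    intro q d
    rw [jointLaw_apply _ _ _ _ _ MeasurableSet.univ, typeEvent, Set.preimage_univ, Set.inter_univ]
  refine ⟨fun q => by rw [e, e], ?_⟩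
  simp_rw [e]
  have := sum_measure_preimage_singleton (μ := κ (c j)) (f := M.localPref j) Finset.univ
    fun q _ => M.measurableSet_localPref j q
  rw [Finset.coe_univ, Set.preimage_univ, measure_univ] at this
  exact this

theorem inequalities_jointLaw (h𝒴 : IsCompact 𝒴) (h𝒢 : IsTestClass 𝒴 𝒢)
    (hκ : M.IsCondVersion j κ) (hcont : M.ContinuousTypes κ j 𝒢) (hsharp : M.SharpSets κ j)
    (hreg : M.RegularSets κ j 𝒢 Λp Λm) :
    Inequalities M κ j Λp Λm (M.jointLaw κ j) :=
  ⟨fun _ hA B _ => (isSide_right h𝒴 h𝒢 hκ hreg).inequality h𝒴 h𝒢 hκ hcont hsharp B hA,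
    fun _ hA B _ => (isSide_left h𝒴 h𝒢 hκ hreg).inequality h𝒴 h𝒢 hκ hcont hsharp B hA⟩

theorem measure_score_preimage (M : Economy J c 𝒴 Ω) (j : Fin J) (F : Set ℝ) :
    M.P (M.score j ⁻¹' F) =
      ∑ B, M.P {ω | M.outcome ω ∈ Set.univ ∧ M.prefSet ω = B ∧ M.score j ω ∈ F} := by
  have := sum_measure_preimage_singleton (μ := M.P.restrict (M.score j ⁻¹' F))
    (f := M.prefSet) Finset.univ fun B _ => M.measurableSet_prefSet B
  rw [Finset.coe_univ, Set.preimage_univ, Measure.restrict_apply_univ] at this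
  rw [← this]
  refine Finset.sum_congr rfl fun B _ => ?_
  have hB : MeasurableSet (M.prefSet ⁻¹' {B}) := M.measurableSet_prefSet B
  rw [Measure.restrict_apply hB]
  congr 1
  ext ω
  simp

/-! ### Economies with the same observables have the same one-sided limits. -/

section Transfer

variable {Ω' : Type*} [MeasurableSpace Ω'] {M' : Economy J c 𝒴 Ω'} {κ' : Kernel ℝ Ω'}

theorem SameObservables.map_score_eq (h : M.SameObservables M' j) :
    M'.P.map (M'.score j) = M.P.map (M.score j) := by
  ext F hF
  rw [Measure.map_apply (M.measurable_score j) hF, Measure.map_apply (M'.measurable_score j) hF]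
  rw [measure_score_preimage, measure_score_preimage]
  exact Finset.sum_congr rfl fun B _ => h _ B F MeasurableSet.univ hF

theorem SameObservables.ae_eq (h : M.SameObservables M' j) (hκ : M.IsCondVersion j κ)
    (hκ' : M'.IsCondVersion j κ') (D : Finset (Choice J × Choice J)) {A : Set 𝒴}
    (hA : MeasurableSet A) :
    ∀ᵐ s ∂(M.P.map (M.score j)), κ' s (M'.obsEvent D A) = κ s (M.obsEvent D A) := by
  have := hκ.1
  have := hκ'.1
  refine ae_eq_of_forall_setLIntegral_eq_of_sigmaFinite
    (κ'.measurable_coe (M'.measurableSet_obsEvent D hA))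
    (κ.measurable_coe (M.measurableSet_obsEvent D hA)) fun F hF _ => ?_
  rw [← hκ.2 F hF _ (M.measurableSet_obsEvent D hA), ← h.map_score_eq,
    ← hκ'.2 F hF _ (M'.measurableSet_obsEvent D hA)]
  have := h A D F hA hF
  convert this using 2 <;> ext ω <;>
    simp only [obsEvent, Set.mem_inter_iff, Set.mem_preimage, Set.mem_ofPred_eq] <;> tauto

/-- The two versions agree only a.e., but two convergent functions that agree frequently along the
filter have the same limit. -/
theorem SameObservables.limit_eq (h : M.SameObservables M' j) (hκ : M.IsCondVersion j κ)
    (hκ' : M'.IsCondVersion j κ') (hM : M.IsSide j κ l sel Λ)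
    (B : Finset (Choice J × Choice J)) {A : Set 𝒴} (hA : MeasurableSet A) {L L' : ℝ≥0∞}
    (hL : Tendsto (fun s => κ s (M.containEvent A B)) l (𝓝 L))
    (hL' : Tendsto (fun s => κ' s (M'.containEvent A B)) l (𝓝 L')) : L = L' := by
  refine tendsto_nhds_unique_of_frequently_eq hL hL' (hM.frequently _ ?_)
  filter_upwards [ae_all_iff.2 fun D => h.ae_eq hκ hκ' D hA] with s hs
  rw [measure_containEvent _ _ hA, measure_containEvent _ _ hA]
  exact Finset.sum_congr rfl fun D _ => (hs D).symm

end Transfer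

end Economy

/-- The necessity argument runs in the economy that realizes `ν`; only the limits on the left-hand
sides have to be carried back to `M`. -/
theorem InSharpSet.isCandidate_and_inequalities {J : ℕ} {c : Fin J → ℝ} {𝒴 : Set ℝ} {Ω : Type*}
    [MeasurableSpace Ω] {M : Economy J c 𝒴 Ω} {j : Fin J} {κ : Kernel ℝ Ω} {𝒢 : Set (ℝ → ℝ)}
    {Λp Λm : Set (Finset (Choice J × Choice J))}
    {ν : Choice J × Choice J → Choice J → Measure 𝒴} (hν : InSharpSet M j 𝒢 Λp Λm ν)
    (h𝒴 : IsCompact 𝒴) (h𝒢 : IsTestClass 𝒴 𝒢) (hκ : M.IsCondVersion j κ)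
    (hreg : M.RegularSets κ j 𝒢 Λp Λm) :
    IsCandidate ν ∧ Inequalities M κ j Λp Λm ν := by
  obtain ⟨Ω', _, M', κ', hκ', hobs, hcont', hsharp', hreg', he⟩ := hν
  have := hκ'.1
  have e₁ : ∀ q, ν q q.1 = M'.jointLaw κ' j q q.1 := fun q => he q q.1 (Or.inl rfl)
  have e₂ : ∀ q, ν q q.2 = M'.jointLaw κ' j q q.2 := fun q => he q q.2 (Or.inr rfl)
  refine ⟨⟨fun q => ?_, ?_⟩, fun A hA B _ => ?_, fun A hA B _ => ?_⟩
  · rw [e₁, e₂]; exact (M'.isCandidate_jointLaw κ' j).1 q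
  · simp_rw [e₁]; exact (M'.isCandidate_jointLaw κ' j).2
  · have hs := Economy.isSide_right h𝒴 h𝒢 hκ hreg
    obtain ⟨L, hL⟩ := hs.exists_limit_containEvent B hA
    obtain ⟨L', hL', hle⟩ := (Economy.isSide_right h𝒴 h𝒢 hκ' hreg').inequality h𝒴 h𝒢 hκ' hcont'
      hsharp' B hA
    refine ⟨L, hL, ?_⟩
    rw [hobs.limit_eq hκ hκ' hs B hA hL hL']
    simpa only [e₁] using hle
  · have hs := Economy.isSide_left h𝒴 h𝒢 hκ hreg
    obtain ⟨L, hL⟩ := hs.exists_limit_containEvent B hA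
    obtain ⟨L', hL', hle⟩ := (Economy.isSide_left h𝒴 h𝒢 hκ' hreg').inequality h𝒴 h𝒢 hκ' hcont'
      hsharp' B hA
    refine ⟨L, hL, ?_⟩
    rw [hobs.limit_eq hκ hκ' hs B hA hL hL']
    simpa only [e₂] using hle

end LocalPref
namespace LocalPref

/-! ### Noise for the scores of untied schools. -/

section Noise

variable {J : ℕ}

/-- Independent uniform noise for every school. -/
def noise (J : ℕ) : Measure (Fin J → ℝ) :=
  Measure.pi fun _ => volume.restrict (Set.Ioo (0 : ℝ) 1)

instance : IsProbabilityMeasure (volume.restrict (Set.Ioo (0 : ℝ) 1)) := ⟨by simp⟩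

instance : IsProbabilityMeasure (noise J) := by unfold noise; infer_instance

/-- A positive modification of the identity of the unit interval. -/
def posPart (x : ℝ) : ℝ := if 0 < x then x else 1

theorem posPart_pos (x : ℝ) : 0 < posPart x := by
  unfold posPart; split_ifs with h
  · exact h
  · exact one_pos

theorem measurable_posPart : Measurable posPart :=
  Measurable.ite measurableSet_Ioi measurable_id measurable_const

theorem map_eval_noise (m : Fin J) :
    (noise J).map (fun u => u m) = volume.restrict (Set.Ioo (0 : ℝ) 1) :=
  (measurePreserving_eval _ m).map_eq

theorem noise_eval (m : Fin J) {V : Set ℝ} (hV : MeasurableSet V) :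
    noise J {u | posPart (u m) ∈ V} = volume (V ∩ Set.Ioo 0 1) := by
  have h₁ : noise J {u | posPart (u m) ∈ V} =
      (noise J).map (fun u => u m) (posPart ⁻¹' V) :=
    (Measure.map_apply (f := fun u : Fin J → ℝ => u m) (measurable_pi_apply m)
      (measurable_posPart hV)).symm
  rw [h₁, map_eval_noise, Measure.restrict_apply (measurable_posPart hV)]
  congr 1
  ext x
  simp only [Set.mem_inter_iff, Set.mem_preimage, and_congr_left_iff]
  intro hx
  simp [posPart, hx.1]

/-- Independence turns the joint law of two coordinates into a product, and each slice of the graph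
is one point, hence Lebesgue null. -/
theorem noise_posPart_eq {l m : Fin J} (hlm : l ≠ m) {g : ℝ → ℝ} (hg : Measurable g) :
    noise J {u | posPart (u m) = g (u l)} = 0 := by
  have hind : IndepFun (fun u : Fin J → ℝ => u l) (fun u => u m) (noise J) :=
    (iIndepFun_pi (μ := fun _ : Fin J => volume.restrict (Set.Ioo (0 : ℝ) 1))
      (X := fun _ => id) fun _ => aemeasurable_id).indepFun hlm
  have hmap := (indepFun_iff_map_prod_eq_prod_map_map (measurable_pi_apply l).aemeasurable
    (measurable_pi_apply m).aemeasurable).1 hind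
  rw [map_eval_noise, map_eval_noise] at hmap
  have hS : MeasurableSet {x : ℝ × ℝ | posPart x.2 = g x.1} :=
    measurableSet_eq_fun (measurable_posPart.comp measurable_snd) (hg.comp measurable_fst)
  have h₁ : noise J {u | posPart (u m) = g (u l)} =
      (noise J).map (fun u => (u l, u m)) {x : ℝ × ℝ | posPart x.2 = g x.1} :=
    (Measure.map_apply (f := fun u : Fin J → ℝ => (u l, u m))
      ((measurable_pi_apply l).prodMk (measurable_pi_apply m)) hS).symm
  rw [h₁, hmap, Measure.measure_prod_null hS]
  refine ae_of_all _ fun x => ?_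
  change volume.restrict (Set.Ioo (0 : ℝ) 1) (Prod.mk x ⁻¹' _) = 0
  rw [Measure.restrict_apply (measurable_prodMk_left hS)]
  refine measure_mono_null (fun y hy => ?_) (measure_singleton (g x))
  have h : posPart y = g x := hy.1
  rw [posPart, if_pos hy.2.1] at h
  exact h

end Noise

/-! ### Construction of an economy from prescribed conditional laws. -/

/-- The discrete part of a student's type in the constructed economies: preferences, available
schools, and the set of local preferences. -/
structure Index (J : ℕ) where
  pref : Preference J
  avail : Finset (Fin J)
  set : Finset (Choice J × Choice J)

instance {J : ℕ} : Finite (Index J) :=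
  Finite.of_injective (fun i : Index J => (i.pref, i.avail, i.set)) fun i i' h => by
    cases i; cases i'; simpa using h

instance {J : ℕ} : Fintype (Index J) := Fintype.ofFinite _

instance {J : ℕ} : MeasurableSpace (Index J) := ⊤

instance {J : ℕ} : DiscreteMeasurableSpace (Index J) := ⟨fun _ => trivial⟩

/-- The sample space of the constructed economies: the score of the given school, the discrete
type, the observed outcome, a counterfactual outcome, and noise for the other scores. -/
abbrev State (J : ℕ) (𝒴 : Set ℝ) : Type := ℝ × Index J × 𝒴 × 𝒴 × (Fin J → ℝ)

/-- The data from which an economy on `State J 𝒴` is built: the conditional laws of the type given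
the score of school `j`. -/
structure Design (J : ℕ) (c : Fin J → ℝ) (𝒴 : Set ℝ) (j : Fin J) where
  T : Finset (Fin J)
  mem_T : j ∈ T
  cutoff_eq : ∀ m ∈ T, c m = c j
  law : Measure ℝ
  prob : IsProbabilityMeasure law
  law_absolutelyContinuous : law ≪ volume
  cutoff_mem : c j ∈ interior law.support
  own : Index J → Kernel ℝ 𝒴
  own_finite : ∀ i, IsFiniteKernel (own i)
  sum_own : ∀ s, ∑ i, own i s Set.univ = 1
  other : Index J → Kernel ℝ 𝒴
  other_markov : ∀ i, IsMarkovKernel (other i)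
  default : 𝒴
  exists_avail : ∀ m ∉ T, ∃ i, m ∈ i.avail ∧ ∫⁻ s, own i s Set.univ ∂law ≠ 0
  exists_unavail : ∀ m ∉ T, ∃ i, m ∉ i.avail ∧ ∫⁻ s, own i s Set.univ ∂law ≠ 0

namespace Design

variable {J : ℕ} {c : Fin J → ℝ} {𝒴 : Set ℝ} {j : Fin J} (X : Design J c 𝒴 j)

instance : IsProbabilityMeasure X.law := X.prob

instance (i : Index J) : IsFiniteKernel (X.own i) := X.own_finite i

instance (i : Index J) : IsMarkovKernel (X.other i) := X.other_markov i

/-- The conditional law of the state given the score of school `j`. -/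
def cond : Kernel ℝ (State J 𝒴) :=
  ∑ i, (Kernel.id ×ₖ (X.own i ×ₖ (X.other i ×ₖ Kernel.const ℝ (noise J)))).map
    fun x => (x.1, i, x.2)

theorem cond_apply (s : ℝ) {E : Set (State J 𝒴)} (hE : MeasurableSet E) :
    X.cond s E = ∑ i, (X.own i s).prod ((X.other i s).prod (noise J)) {x | (s, i, x) ∈ E} := by
  rw [cond, Kernel.finsetSum_apply']
  refine Finset.sum_congr rfl fun i _ => ?_
  have hm : Measurable fun x : ℝ × 𝒴 × 𝒴 × (Fin J → ℝ) => ((x.1, i, x.2) : State J 𝒴) := by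
    fun_prop
  rw [Kernel.map_apply' _ hm _ hE, Kernel.prod_apply, Kernel.prod_apply, Kernel.prod_apply,
    Kernel.id_apply, Kernel.const_apply, Measure.dirac_prod,
    Measure.map_apply measurable_prodMk_left (hm hE)]
  rfl

instance : IsMarkovKernel X.cond := ⟨fun s => ⟨by
  rw [cond_apply _ _ MeasurableSet.univ, ← X.sum_own s]
  refine Finset.sum_congr rfl fun i _ => ?_
  simp only [Set.mem_univ]
  rw [show {x : 𝒴 × 𝒴 × (Fin J → ℝ) | True} = Set.univ ×ˢ Set.univ from by ext; simp,
    Measure.prod_prod, measure_univ (μ := (X.other i s).prod (noise J)), mul_one]⟩⟩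

/-- The value of `cond` on events that are rectangles given the discrete type. -/
theorem cond_rectangle (s : ℝ) {E : Set (State J 𝒴)} (hE : MeasurableSet E)
    {A A' : Index J → Set 𝒴} {U : Index J → Set (Fin J → ℝ)}
    (h : ∀ i y z u, (s, i, y, z, u) ∈ E ↔ y ∈ A i ∧ z ∈ A' i ∧ u ∈ U i) :
    X.cond s E = ∑ i, X.own i s (A i) * (X.other i s (A' i) * noise J (U i)) := by
  rw [X.cond_apply s hE]
  refine Finset.sum_congr rfl fun i _ => ?_
  rw [← Measure.prod_prod, ← Measure.prod_prod]
  congr 1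
  ext ⟨y, z, u⟩
  exact h i y z u

/-- Noise is independent of everything else given `s`, so a null condition on the noise makes an
event null at every score, whatever the discrete type. -/
theorem cond_le_noise (s : ℝ) {E : Set (State J 𝒴)} (hE : MeasurableSet E)
    {U : Set (Fin J → ℝ)} (h : ∀ i y z u, (s, i, y, z, u) ∈ E → u ∈ U) :
    X.cond s E ≤ noise J U := by
  rw [X.cond_apply s hE]
  have : ∀ i, (X.own i s).prod ((X.other i s).prod (noise J)) {x | (s, i, x) ∈ E} ≤
      X.own i s Set.univ * noise J U := by
    intro i
    refine (measure_mono (t := Set.univ ×ˢ Set.univ ×ˢ U) ?_).trans_eq ?_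
    · rintro ⟨y, z, u⟩ hx
      exact ⟨trivial, trivial, h i y z u hx⟩
    · rw [Measure.prod_prod, Measure.prod_prod, measure_univ (μ := X.other i s), one_mul]
  refine (Finset.sum_le_sum fun i _ => this i).trans_eq ?_
  rw [← Finset.sum_mul, X.sum_own, one_mul]

/-- The law of the state. -/
def P : Measure (State J 𝒴) := X.law.bind X.cond

theorem P_apply {E : Set (State J 𝒴)} (hE : MeasurableSet E) :
    X.P E = ∫⁻ s, X.cond s E ∂X.law :=
  Measure.bind_apply hE X.cond.measurable.aemeasurable

instance : IsProbabilityMeasure X.P := ⟨by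
  rw [P_apply _ MeasurableSet.univ]; simp⟩

theorem cond_fst_inter (s : ℝ) {F : Set ℝ} (hF : MeasurableSet F) {E : Set (State J 𝒴)}
    (hE : MeasurableSet E) :
    X.cond s (Prod.fst ⁻¹' F ∩ E) = F.indicator (fun s => X.cond s E) s := by
  rw [X.cond_apply s ((measurable_fst hF).inter hE)]
  by_cases hs : s ∈ F
  · rw [Set.indicator_of_mem hs, X.cond_apply s hE]
    simp [hs]
  · rw [Set.indicator_of_notMem hs]
    simp [hs]

theorem P_fst_inter {F : Set ℝ} (hF : MeasurableSet F) {E : Set (State J 𝒴)}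
    (hE : MeasurableSet E) : X.P (Prod.fst ⁻¹' F ∩ E) = ∫⁻ s in F, X.cond s E ∂X.law := by
  rw [X.P_apply ((measurable_fst hF).inter hE), ← lintegral_indicator hF]
  exact lintegral_congr fun s => X.cond_fst_inter s hF hE

/-- The scores: those of the tied schools agree with that of school `j`, the others are on the side
of the cutoff that the type prescribes, at a distance that is noise. -/
def score (m : Fin J) (ω : State J 𝒴) : ℝ :=
  if m ∈ X.T then ω.1 else
    if m ∈ ω.2.1.avail then c m + posPart (ω.2.2.2.2 m) else c m - posPart (ω.2.2.2.2 m)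

theorem measurable_index {ω : Type*} [MeasurableSpace ω] {f : ω → Index J} (hf : Measurable f)
    (S : Set (Index J)) : MeasurableSet {x | f x ∈ S} := hf (MeasurableSet.of_discrete)

theorem measurable_score (m : Fin J) : Measurable (X.score m) := by
  unfold score
  have hp : Measurable fun ω : State J 𝒴 => posPart (ω.2.2.2.2 m) :=
    measurable_posPart.comp (by fun_prop)
  refine Measurable.ite (.const _) measurable_fst (Measurable.ite ?_ (hp.const_add _)
    (hp.const_sub _))
  exact measurable_index (f := fun ω : State J 𝒴 => ω.2.1) (by fun_prop) {i | m ∈ i.avail}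

theorem score_of_mem {m : Fin J} (hm : m ∈ X.T) (ω : State J 𝒴) : X.score m ω = ω.1 := by
  simp [score, hm]

theorem score_eq_or {m : Fin J} (hm : m ∉ X.T) (ω : State J 𝒴) :
    X.score m ω = c m + posPart (ω.2.2.2.2 m) ∨ X.score m ω = c m - posPart (ω.2.2.2.2 m) := by
  unfold score
  rw [if_neg hm]
  split_ifs <;> simp

theorem cutoff_le_score {m : Fin J} (hm : m ∉ X.T) (ω : State J 𝒴) :
    c m ≤ X.score m ω ↔ m ∈ ω.2.1.avail := by
  have := posPart_pos (ω.2.2.2.2 m)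
  unfold score
  rw [if_neg hm]
  split_ifs with h
  · simp only [h, iff_true]; linarith
  · simp only [h, iff_false]; linarith

theorem map_score_of_mem {m : Fin J} (hm : m ∈ X.T) : X.P.map (X.score m) = X.law := by
  ext F hF
  rw [Measure.map_apply (X.measurable_score m) hF]
  have : X.score m ⁻¹' F = Prod.fst ⁻¹' F ∩ Set.univ := by
    ext ω; simp [X.score_of_mem hm]
  rw [this, X.P_fst_inter hF MeasurableSet.univ]
  simp

theorem absolutelyContinuous_score (m : Fin J) : X.P.map (X.score m) ≪ volume := by
  by_cases hm : m ∈ X.T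
  · rw [X.map_score_of_mem hm]; exact X.law_absolutelyContinuous
  refine Measure.AbsolutelyContinuous.mk fun N hN h0 => ?_
  rw [Measure.map_apply (X.measurable_score m) hN, X.P_apply (X.measurable_score m hN)]
  have hU : noise J ({u | posPart (u m) ∈ (fun x => c m + x) ⁻¹' N} ∪
      {u | posPart (u m) ∈ (fun x => c m - x) ⁻¹' N}) = 0 := by
    refine measure_union_null ?_ ?_
    · rw [noise_eval m (hN.preimage (measurable_const_add _))]
      exact measure_mono_null Set.inter_subset_left
        (((measurePreserving_add_left volume (c m)).measure_preimage hN.nullMeasurableSet).trans h0)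
    · rw [noise_eval m (hN.preimage (measurable_const_sub _))]
      exact measure_mono_null Set.inter_subset_left
        (((Measure.measurePreserving_sub_left volume (c m)).measure_preimage hN.nullMeasurableSet).trans h0)
  refine (lintegral_congr fun s => ?_).trans lintegral_zero
  refine le_antisymm ((X.cond_le_noise s (X.measurable_score m hN) ?_).trans hU.le) zero_le
  intro i y z u hω
  have hω' : X.score m (s, i, y, z, u) ∈ N := hω
  rcases X.score_eq_or hm (s, i, y, z, u) with e | e
  · left; rw [e] at hω'; exact hω'
  · right; rw [e] at hω'; exact hω'

theorem P_index_noise_pos {i : Index J} (hi : ∫⁻ s, X.own i s Set.univ ∂X.law ≠ 0) {m : Fin J}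
    {V : Set ℝ} (hV : MeasurableSet V) (hV0 : volume (V ∩ Set.Ioo 0 1) ≠ 0) :
    X.P {ω | ω.2.1 = i ∧ posPart (ω.2.2.2.2 m) ∈ V} ≠ 0 := by
  have hE : MeasurableSet {ω : State J 𝒴 | ω.2.1 = i ∧ posPart (ω.2.2.2.2 m) ∈ V} :=
    (measurable_index (f := fun ω : State J 𝒴 => ω.2.1) (by fun_prop) {i}).inter
      (measurable_posPart.comp
        (show Measurable fun ω : State J 𝒴 => ω.2.2.2.2 m by fun_prop) hV)
  rw [X.P_apply hE]
  have hle : ∀ s, X.own i s Set.univ * volume (V ∩ Set.Ioo 0 1) ≤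
      X.cond s {ω | ω.2.1 = i ∧ posPart (ω.2.2.2.2 m) ∈ V} := by
    intro s
    rw [X.cond_apply s hE]
    refine le_trans (le_of_eq ?_) (Finset.single_le_sum (fun _ _ => zero_le) (Finset.mem_univ i))
    rw [← noise_eval m hV]
    have : {x : 𝒴 × 𝒴 × (Fin J → ℝ) |
        (s, i, x) ∈ {ω : State J 𝒴 | ω.2.1 = i ∧ posPart (ω.2.2.2.2 m) ∈ V}} =
        Set.univ ×ˢ Set.univ ×ˢ {u | posPart (u m) ∈ V} := by
      ext x; simp
    rw [this, Measure.prod_prod, Measure.prod_prod, measure_univ (μ := X.other i s), one_mul]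
  refine fun h0 => ?_
  have := lintegral_mono (μ := X.law) hle
  rw [h0, lintegral_mul_const _ ((X.own i).measurable_coe MeasurableSet.univ)] at this
  exact (mul_ne_zero hi hV0) (le_antisymm this zero_le)

/-- A type with `m` available puts density immediately above the cutoff and one with `m` unavailable
immediately below. Both must have positive probability for the cutoff to be interior to the support.
-/
theorem Ioo_subset_support {m : Fin J} (hm : m ∉ X.T) :
    Set.Ioo (c m - 1) (c m + 1) ⊆ (X.P.map (X.score m)).support := by
  intro x hx
  rw [Measure.mem_support_iff_forall]
  intro U hU
  have hpos : ∀ V : Set ℝ, MeasurableSet V → V ⊆ U →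
      X.P (X.score m ⁻¹' V) ≠ 0 → 0 < X.P.map (X.score m) U := fun V hV hVU h => by
    refine lt_of_lt_of_le (pos_iff_ne_zero.2 ?_) (measure_mono hVU)
    rwa [Measure.map_apply (X.measurable_score m) hV]
  rcases le_or_gt (c m) x with hcx | hcx
  · obtain ⟨i, hi, hi0⟩ := X.exists_avail m hm
    obtain ⟨u, hu, huU⟩ := mem_nhdsGT_iff_exists_Ioo_subset.1 (mem_nhdsWithin_of_mem_nhds hU)
    have hu : x < u := hu
    refine hpos (Set.Ioo x u) measurableSet_Ioo huU ?_
    refine fun h0 => X.P_index_noise_pos hi0 (m := m) (V := Set.Ioo (x - c m) (u - c m))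
      measurableSet_Ioo ?_ (measure_mono_null ?_ h0)
    · rw [Set.Ioo_inter_Ioo, Real.volume_Ioo]
      simp only [ne_eq, ENNReal.ofReal_eq_zero, not_le, sub_pos]
      refine max_lt (lt_min ?_ ?_) (lt_min ?_ ?_) <;> linarith [hx.2]
    · rintro ω ⟨rfl, h₁, h₂⟩
      have : X.score m ω = c m + posPart (ω.2.2.2.2 m) := by simp [score, hm, hi]
      rw [Set.mem_preimage, this]
      constructor <;> linarith
  · obtain ⟨i, hi, hi0⟩ := X.exists_unavail m hm
    obtain ⟨u, hu, huU⟩ := mem_nhdsLT_iff_exists_Ioo_subset.1 (mem_nhdsWithin_of_mem_nhds hU)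
    have hu : u < x := hu
    refine hpos (Set.Ioo u x) measurableSet_Ioo huU ?_
    refine fun h0 => X.P_index_noise_pos hi0 (m := m) (V := Set.Ioo (c m - x) (c m - u))
      measurableSet_Ioo ?_ (measure_mono_null ?_ h0)
    · rw [Set.Ioo_inter_Ioo, Real.volume_Ioo]
      simp only [ne_eq, ENNReal.ofReal_eq_zero, not_le, sub_pos]
      refine max_lt (lt_min ?_ ?_) (lt_min ?_ ?_) <;> linarith [hx.1]
    · rintro ω ⟨rfl, h₁, h₂⟩
      have : X.score m ω = c m - posPart (ω.2.2.2.2 m) := by simp [score, hm, hi]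
      rw [Set.mem_preimage, this]
      constructor <;> linarith

theorem cutoff_mem_interior (m : Fin J) : c m ∈ interior (X.P.map (X.score m)).support := by
  by_cases hm : m ∈ X.T
  · rw [X.map_score_of_mem hm, X.cutoff_eq m hm]; exact X.cutoff_mem
  · exact mem_interior.2 ⟨_, X.Ioo_subset_support hm, isOpen_Ioo, by constructor <;> linarith⟩

/-- If `m` is untied, its noise is independent of `s` and of the noise of `l`, so it hits a
prescribed value with probability zero. If `m` is tied, its score is `s`, which is atomless and
independent of the noise of the untied `l`. -/
theorem P_score_eq {l m : Fin J} (hlm : l ≠ m) (h : l ∉ X.T ∨ m ∉ X.T) {f : ℝ → ℝ}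
    (hf : Measurable f) : X.P {ω | f (X.score l ω) = X.score m ω} = 0 := by
  have hE : MeasurableSet {ω | f (X.score l ω) = X.score m ω} :=
    measurableSet_eq_fun (hf.comp (X.measurable_score l)) (X.measurable_score m)
  rw [X.P_apply hE]
  by_cases hm : m ∈ X.T
  · have hl : l ∉ X.T := h.resolve_right (by simpa using hm)
    have key : ∀ a : ℝ → ℝ, Measurable a → ∀ᵐ s ∂X.law, noise J {u | a (u l) = s} = 0 := by
      intro a ha
      have hS : MeasurableSet {x : ℝ × (Fin J → ℝ) | a (x.2 l) = x.1} :=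
        measurableSet_eq_fun (ha.comp (by fun_prop)) measurable_fst
      -- Fubini in the other order: for fixed noise only one score qualifies, and the law of the
      -- score has no atoms.
      have h0 : (X.law.prod (noise J)) {x | a (x.2 l) = x.1} = 0 := by
        rw [Measure.prod_apply_symm hS]
        refine (lintegral_congr fun u => ?_).trans lintegral_zero
        refine measure_mono_null (t := {a (u l)}) (fun s hs => ?_)
          (X.law_absolutelyContinuous (measure_singleton _))
        exact (show a (u l) = s from hs).symm
      exact (Measure.measure_prod_null hS).1 h0
    have h₁ := key (fun x => f (c l + posPart x)) (hf.comp (measurable_posPart.const_add _))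
    have h₂ := key (fun x => f (c l - posPart x)) (hf.comp (measurable_posPart.const_sub _))
    rw [lintegral_eq_zero_iff (X.cond.measurable_coe hE)]
    filter_upwards [h₁, h₂] with s h₁ h₂
    refine le_antisymm ((X.cond_le_noise s hE ?_).trans (measure_union_null h₁ h₂).le) zero_le
    intro i y z u hω
    have hω' : f (X.score l (s, i, y, z, u)) = X.score m (s, i, y, z, u) := hω
    rw [X.score_of_mem hm] at hω'
    rcases X.score_eq_or hl (s, i, y, z, u) with e | e
    · left; rw [e] at hω'; exact hω'
    · right; rw [e] at hω'; exact hω'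
  · refine (lintegral_congr fun s => ?_).trans lintegral_zero
    have key : ∀ a : ℝ → ℝ, Measurable a →
        noise J ({u | posPart (u m) = a (u l) - c m} ∪ {u | posPart (u m) = c m - a (u l)}) = 0 :=
      fun a ha => measure_union_null (noise_posPart_eq hlm (ha.sub_const _))
        (noise_posPart_eq hlm (ha.const_sub _))
    have hcase : ∀ (a b : ℝ) i y z u, b = X.score m (s, i, y, z, u) → b = a →
        posPart (u m) = a - c m ∨ posPart (u m) = c m - a := by
      rintro a b i y z u hb rfl
      rcases X.score_eq_or hm (s, i, y, z, u) with e | e <;> rw [e] at hb <;> simp only at hb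
      · left; linarith
      · right; linarith
    -- The three null events are for `l` tied, `l` above its cutoff and `l` below it; each allows
    -- both signs for `m`.
    have h₀ := key (fun _ => f s) measurable_const
    have h₁ := key (fun x => f (c l + posPart x)) (hf.comp (measurable_posPart.const_add _))
    have h₂ := key (fun x => f (c l - posPart x)) (hf.comp (measurable_posPart.const_sub _))
    refine le_antisymm ((X.cond_le_noise s hE ?_).trans
      (measure_union_null h₀ (measure_union_null h₁ h₂)).le) zero_le
    intro i y z u hω
    have hω' : f (X.score l (s, i, y, z, u)) = X.score m (s, i, y, z, u) := hω
    by_cases hl : l ∈ X.T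
    · exact Or.inl (hcase _ _ i y z u hω' (by rw [X.score_of_mem hl]))
    · rcases X.score_eq_or hl (s, i, y, z, u) with e | e
      · exact Or.inr (Or.inl (hcase _ _ i y z u hω' (by rw [e])))
      · exact Or.inr (Or.inr (hcase _ _ i y z u hω' (by rw [e])))

/-- The local preference that the discrete type prescribes. -/
def localPair (i : Index J) : Choice J × Choice J := localOf X.T i.pref i.avail

/-- The potential outcomes: the observed outcome is that of the matched option. -/
def potential (d : Choice J) (ω : State J 𝒴) : 𝒴 :=
  if c j ≤ ω.1 then
    if d = (X.localPair ω.2.1).1 then ω.2.2.1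
    else if d = (X.localPair ω.2.1).2 then ω.2.2.2.1 else X.default
  else
    if d = (X.localPair ω.2.1).2 then ω.2.2.1
    else if d = (X.localPair ω.2.1).1 then ω.2.2.2.1 else X.default

theorem measurable_potential (d : Choice J) : Measurable (X.potential d) := by
  have hi : ∀ p : Index J → Prop, MeasurableSet {ω : State J 𝒴 | p ω.2.1} := fun p =>
    measurable_index (f := fun ω : State J 𝒴 => ω.2.1) (by fun_prop) {i | p i}
  unfold potential
  refine Measurable.ite (measurableSet_le measurable_const measurable_fst) ?_ ?_
  · exact Measurable.ite (hi fun i => d = (X.localPair i).1) (by fun_prop)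
      (Measurable.ite (hi fun i => d = (X.localPair i).2) (by fun_prop) measurable_const)
  · exact Measurable.ite (hi fun i => d = (X.localPair i).2) (by fun_prop)
      (Measurable.ite (hi fun i => d = (X.localPair i).1) (by fun_prop) measurable_const)

/-- The constructed economy. -/
def economy : Economy J c 𝒴 (State J 𝒴) where
  P := X.P
  prob := inferInstance
  pref ω := ω.2.1.pref
  score := X.score
  potential := X.potential
  prefSet ω := ω.2.1.set
  measurableSet_pref Q := measurable_index (f := fun ω : State J 𝒴 => ω.2.1) (by fun_prop)
    {i | i.pref = Q}
  measurable_score := X.measurable_score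
  measurable_potential := X.measurable_potential
  measurableSet_prefSet B := measurable_index (f := fun ω : State J 𝒴 => ω.2.1) (by fun_prop)
    {i | i.set = B}
  score_absolutelyContinuous := X.absolutelyContinuous_score
  cutoff_mem_interior := X.cutoff_mem_interior
  score_dichotomy l m := by
    by_cases hlm : l = m
    · left; subst hlm; exact ae_of_all _ fun _ => rfl
    by_cases h : l ∉ X.T ∨ m ∉ X.T
    · right; intro f hf
      rw [X.P_score_eq hlm h hf]; exact one_pos
    · left
      push Not at h
      exact ae_of_all _ fun ω => by rw [X.score_of_mem h.1, X.score_of_mem h.2]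

/-- The noise prevents accidental ties: an untied school's score equals that of `j` with probability
zero. -/
theorem tied_economy : X.economy.tied j = X.T := by
  ext m
  rw [Economy.mem_tied]
  constructor
  · rintro ⟨h, -⟩
    by_contra hm
    have hmj : m ≠ j := fun e => hm (e ▸ X.mem_T)
    have h0 := X.P_score_eq hmj (Or.inl hm) measurable_id
    have h1 : X.P {ω | id (X.score m ω) = X.score j ω} = 1 :=
      (measure_eq_measure_of_null_sdiff (Set.subset_univ _) (by
        rw [← Set.compl_eq_univ_sdiff]; exact h)).trans measure_univ
    rw [h0] at h1
    exact zero_ne_one h1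
  · intro hm
    exact ⟨ae_of_all _ fun ω => (X.score_of_mem hm ω).trans (X.score_of_mem X.mem_T ω).symm,
      X.cutoff_eq m hm⟩

theorem avail_economy_sdiff (ω : State J 𝒴) : X.economy.avail ω \ X.T = ω.2.1.avail \ X.T := by
  ext m
  simp only [Finset.mem_sdiff, Economy.mem_avail]
  exact and_congr_left fun hm => X.cutoff_le_score hm ω

theorem localPref_economy (ω : State J 𝒴) : X.economy.localPref j ω = X.localPair ω.2.1 := by
  rw [Economy.localPref_eq, tied_economy]
  exact localOf_congr _ (X.avail_economy_sdiff ω)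

/-- The comparison `c j ≤ s` that decides whether the tied schools are available also decides which
local option carries the observed coordinate. -/
theorem outcome_economy (ω : State J 𝒴) : X.economy.outcome ω = ω.2.2.1 := by
  have hmem : ∀ m ∈ X.T, (m ∈ X.economy.avail ω ↔ c j ≤ ω.1) := fun m hm => by
    rw [Economy.mem_avail, X.cutoff_eq m hm]
    exact (X.score_of_mem hm ω) ▸ Iff.rfl
  by_cases hs : c j ≤ ω.1
  · rw [Economy.outcome, Economy.matching_of_tied_subset (j := j), localPref_economy]
    · change X.potential _ ω = _
      simp [potential, hs]
    · rw [tied_economy]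
      exact fun m hm => (hmem m hm).2 hs
  · rw [Economy.outcome, Economy.matching_of_disjoint_tied (j := j), localPref_economy]
    · change X.potential _ ω = _
      simp [potential, hs]
    · rw [tied_economy]
      exact fun m hm h => hs ((hmem m hm).1 h)

theorem isCondVersion_cond : X.economy.IsCondVersion j X.cond := by
  refine ⟨inferInstance, fun F hF E hE => ?_⟩
  change X.P (X.score j ⁻¹' F ∩ E) = ∫⁻ s in F, X.cond s E ∂(X.P.map (X.score j))
  rw [X.map_score_of_mem X.mem_T, ← X.P_fst_inter hF hE]
  congr 2
  ext ω
  simp [X.score_of_mem X.mem_T]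

end Design

end LocalPref
namespace LocalPref

/-! ### Integrals of test functions, and weights of kinds given the local preference. -/

namespace Economy

variable {J : ℕ} {c : Fin J → ℝ} {𝒴 : Set ℝ} {Ω : Type*} [MeasurableSpace Ω]
  {M : Economy J c 𝒴 Ω} {j : Fin J} {κ : Kernel ℝ Ω} {𝒢 : Set (ℝ → ℝ)}

/-- Setwise convergence is enough because test functions are bounded on the outcome space. -/
theorem continuousTypes_of_tendsto [IsMarkovKernel κ] (h𝒢 : IsTestClass 𝒴 𝒢)
    (h : ∀ (R : Finset (Fin J)) (Q₀ : Preference J) (d : Choice J) (A : Set 𝒴), MeasurableSet A →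
      Tendsto (fun s => κ s (M.availEvent j R ∩ {ω | M.pref ω = Q₀} ∩ M.potential d ⁻¹' A))
        (𝓝 (c j))
        (𝓝 (κ (c j) (M.availEvent j R ∩ {ω | M.pref ω = Q₀} ∩ M.potential d ⁻¹' A)))) :
    M.ContinuousTypes κ j 𝒢 := by
  refine ⟨fun R Q₀ => ?_, fun R Q₀ d g hg => ?_⟩
  · have := h R Q₀ none Set.univ MeasurableSet.univ
    simp only [Set.preimage_univ, Set.inter_univ] at this
    exact (ENNReal.tendsto_toReal (measure_ne_top _ _)).comp this
  · obtain ⟨hgm, K, hK⟩ := h𝒢.1 g hg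
    let E := M.availEvent j R ∩ {ω | M.pref ω = Q₀}
    have hgm' : Measurable fun y : 𝒴 => g y := hgm.comp measurable_subtype_coe
    have e : ∀ s, ∫ ω in E, g (M.potential d ω) ∂(κ s) =
        ∫ y : 𝒴, g y ∂(((κ s).restrict E).map (M.potential d)) := fun s =>
      (integral_map (M.measurable_potential d).aemeasurable hgm'.aestronglyMeasurable).symm
    change Tendsto (fun s => ∫ ω in E, g (M.potential d ω) ∂(κ s)) (𝓝 (c j))
      (𝓝 (∫ ω in E, g (M.potential d ω) ∂(κ (c j))))
    simp_rw [e]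
    refine tendsto_integral_of_tendsto_measure (fun A hA => ?_) hgm' fun y => hK y y.2
    simp_rw [Measure.map_apply (M.measurable_potential d) hA,
      Measure.restrict_apply (M.measurable_potential d hA), Set.inter_comm _ E]
    exact h R Q₀ d A hA

theorem map_outcome_apply (M : Economy J c 𝒴 Ω) (μ : Measure Ω)
    (D : Finset (Choice J × Choice J)) {A : Set 𝒴} (hA : MeasurableSet A) :
    (μ.restrict {ω | M.prefSet ω = D}).map M.outcome A = μ (M.obsEvent D A) := by
  rw [Measure.map_apply M.measurable_outcome hA, Measure.restrict_apply (M.measurable_outcome hA),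
    Set.inter_comm]
  rfl

/-- Shows that the truncated integrals depend only on the law of the outcome given the set, hence
only on observables. -/
theorem setIntegral_truncEvent_eq (M : Economy J c 𝒴 Ω) (μ : Measure Ω)
    (D : Finset (Choice J × Choice J)) {g : ℝ → ℝ} (hg : Measurable g) (τ₁ τ₂ : EReal) :
    ∫ ω in M.truncEvent D g τ₁ τ₂, g (M.outcome ω) ∂μ =
      ∫ y in {y : 𝒴 | τ₁ < (g y : EReal) ∧ (g y : EReal) < τ₂}, g y
        ∂((μ.restrict {ω | M.prefSet ω = D}).map M.outcome) := by
  have hg' : Measurable fun y : 𝒴 => g y := hg.comp measurable_subtype_coe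
  have hS : MeasurableSet {y : 𝒴 | τ₁ < (g y : EReal) ∧ (g y : EReal) < τ₂} :=
    (measurableSet_lt measurable_const hg'.coe_real_ereal).inter
      (measurableSet_lt hg'.coe_real_ereal measurable_const)
  rw [setIntegral_map hS hg'.aestronglyMeasurable M.measurable_outcome.aemeasurable,
    Measure.restrict_restrict (M.measurable_outcome hS), Set.inter_comm]
  rfl

/-- The conditional probability of a preference and available schools given the local preference. -/
def kindWeight (M : Economy J c 𝒴 Ω) (j : Fin J) (Q : Preference J) (R : Finset (Fin J)) : ℝ≥0∞ :=
  M.P {ω | M.pref ω = Q ∧ M.avail ω = R} / M.P {ω | M.localPref j ω = localOf (M.tied j) Q R}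

theorem measurableSet_pref_avail (Q : Preference J) (R : Finset (Fin J)) :
    MeasurableSet {ω | M.pref ω = Q ∧ M.avail ω = R} :=
  M.measurableSet_kind fun Q' R' => Q' = Q ∧ R' = R

theorem kindWeight_le_one (Q : Preference J) (R : Finset (Fin J)) : M.kindWeight j Q R ≤ 1 := by
  refine ENNReal.div_le_of_le_mul ?_
  rw [one_mul]
  exact measure_mono fun ω h => by
    rw [Set.mem_ofPred_eq, localPref_eq, h.1, h.2]

theorem sum_kindWeight {q : Choice J × Choice J} (hq : M.P {ω | M.localPref j ω = q} ≠ 0) :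
    open Classical in
    ∑ x ∈ (Set.toFinite {x : Preference J × Finset (Fin J) |
      localOf (M.tied j) x.1 x.2 = q}).toFinset, M.kindWeight j x.1 x.2 = 1 := by
  classical
  have e : ∑ x ∈ (Set.toFinite {x : Preference J × Finset (Fin J) |
      localOf (M.tied j) x.1 x.2 = q}).toFinset, M.P {ω | M.pref ω = x.1 ∧ M.avail ω = x.2} =
      M.P {ω | M.localPref j ω = q} := by
    rw [← measure_biUnion_finset]
    · congr 1
      ext ω
      simp only [Set.mem_iUnion, Set.Finite.mem_toFinset, Set.mem_ofPred_eq, exists_prop,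
        localPref_eq]
      constructor
      · rintro ⟨x, h, h₁, h₂⟩; rw [h₁, h₂, h]
      · intro h; exact ⟨(_, _), h, rfl, rfl⟩
    · intro x _ y _ hxy
      refine Set.disjoint_left.2 fun ω h₁ h₂ => hxy (Prod.ext ?_ ?_)
      · exact h₁.1.symm.trans h₂.1
      · exact h₁.2.symm.trans h₂.2
    · exact fun x _ => measurableSet_pref_avail _ _
  rw [← ENNReal.div_self hq (measure_ne_top _ _)]
  nth_rewrite 1 [← e]
  rw [ENNReal.div_eq_inv_mul, Finset.mul_sum]
  refine Finset.sum_congr rfl fun x hx => ?_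
  rw [kindWeight, ENNReal.div_eq_inv_mul]
  simp only [Set.Finite.mem_toFinset, Set.mem_ofPred_eq] at hx
  rw [hx]

instance : Fintype (Preference J) := Fintype.ofFinite _

theorem sum_index_eq (F : Index J → ℝ≥0∞) :
    ∑ i, F i = ∑ D, ∑ x : Preference J × Finset (Fin J), F ⟨x.1, x.2, D⟩ := by
  refine Eq.trans ?_ (Fintype.sum_prod_type fun y : Finset (Choice J × Choice J) ×
    (Preference J × Finset (Fin J)) => F ⟨y.2.1, y.2.2, y.1⟩)
  exact (Fintype.sum_bijective (fun y : Finset (Choice J × Choice J) ×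
    (Preference J × Finset (Fin J)) => (⟨y.2.1, y.2.2, y.1⟩ : Index J))
    ⟨fun y y' h => by
      simp only [Index.mk.injEq] at h
      exact Prod.ext h.2.2 (Prod.ext h.1 h.2.1), fun i => ⟨(i.set, i.pref, i.avail), rfl⟩⟩
    _ _ fun _ => rfl).symm

/-- Weights of the kinds with local preference `q` sum to one if `q` has positive probability. For
null `q` they do not, so `g q = 0` is required there. -/
theorem sum_kindWeight_mul {g : Choice J × Choice J → ℝ≥0∞}
    (hg : ∀ q, M.P {ω | M.localPref j ω = q} = 0 → g q = 0) :
    ∑ x : Preference J × Finset (Fin J), M.kindWeight j x.1 x.2 * g (localOf (M.tied j) x.1 x.2) =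
      ∑ q, g q := by
  classical
  rw [← Finset.sum_fiberwise Finset.univ
    fun x : Preference J × Finset (Fin J) => localOf (M.tied j) x.1 x.2]
  refine Finset.sum_congr rfl fun q _ => ?_
  by_cases hq : M.P {ω | M.localPref j ω = q} = 0
  · rw [hg q hq]
    refine Finset.sum_eq_zero fun x hx => ?_
    rw [(Finset.mem_filter.1 hx).2, hg q hq, mul_zero]
  · calc _ = ∑ x ∈ Finset.univ.filter fun x : Preference J × Finset (Fin J) =>
          localOf (M.tied j) x.1 x.2 = q, M.kindWeight j x.1 x.2 * g q :=
        Finset.sum_congr rfl fun x hx => by rw [(Finset.mem_filter.1 hx).2]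
      _ = 1 * g q := by
        rw [← Finset.sum_mul, ← sum_kindWeight hq]
        congr 2
        ext x; simp
      _ = g q := one_mul _

theorem sum_index_kindWeight {g : Choice J × Choice J → Finset (Choice J × Choice J) → ℝ≥0∞}
    (hg : ∀ q, M.P {ω | M.localPref j ω = q} = 0 → ∀ D, g q D = 0) :
    ∑ i : Index J, M.kindWeight j i.pref i.avail *
      g (localOf (M.tied j) i.pref i.avail) i.set = ∑ D, ∑ q, g q D := by
  rw [sum_index_eq]
  exact Finset.sum_congr rfl fun D _ => sum_kindWeight_mul (g := fun q => g q D) fun q hq => hg q hq D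

end Economy

/-! ### From a split of the observed laws to a design. -/

variable {J : ℕ} {c : Fin J → ℝ} {𝒴 : Set ℝ} {Ω : Type*} [MeasurableSpace Ω]

/-- A split of the conditional laws of the observables of `M` among the local preferences: `part D q`
is the conditional law of the outcome on the event that the set of local preferences is `D` and the
local preference is `q`, and `right q`, `left q` are laws of the counterfactual outcome to the right
and to the left of the cutoff. -/
structure Split (M : Economy J c 𝒴 Ω) (κ : Kernel ℝ Ω) (j : Fin J) where
  part : Finset (Choice J × Choice J) → Choice J × Choice J → Kernel ℝ 𝒴
  finite : ∀ D q, IsFiniteKernel (part D q)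
  right : Choice J × Choice J → Measure 𝒴
  left : Choice J × Choice J → Measure 𝒴
  right_prob : ∀ q, IsProbabilityMeasure (right q)
  left_prob : ∀ q, IsProbabilityMeasure (left q)
  part_eq_zero : ∀ q, M.P {ω | M.localPref j ω = q} = 0 → ∀ D s, part D q s = 0
  sum_part : ∀ s, ∑ D, ∑ q, part D q s Set.univ = 1
  ae_obs : ∀ᵐ s ∂(M.P.map (M.score j)), ∀ D A, MeasurableSet A →
    ∑ q, part D q s A = κ s (M.obsEvent D A)
  ae_notMem : ∀ᵐ s ∂(M.P.map (M.score j)), ∀ D, ∀ q ∉ D, part D q s = 0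
  ae_mem : ∀ᵐ s ∂(M.P.map (M.score j)), ∀ D, ∀ q ∈ D, κ s {ω | M.prefSet ω = D} ≠ 0 →
    part D q s Set.univ ≠ 0

namespace Split

variable {M : Economy J c 𝒴 Ω} {κ : Kernel ℝ Ω} {j : Fin J} (S : Split M κ j)

instance (D q) : IsFiniteKernel (S.part D q) := S.finite D q

instance (q) : IsProbabilityMeasure (S.right q) := S.right_prob q

instance (q) : IsProbabilityMeasure (S.left q) := S.left_prob q

/-- The local preference of a discrete type. -/
abbrev pair (M : Economy J c 𝒴 Ω) (j : Fin J) (i : Index J) : Choice J × Choice J :=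
  localOf (M.tied j) i.pref i.avail

/-- The conditional law of the observed outcome on the event of a discrete type. -/
def own (i : Index J) : Kernel ℝ 𝒴 :=
  (S.part i.set (pair M j i)).withDensity fun _ _ => M.kindWeight j i.pref i.avail

theorem own_apply (i : Index J) (s : ℝ) (A : Set 𝒴) :
    S.own i s A = M.kindWeight j i.pref i.avail * S.part i.set (pair M j i) s A := by
  rw [own, Kernel.withDensity_apply _ measurable_const, withDensity_const, Measure.smul_apply,
    smul_eq_mul]

instance (i : Index J) : IsFiniteKernel (S.own i) := by
  refine Kernel.isFiniteKernel_withDensity_of_bounded _ (B := 1) ENNReal.one_ne_top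
    fun _ _ => Economy.kindWeight_le_one _ _

/-- The conditional law of the counterfactual outcome. -/
def other (i : Index J) : Kernel ℝ 𝒴 :=
  Kernel.piecewise (measurableSet_Ici : MeasurableSet (Set.Ici (c j)))
    (Kernel.const ℝ (S.right (pair M j i))) (Kernel.const ℝ (S.left (pair M j i)))

instance (i : Index J) : IsMarkovKernel (S.other i) := by unfold other; infer_instance

theorem other_apply (i : Index J) (s : ℝ) :
    S.other i s = if c j ≤ s then S.right (pair M j i) else S.left (pair M j i) := by
  rw [other, Kernel.piecewise_apply]
  rfl

theorem sum_own_mul (s : ℝ) (A : Set 𝒴)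
    (g : Choice J × Choice J → Finset (Choice J × Choice J) → ℝ≥0∞) :
    ∑ i, S.own i s A * g (pair M j i) i.set = ∑ D, ∑ q, S.part D q s A * g q D := by
  rw [← Economy.sum_index_kindWeight (M := M) (j := j) (g := fun q D => S.part D q s A * g q D)]
  · exact Finset.sum_congr rfl fun i _ => by rw [own_apply, mul_assoc]
  · intro q hq D
    rw [S.part_eq_zero q hq, Measure.coe_zero, Pi.zero_apply, zero_mul]

/-- If all parts of `q` vanished, no set containing `q` would occur; as `Q_j` belongs to its set
almost surely, `q` would be null. -/
theorem exists_part_ne_zero (hκ : M.IsCondVersion j κ) (hsharp : M.SharpSets κ j)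
    {q : Choice J × Choice J} (hq : M.P {ω | M.localPref j ω = q} ≠ 0) :
    ∃ D, ∫⁻ s, S.part D q s Set.univ ∂(M.P.map (M.score j)) ≠ 0 := by
  by_contra! h
  refine hq ?_
  have h' : ∀ᵐ s ∂(M.P.map (M.score j)), ∀ D, S.part D q s Set.univ = 0 :=
    ae_all_iff.2 fun D => (lintegral_eq_zero_iff
      ((S.part D q).measurable_coe MeasurableSet.univ)).1 (h D)
  rw [hκ.measure_eq (M.measurableSet_localPref j q)]
  rw [lintegral_eq_zero_iff (κ.measurable_coe (M.measurableSet_localPref j q))]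
  filter_upwards [h', S.ae_mem, hκ.ae_ae hsharp.1] with s h₁ h₂ h₃
  have h₄ : ∀ᵐ ω ∂(κ s), ∀ D, q ∈ D → M.prefSet ω ≠ D := by
    rw [ae_all_iff]
    intro D
    by_cases hqD : q ∈ D
    · have : κ s {ω | M.prefSet ω = D} = 0 := by
        by_contra hne
        exact h₂ D q hqD hne (h₁ D)
      refine (measure_eq_zero_iff_ae_notMem.1 this).mono fun ω hω _ => hω
    · exact ae_of_all _ fun ω h => absurd h hqD
  refine measure_eq_zero_iff_ae_notMem.2 ?_
  filter_upwards [h₃, h₄] with ω h₃ h₄ hω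
  refine h₄ _ ?_ rfl
  rw [← show M.localPref j ω = q from hω]
  exact h₃

theorem exists_own_ne_zero (hκ : M.IsCondVersion j κ) (hsharp : M.SharpSets κ j)
    {p : Finset (Fin J) → Prop} (hp : M.P {ω | p (M.avail ω)} ≠ 0) :
    ∃ i : Index J, p i.avail ∧ ∫⁻ s, S.own i s Set.univ ∂(M.P.map (M.score j)) ≠ 0 := by
  have : ∃ Q R, p R ∧ M.P {ω | M.pref ω = Q ∧ M.avail ω = R} ≠ 0 := by
    by_contra! h
    refine hp (measure_eq_zero_iff_ae_notMem.2 ?_)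
    have h' : ∀ᵐ ω ∂M.P, ∀ (Q : Preference J) (R : Finset (Fin J)), p R →
        ¬ (M.pref ω = Q ∧ M.avail ω = R) := by
      simp_rw [ae_all_iff]
      exact fun Q R hR => measure_eq_zero_iff_ae_notMem.1 (h Q R hR)
    filter_upwards [h'] with ω hω hpω
    exact hω _ _ hpω ⟨rfl, rfl⟩
  obtain ⟨Q, R, hR, h0⟩ := this
  have hq : M.P {ω | M.localPref j ω = localOf (M.tied j) Q R} ≠ 0 := fun h =>
    h0 (measure_mono_null (fun ω hω => by
      rw [Set.mem_ofPred_eq, Economy.localPref_eq, hω.1, hω.2]) h)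
  obtain ⟨D, hD⟩ := S.exists_part_ne_zero hκ hsharp hq
  refine ⟨⟨Q, R, D⟩, hR, ?_⟩
  simp_rw [own_apply]
  rw [lintegral_const_mul _ ((S.part _ _).measurable_coe MeasurableSet.univ)]
  refine mul_ne_zero ?_ hD
  exact (ENNReal.div_pos h0 (measure_ne_top _ _)).ne'

/-- The design of an economy with the given split. -/
def design (hκ : M.IsCondVersion j κ) (hsharp : M.SharpSets κ j) (y₀ : 𝒴) : Design J c 𝒴 j where
  T := M.tied j
  mem_T := Economy.mem_tied.2 ⟨ae_of_all _ fun _ => rfl, rfl⟩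
  cutoff_eq m hm := (Economy.mem_tied.1 hm).2
  law := M.P.map (M.score j)
  prob := inferInstance
  law_absolutelyContinuous := M.score_absolutelyContinuous j
  cutoff_mem := M.cutoff_mem_interior j
  own := S.own
  own_finite := inferInstance
  sum_own s := by
    have := S.sum_own_mul s Set.univ fun _ _ => 1
    simp only [mul_one] at this
    rw [this, S.sum_part]
  other := S.other
  other_markov := inferInstance
  default := y₀
  -- Were `m` almost never available, its score would be below the cutoff a.e., although the cutoff
  -- is interior to the support.
  exists_avail m _ := by
    refine S.exists_own_ne_zero hκ hsharp (p := fun R => m ∈ R) fun h => ?_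
    refine frequently_nhdsGT_of_ae (M.cutoff_mem_interior m) (p := fun s => ¬ c m ≤ s) ?_
      (eventually_nhdsWithin_of_forall fun s hs h => h (le_of_lt hs))
    refine (ae_map_iff (M.measurable_score m).aemeasurable measurableSet_Ici.compl).2 ?_
    refine (measure_eq_zero_iff_ae_notMem.1 h).mono fun ω hω hc => hω ?_
    exact (M.mem_avail ω m).2 hc
  exists_unavail m _ := by
    refine S.exists_own_ne_zero hκ hsharp (p := fun R => m ∉ R) fun h => ?_
    refine frequently_nhdsLT_of_ae (M.cutoff_mem_interior m) (p := fun s => c m ≤ s) ?_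
      (eventually_nhdsWithin_of_forall fun s hs => not_le.2 hs)
    refine (ae_map_iff (M.measurable_score m).aemeasurable measurableSet_Ici).2 ?_
    refine (measure_eq_zero_iff_ae_notMem.1 h).mono fun ω hω => ?_
    by_contra hc
    exact hω fun hm => hc ((M.mem_avail ω m).1 hm)

variable {S} {hκ : M.IsCondVersion j κ} {hsharp : M.SharpSets κ j} {y₀ : 𝒴}

theorem cond_obsEvent (s : ℝ) (D : Finset (Choice J × Choice J)) {A : Set 𝒴}
    (hA : MeasurableSet A) :
    (S.design hκ hsharp y₀).cond s ((S.design hκ hsharp y₀).economy.obsEvent D A) =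
      ∑ q, S.part D q s A := by
  classical
  rw [Design.cond_rectangle _ s (Economy.measurableSet_obsEvent _ D hA)
    (A := fun i => if i.set = D then A else ∅) (A' := fun _ => Set.univ) (U := fun _ => Set.univ)]
  · have := S.sum_own_mul s A fun _ D' => if D' = D then 1 else 0
    simp only [mul_ite, mul_one, mul_zero, Finset.sum_ite_irrel, Finset.sum_const_zero,
      Finset.sum_ite_eq', Finset.mem_univ, if_true] at this
    rw [← this]
    refine Finset.sum_congr rfl fun i _ => ?_
    rw [measure_univ, measure_univ, mul_one, mul_one]
    split_ifs
    · rfl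
    · exact measure_empty
  · intro i y z u
    simp only [Economy.obsEvent, Set.mem_inter_iff, Set.mem_ofPred_eq, Set.mem_preimage,
      Design.outcome_economy, Set.mem_univ, and_true]
    change i.set = D ∧ y ∈ A ↔ _
    by_cases h : i.set = D <;> simp [h]

theorem cond_localPref_prefSet (s : ℝ) (q : Choice J × Choice J)
    (D : Finset (Choice J × Choice J)) :
    (S.design hκ hsharp y₀).cond s {ω | (S.design hκ hsharp y₀).economy.localPref j ω = q ∧
      (S.design hκ hsharp y₀).economy.prefSet ω = D} = S.part D q s Set.univ := by
  classical
  have hE : MeasurableSet {ω | (S.design hκ hsharp y₀).economy.localPref j ω = q ∧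
      (S.design hκ hsharp y₀).economy.prefSet ω = D} :=
    (Economy.measurableSet_localPref _ j q).inter (Economy.measurableSet_prefSet _ D)
  rw [Design.cond_rectangle _ s hE
    (A := fun i => if pair M j i = q ∧ i.set = D then Set.univ else ∅)
    (A' := fun _ => Set.univ) (U := fun _ => Set.univ)]
  · have := S.sum_own_mul s Set.univ fun q' D' => if D' = D then if q' = q then 1 else 0 else 0
    simp only [mul_ite, mul_one, mul_zero, Finset.sum_ite_irrel, Finset.sum_const_zero,
      Finset.sum_ite_eq', Finset.mem_univ, if_true] at this
    rw [← this]
    refine Finset.sum_congr rfl fun i _ => ?_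
    rw [measure_univ, measure_univ, mul_one, mul_one]
    by_cases h₁ : pair M j i = q <;> by_cases h₂ : i.set = D <;>
      simp only [h₁, h₂, and_self, and_true, and_false, if_true, if_false, measure_empty] <;> rfl
  · intro i y z u
    simp only [Set.mem_ofPred_eq, Design.localPref_economy, Set.mem_univ, and_true]
    change pair M j i = q ∧ i.set = D ↔ _
    by_cases h₁ : pair M j i = q <;> by_cases h₂ : i.set = D <;> simp [h₁, h₂]

variable (S) in
/-- The law of `Y(d)` on the event that the local preference is `q`. -/
def potentialLaw (y₀ : 𝒴) (q : Choice J × Choice J) (d : Choice J) (A : Set 𝒴) (s : ℝ) : ℝ≥0∞ :=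
  if c j ≤ s then
    if d = q.1 then ∑ D, S.part D q s A
    else (∑ D, S.part D q s Set.univ) *
      if d = q.2 then S.right q A else A.indicator (fun _ => 1) y₀
  else
    if d = q.2 then ∑ D, S.part D q s A
    else (∑ D, S.part D q s Set.univ) *
      if d = q.1 then S.left q A else A.indicator (fun _ => 1) y₀

end Split

end LocalPref
namespace LocalPref

variable {J : ℕ} {c : Fin J → ℝ} {𝒴 : Set ℝ} {Ω : Type*} [MeasurableSpace Ω]

theorem Economy.obsEvent_univ (M : Economy J c 𝒴 Ω) (D : Finset (Choice J × Choice J)) :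
    M.obsEvent D Set.univ = {ω | M.prefSet ω = D} := by
  simp [Economy.obsEvent]

/-! ### The constructed economy has the same observables and satisfies the set assumptions. -/

namespace Split

variable {M : Economy J c 𝒴 Ω} {κ : Kernel ℝ Ω} {j : Fin J} {S : Split M κ j}
  {hκ : M.IsCondVersion j κ} {hsharp : M.SharpSets κ j} {y₀ : 𝒴}

/-- The total weight of the kinds with a given property. -/
def totalWeight (M : Economy J c 𝒴 Ω) (j : Fin J) (p : Preference J → Finset (Fin J) → Prop) :
    ℝ≥0∞ :=
  open Classical in
  ∑ x : Preference J × Finset (Fin J), if p x.1 x.2 then M.kindWeight j x.1 x.2 else 0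

theorem totalWeight_ne_top (p : Preference J → Finset (Fin J) → Prop) :
    totalWeight M j p ≠ ∞ := by
  refine ENNReal.sum_ne_top.2 fun x _ => ?_
  split_ifs
  · exact ne_top_of_le_ne_top ENNReal.one_ne_top (Economy.kindWeight_le_one _ _)
  · exact ENNReal.zero_ne_top

theorem totalWeight_localPref {q : Choice J × Choice J}
    (hq : M.P {ω | M.localPref j ω = q} ≠ 0) :
    totalWeight M j (fun Q R => localOf (M.tied j) Q R = q) = 1 := by
  classical
  have e : (Set.toFinite {x : Preference J × Finset (Fin J) |
      localOf (M.tied j) x.1 x.2 = q}).toFinset =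
      Finset.univ.filter fun x => localOf (M.tied j) x.1 x.2 = q := by
    ext x; simp
  rw [totalWeight, ← Economy.sum_kindWeight hq, e, Finset.sum_filter]
  exact Finset.sum_congr rfl fun x _ => by congr

/-- All kinds in question share the local preference `q`, so the laws of both outcomes depend on the
kind only through its weight, which factors out. -/
theorem cond_kind_rectangle (s : ℝ) {E : Set (State J 𝒴)} (hE : MeasurableSet E)
    {p : Preference J → Finset (Fin J) → Prop} {q : Choice J × Choice J}
    (hp : ∀ Q R, p Q R → localOf (M.tied j) Q R = q) {A A' : Set 𝒴}
    (h : ∀ i y z u, p i.pref i.avail → ((s, i, y, z, u) ∈ E ↔ y ∈ A ∧ z ∈ A'))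
    (h' : ∀ i y z u, (s, i, y, z, u) ∈ E → p i.pref i.avail) :
    (S.design hκ hsharp y₀).cond s E = totalWeight M j p *
      ((∑ D, S.part D q s A) * (if c j ≤ s then S.right q else S.left q) A') := by
  classical
  rw [Design.cond_rectangle _ s hE (A := fun i => if p i.pref i.avail then A else ∅)
    (A' := fun _ => A') (U := fun _ => Set.univ)]
  · rw [Economy.sum_index_eq, Finset.sum_mul, Finset.mul_sum]
    refine Finset.sum_congr rfl fun D _ => ?_
    rw [totalWeight, Finset.sum_mul]
    refine Finset.sum_congr rfl fun x _ => ?_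
    simp only [measure_univ, mul_one]
    change S.own _ s _ * S.other _ s _ = _
    split_ifs with hx hs hs
    · rw [own_apply, other_apply, if_pos hs]
      simp only [pair, hp _ _ hx, mul_assoc]
    · rw [own_apply, other_apply, if_neg hs]
      simp only [pair, hp _ _ hx, mul_assoc]
    · simp
    · simp
  · intro i y z u
    by_cases hi : p i.pref i.avail
    · simp [hi, h i y z u hi]
    · simp only [hi, if_false, Set.mem_empty_iff_false, false_and, iff_false]
      exact fun hE => hi (h' i y z u hE)

theorem cond_kind_potential (s : ℝ) {p : Preference J → Finset (Fin J) → Prop}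
    {q : Choice J × Choice J} (hp : ∀ Q R, p Q R → localOf (M.tied j) Q R = q) (d : Choice J)
    {A : Set 𝒴} (hA : MeasurableSet A) :
    (S.design hκ hsharp y₀).cond s {ω | p ω.2.1.pref ω.2.1.avail ∧
      (S.design hκ hsharp y₀).potential d ω ∈ A} =
        totalWeight M j p * S.potentialLaw y₀ q d A s := by
  classical
  have hE : MeasurableSet {ω : State J 𝒴 | p ω.2.1.pref ω.2.1.avail ∧
      (S.design hκ hsharp y₀).potential d ω ∈ A} :=
    (Design.measurable_index (f := fun ω : State J 𝒴 => ω.2.1) (by fun_prop)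
      {i | p i.pref i.avail}).inter ((S.design hκ hsharp y₀).measurable_potential d hA)
  have hq : ∀ i, p i.pref i.avail → (S.design hκ hsharp y₀).localPair i = q :=
    fun i hi => hp _ _ hi
  have huniv : (if c j ≤ s then S.right q else S.left q) Set.univ = 1 := by
    split_ifs <;> exact measure_univ
  -- The default outcome is constant, so its membership in `A` is encoded by a full or empty
  -- condition on the counterfactual coordinate.
  have hind : (if c j ≤ s then S.right q else S.left q) (if y₀ ∈ A then Set.univ else ∅) =
      A.indicator (fun _ => 1) y₀ := by
    by_cases h : y₀ ∈ A <;> simp [h, huniv]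
  by_cases hs : c j ≤ s
  · by_cases h₁ : d = q.1
    · rw [cond_kind_rectangle s hE hp (A := A) (A' := Set.univ) _ fun i y z u h => h.1]
      · rw [huniv, mul_one]; simp [potentialLaw, hs, h₁]
      · intro i y z u hi
        simp [hi, Design.potential, hs, hq i hi, h₁]
    by_cases h₂ : d = q.2
    · rw [cond_kind_rectangle s hE hp (A := Set.univ) (A' := A) _ fun i y z u h => h.1]
      · rw [potentialLaw, if_pos hs, if_pos hs, if_neg h₁, if_pos h₂]
      · intro i y z u hi
        simp only [Set.mem_ofPred_eq, hi, Design.potential, hs, hq i hi, h₁, if_true, if_false,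
          true_and, Set.mem_univ, if_pos h₂]
    · rw [cond_kind_rectangle s hE hp (A := Set.univ)
        (A' := if y₀ ∈ A then Set.univ else ∅) _ fun i y z u h => h.1]
      · rw [hind, potentialLaw, if_pos hs, if_neg h₁, if_neg h₂]
      · intro i y z u hi
        simp only [Set.mem_ofPred_eq, hi, Design.potential, hs, hq i hi, h₁, h₂, if_true, if_false,
          true_and, Set.mem_univ]
        change y₀ ∈ A ↔ _
        by_cases h : y₀ ∈ A <;> simp [h]
  · by_cases h₁ : d = q.2
    · rw [cond_kind_rectangle s hE hp (A := A) (A' := Set.univ) _ fun i y z u h => h.1]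
      · rw [huniv, mul_one]; simp [potentialLaw, hs, h₁]
      · intro i y z u hi
        simp [hi, Design.potential, hs, hq i hi, h₁]
    by_cases h₂ : d = q.1
    · rw [cond_kind_rectangle s hE hp (A := Set.univ) (A' := A) _ fun i y z u h => h.1]
      · rw [potentialLaw, if_neg hs, if_neg hs, if_neg h₁, if_pos h₂]
      · intro i y z u hi
        simp only [Set.mem_ofPred_eq, hi, Design.potential, hs, hq i hi, h₁, if_false,
          true_and, Set.mem_univ, if_pos h₂]
    · rw [cond_kind_rectangle s hE hp (A := Set.univ)
        (A' := if y₀ ∈ A then Set.univ else ∅) _ fun i y z u h => h.1]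
      · rw [hind, potentialLaw, if_neg hs, if_neg h₁, if_neg h₂]
      · intro i y z u hi
        simp only [Set.mem_ofPred_eq, hi, Design.potential, hs, hq i hi, h₁, h₂, if_false,
          true_and, Set.mem_univ]
        change y₀ ∈ A ↔ _
        by_cases h : y₀ ∈ A <;> simp [h]

theorem sameObservables (hκ : M.IsCondVersion j κ) (hsharp : M.SharpSets κ j) (y₀ : 𝒴) :
    M.SameObservables (S.design hκ hsharp y₀).economy j := by
  intro A D F hA hF
  have e : ∀ {Ω : Type _} [MeasurableSpace Ω] (N : Economy J c 𝒴 Ω),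
      {ω | N.outcome ω ∈ A ∧ N.prefSet ω = D ∧ N.score j ω ∈ F} =
        N.score j ⁻¹' F ∩ N.obsEvent D A := by
    intro Ω _ N
    ext ω
    simp only [Economy.obsEvent, Set.mem_inter_iff, Set.mem_preimage, Set.mem_ofPred_eq]
    tauto
  have e' : {ω | M.outcome ω ∈ A ∧ M.prefSet ω = D ∧ M.score j ω ∈ F} =
        M.score j ⁻¹' F ∩ M.obsEvent D A := by
    ext ω
    simp only [Economy.obsEvent, Set.mem_inter_iff, Set.mem_preimage, Set.mem_ofPred_eq]
    tauto
  rw [e, e', hκ.2 F hF _ (M.measurableSet_obsEvent D hA),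
    (Design.isCondVersion_cond _).2 F hF _ (Economy.measurableSet_obsEvent _ D hA)]
  rw [show (S.design hκ hsharp y₀).economy.P.map ((S.design hκ hsharp y₀).economy.score j) =
    M.P.map (M.score j) from (S.design hκ hsharp y₀).map_score_of_mem
      (S.design hκ hsharp y₀).mem_T]
  refine lintegral_congr_ae (ae_restrict_of_ae ?_)
  filter_upwards [S.ae_obs] with s hs
  rw [cond_obsEvent s D hA, hs D A hA]

theorem sharpSets (hκ : M.IsCondVersion j κ) (hsharp : M.SharpSets κ j) (y₀ : 𝒴) :
    (S.design hκ hsharp y₀).economy.SharpSets (S.design hκ hsharp y₀).cond j := by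
  have hlaw : (S.design hκ hsharp y₀).economy.P.map ((S.design hκ hsharp y₀).economy.score j) =
    M.P.map (M.score j) := (S.design hκ hsharp y₀).map_score_of_mem (S.design hκ hsharp y₀).mem_T
  refine ⟨?_, ?_⟩
  · have hpair : ∀ q D, q ∉ D → ∀ᵐ ω ∂(S.design hκ hsharp y₀).economy.P,
        ¬ ((S.design hκ hsharp y₀).economy.localPref j ω = q ∧
          (S.design hκ hsharp y₀).economy.prefSet ω = D) := by
      intro q D hqD
      have hE : MeasurableSet {ω | (S.design hκ hsharp y₀).economy.localPref j ω = q ∧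
          (S.design hκ hsharp y₀).economy.prefSet ω = D} :=
        (Economy.measurableSet_localPref _ j q).inter (Economy.measurableSet_prefSet _ D)
      refine measure_eq_zero_iff_ae_notMem.1 (((Design.isCondVersion_cond _).measure_eq hE).trans ?_)
      rw [hlaw, lintegral_eq_zero_iff (Kernel.measurable_coe _ hE)]
      filter_upwards [S.ae_notMem] with s hs
      rw [cond_localPref_prefSet, hs D q hqD]
      rfl
    have : ∀ᵐ ω ∂(S.design hκ hsharp y₀).economy.P, ∀ q D, q ∉ D →
        ¬ ((S.design hκ hsharp y₀).economy.localPref j ω = q ∧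
          (S.design hκ hsharp y₀).economy.prefSet ω = D) := by
      simp_rw [ae_all_iff]
      exact hpair
    filter_upwards [this] with ω hω
    by_contra h
    exact hω _ _ h ⟨rfl, rfl⟩
  · rw [hlaw]
    filter_upwards [S.ae_obs, S.ae_notMem, S.ae_mem] with s h₁ h₂ h₃ D hD q
    rw [cond_localPref_prefSet]
    rw [← Economy.obsEvent_univ, cond_obsEvent s D MeasurableSet.univ,
      h₁ D _ MeasurableSet.univ, Economy.obsEvent_univ] at hD
    constructor
    · intro h
      by_contra hq
      rw [h₂ D q hq] at h
      simp at h
    · intro hq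
      exact pos_iff_ne_zero.2 (h₃ D q hq hD.ne')

/-- Constancy of the support is required at every score near the cutoff, so a.e. agreement of
observables is too weak. They agree at all nearby scores except the cutoff, where `hcut` prescribes
the support. -/
theorem regularSets {𝒢 : Set (ℝ → ℝ)} (h𝒢 : IsTestClass 𝒴 𝒢)
    {Λp Λm : Set (Finset (Choice J × Choice J))} (hreg : M.RegularSets κ j 𝒢 Λp Λm)
    (hobs : ∀ᶠ s in 𝓝[≠] (c j), ∀ D A, MeasurableSet A →
      ∑ q, S.part D q s A = κ s (M.obsEvent D A))
    (hcut : ∀ D, D ∈ Λp ↔ ∑ q, S.part D q (c j) Set.univ ≠ 0)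
    (hκ : M.IsCondVersion j κ) (hsharp : M.SharpSets κ j) (y₀ : 𝒴) :
    (S.design hκ hsharp y₀).economy.RegularSets (S.design hκ hsharp y₀).cond j 𝒢 Λp Λm := by
  obtain ⟨⟨ε, hε, hp, hm⟩, hlim⟩ := hreg
  have hsupp : ∀ s, (∀ D A, MeasurableSet A → ∑ q, S.part D q s A = κ s (M.obsEvent D A)) →
      (S.design hκ hsharp y₀).economy.setSupport (S.design hκ hsharp y₀).cond s =
        M.setSupport κ s := by
    intro s hs
    ext D
    simp only [Economy.setSupport, Set.mem_ofPred_eq]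
    rw [← Economy.obsEvent_univ, ← Economy.obsEvent_univ, cond_obsEvent s D MeasurableSet.univ,
      hs D _ MeasurableSet.univ]
  have hint : ∀ s, (∀ D A, MeasurableSet A → ∑ q, S.part D q s A = κ s (M.obsEvent D A)) →
      ∀ D, ∀ g ∈ 𝒢, ∀ τ₁ τ₂ : EReal,
        ∫ ω in M.truncEvent D g τ₁ τ₂, g (M.outcome ω) ∂(κ s) =
        ∫ ω in (S.design hκ hsharp y₀).economy.truncEvent D g τ₁ τ₂,
          g ((S.design hκ hsharp y₀).economy.outcome ω) ∂((S.design hκ hsharp y₀).cond s) := by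
    intro s hs D g hg τ₁ τ₂
    rw [Economy.setIntegral_truncEvent_eq _ _ _ (h𝒢.1 g hg).1,
      Economy.setIntegral_truncEvent_eq _ _ _ (h𝒢.1 g hg).1]
    congr 2
    ext A hA
    rw [Economy.map_outcome_apply _ _ _ hA, Economy.map_outcome_apply _ _ _ hA,
      cond_obsEvent s D hA, hs D A hA]
  obtain ⟨δ, hδ, hδobs⟩ := Metric.eventually_nhds_iff.1 (eventually_nhdsWithin_iff.1 hobs)
  refine ⟨⟨min ε δ, lt_min hε hδ, fun e he he' => ?_, fun e he he' => ?_⟩,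
    fun g hg τ₁ τ₂ hτ => ⟨fun D hD => ?_, fun D hD => ?_⟩⟩
  · rcases he.eq_or_lt with rfl | he
    · ext D
      rw [add_zero, Economy.setSupport, Set.mem_ofPred_eq, ← Economy.obsEvent_univ,
        cond_obsEvent _ D MeasurableSet.univ, hcut, pos_iff_ne_zero]
    · rw [hsupp, hp e he.le (he'.trans_le (min_le_left _ _))]
      refine hδobs ?_ (by simpa using he.ne')
      rw [Real.dist_eq, add_sub_cancel_left, abs_of_pos he]
      exact he'.trans_le (min_le_right _ _)
  · rw [hsupp, hm e he (he'.trans_le (min_le_left _ _))]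
    refine hδobs ?_ (by simpa using he.ne')
    rw [Real.dist_eq, sub_sub_cancel_left, abs_neg, abs_of_pos he]
    exact he'.trans_le (min_le_right _ _)
  · obtain ⟨L, hL⟩ := (hlim g hg τ₁ τ₂ hτ).1 D hD
    refine ⟨L, hL.congr' ?_⟩
    filter_upwards [nhdsGT_le_nhdsNE _ hobs] with s hs using hint s hs D g hg τ₁ τ₂
  · obtain ⟨L, hL⟩ := (hlim g hg τ₁ τ₂ hτ).2 D hD
    refine ⟨L, hL.congr' ?_⟩
    filter_upwards [nhdsLT_le_nhdsNE _ hobs] with s hs using hint s hs D g hg τ₁ τ₂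

/-! ### Continuity of types for a split converging to the candidate. -/

section Limits

variable {ν : Choice J × Choice J → Choice J → Measure 𝒴}

variable (S ν) in
/-- At the cutoff, the split converges from both sides to the candidate `ν`. -/
structure ConvergesTo : Prop where
  mass : ∀ q, ν q q.1 Set.univ = ν q q.2 Set.univ
  at_cutoff : ∀ q A, MeasurableSet A → ∑ D, S.part D q (c j) A = ν q q.1 A
  from_right : ∀ q A, MeasurableSet A →
    Tendsto (fun s => ∑ D, S.part D q s A) (𝓝[>] (c j)) (𝓝 (ν q q.1 A))
  from_left : ∀ q A, MeasurableSet A →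
    Tendsto (fun s => ∑ D, S.part D q s A) (𝓝[<] (c j)) (𝓝 (ν q q.2 A))
  right_eq : ∀ q A, MeasurableSet A → ν q q.1 Set.univ * S.right q A = ν q q.2 A
  left_eq : ∀ q A, MeasurableSet A → ν q q.1 Set.univ * S.left q A = ν q q.1 A

theorem ConvergesTo.potentialLaw_cutoff (h : S.ConvergesTo ν) (q : Choice J × Choice J)
    (d : Choice J) {A : Set 𝒴} (hA : MeasurableSet A) :
    S.potentialLaw y₀ q d A (c j) =
      if d = q.1 then ν q q.1 A else if d = q.2 then ν q q.2 A else
        ν q q.1 Set.univ * A.indicator (fun _ => 1) y₀ := by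
  rw [potentialLaw, if_pos le_rfl, h.at_cutoff q A hA, h.at_cutoff q _ MeasurableSet.univ]
  split_ifs
  · rfl
  · exact h.right_eq q A hA
  · rfl

/-- On each side, one local outcome is observed and its law converges to the candidate. The other
has the mass of `q` times the normalized candidate, and the default outcome has that mass alone.
Since the masses converge as well, both sides meet at the cutoff. -/
theorem ConvergesTo.tendsto_potentialLaw (h : S.ConvergesTo ν) (q : Choice J × Choice J)
    (d : Choice J) {A : Set 𝒴} (hA : MeasurableSet A) :
    Tendsto (S.potentialLaw y₀ q d A) (𝓝 (c j)) (𝓝 (S.potentialLaw y₀ q d A (c j))) := by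
  have hi : A.indicator (fun _ => (1 : ℝ≥0∞)) y₀ ≠ ∞ := by
    by_cases hy : y₀ ∈ A <;> simp [hy]
  refine continuousAt_iff_continuous_left'_right'.2 ⟨?_, ?_⟩
  · rw [ContinuousWithinAt, h.potentialLaw_cutoff q d hA]
    have e : (fun s => if d = q.2 then ∑ D, S.part D q s A
        else (∑ D, S.part D q s Set.univ) *
          if d = q.1 then S.left q A else A.indicator (fun _ => 1) y₀) =ᶠ[𝓝[<] (c j)]
        S.potentialLaw y₀ q d A := by
      filter_upwards [self_mem_nhdsWithin] with s hs
      rw [potentialLaw, if_neg (not_le.2 hs)]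
    refine Tendsto.congr' e ?_
    have hu := h.from_left q _ MeasurableSet.univ
    rw [← h.mass q] at hu
    by_cases h₂ : d = q.2
    · simp only [h₂, if_true]
      -- If the local options coincide, `ν q q.1` and `ν q q.2` are the same measure, so both
      -- one-sided limits agree.
      by_cases h₁ : q.2 = q.1
      · have := h.from_left q A hA
        simpa only [h₁, if_true] using this
      · simpa only [h₁, if_false] using h.from_left q A hA
    · by_cases h₁ : d = q.1
      · simp only [h₁, if_true]
        rw [← h.left_eq q A hA]
        have h₂' : ¬ q.1 = q.2 := fun e => h₂ (h₁.trans e)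
        simp only [h₂', if_false]
        exact ENNReal.Tendsto.mul_const hu (Or.inr (measure_ne_top _ _))
      · simp only [h₂, h₁, if_false]
        exact ENNReal.Tendsto.mul_const hu (Or.inr hi)
  · rw [ContinuousWithinAt, h.potentialLaw_cutoff q d hA]
    have e : (fun s => if d = q.1 then ∑ D, S.part D q s A
        else (∑ D, S.part D q s Set.univ) *
          if d = q.2 then S.right q A else A.indicator (fun _ => 1) y₀) =ᶠ[𝓝[>] (c j)]
        S.potentialLaw y₀ q d A := by
      filter_upwards [self_mem_nhdsWithin] with s hs
      rw [potentialLaw, if_pos (le_of_lt hs)]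
    refine Tendsto.congr' e ?_
    have hu := h.from_right q _ MeasurableSet.univ
    by_cases h₁ : d = q.1
    · simpa only [h₁, if_true] using h.from_right q A hA
    · by_cases h₂ : d = q.2
      · simp only [h₁, if_false, if_pos h₂]
        rw [← h.right_eq q A hA]
        exact ENNReal.Tendsto.mul_const hu (Or.inr (measure_ne_top _ _))
      · simp only [h₂, h₁, if_false]
        exact ENNReal.Tendsto.mul_const hu (Or.inr hi)

theorem ConvergesTo.continuousTypes (h : S.ConvergesTo ν) {𝒢 : Set (ℝ → ℝ)}
    (h𝒢 : IsTestClass 𝒴 𝒢) (hκ : M.IsCondVersion j κ) (hsharp : M.SharpSets κ j) (y₀ : 𝒴) :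
    (S.design hκ hsharp y₀).economy.ContinuousTypes (S.design hκ hsharp y₀).cond j 𝒢 := by
  refine Economy.continuousTypes_of_tendsto h𝒢 fun R Q₀ d A hA => ?_
  have e : (S.design hκ hsharp y₀).economy.availEvent j R ∩
      {ω | (S.design hκ hsharp y₀).economy.pref ω = Q₀} ∩
        (S.design hκ hsharp y₀).economy.potential d ⁻¹' A =
      {ω | (ω.2.1.avail \ M.tied j = R \ M.tied j ∧ ω.2.1.pref = Q₀) ∧
        (S.design hκ hsharp y₀).potential d ω ∈ A} := by
    ext ω
    rw [Economy.availEvent_eq, Design.tied_economy]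
    have := (S.design hκ hsharp y₀).avail_economy_sdiff ω
    simp only [Set.mem_inter_iff, Set.mem_ofPred_eq, this]
    rfl
  rw [e]
  simp_rw [cond_kind_potential (S := S) (hκ := hκ) (hsharp := hsharp) (y₀ := y₀) _
    (p := fun Q R' => R' \ M.tied j = R \ M.tied j ∧ Q = Q₀) (q := localOf (M.tied j) Q₀ R)
    (fun Q R' hQ => by rw [hQ.2]; exact localOf_congr _ hQ.1) d hA]
  exact ENNReal.Tendsto.const_mul (h.tendsto_potentialLaw _ d hA) (Or.inr (totalWeight_ne_top _))

theorem ConvergesTo.jointLaw_eq (h : S.ConvergesTo ν) (hκ : M.IsCondVersion j κ)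
    (hsharp : M.SharpSets κ j) (y₀ : 𝒴) (q : Choice J × Choice J) {d : Choice J}
    (hd : d = q.1 ∨ d = q.2) :
    ν q d = (S.design hκ hsharp y₀).economy.jointLaw (S.design hκ hsharp y₀).cond j q d := by
  ext A hA
  rw [Economy.jointLaw_apply _ _ _ _ _ hA]
  have e : (S.design hκ hsharp y₀).economy.typeEvent j q d A =
      {ω | localOf (M.tied j) ω.2.1.pref ω.2.1.avail = q ∧
        (S.design hκ hsharp y₀).potential d ω ∈ A} := by
    ext ω
    simp only [Economy.typeEvent, Set.mem_inter_iff, Set.mem_ofPred_eq, Design.localPref_economy]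
    rfl
  rw [e, cond_kind_potential _ (p := fun Q R => localOf (M.tied j) Q R = q) (q := q)
    (fun _ _ h => h) d hA]
  have e₂ : S.potentialLaw y₀ q d A (c j) = ν q d A := by
    rw [h.potentialLaw_cutoff q d hA]
    by_cases h₁ : d = q.1
    · rw [if_pos h₁, h₁]
    · have h₂ := hd.resolve_left h₁
      rw [if_neg h₁, if_pos h₂, h₂]
  -- For a null local preference the kind weights need not sum to one, but then the candidate mass
  -- vanishes as well.
  by_cases hq : M.P {ω | M.localPref j ω = q} = 0
  · have h0 : ν q q.1 Set.univ = 0 := by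
      rw [← h.at_cutoff q _ MeasurableSet.univ]
      exact Finset.sum_eq_zero fun D _ => by rw [S.part_eq_zero q hq]; rfl
    have h0' : ν q d A = 0 := by
      refine measure_mono_null (Set.subset_univ _) ?_
      rcases hd with rfl | rfl
      · exact h0
      · rw [← h.mass, h0]
    rw [e₂, h0', mul_zero]
  · rw [totalWeight_localPref hq, one_mul, e₂]

theorem ConvergesTo.inSharpSet (h : S.ConvergesTo ν) {𝒢 : Set (ℝ → ℝ)} (h𝒢 : IsTestClass 𝒴 𝒢)
    (hκ : M.IsCondVersion j κ) (hsharp : M.SharpSets κ j) (y₀ : 𝒴)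
    {Λp Λm : Set (Finset (Choice J × Choice J))} (hreg : M.RegularSets κ j 𝒢 Λp Λm)
    (hobs : ∀ᶠ s in 𝓝[≠] (c j), ∀ D A, MeasurableSet A →
      ∑ q, S.part D q s A = κ s (M.obsEvent D A))
    (hcut : ∀ D, D ∈ Λp ↔ ∑ q, S.part D q (c j) Set.univ ≠ 0) :
    InSharpSet M j 𝒢 Λp Λm ν :=
  ⟨State J 𝒴, inferInstance, (S.design hκ hsharp y₀).economy, (S.design hκ hsharp y₀).cond,
    Design.isCondVersion_cond _, sameObservables hκ hsharp y₀, h.continuousTypes h𝒢 hκ hsharp y₀,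
    sharpSets hκ hsharp y₀, regularSets h𝒢 hreg hobs hcut hκ hsharp y₀,
    fun q _ hd => h.jointLaw_eq hκ hsharp y₀ q hd⟩

end Limits

end Split

end LocalPref
namespace LocalPref

/-! ### One-sided splits from the inequalities, and exceptional scores. -/

theorem tendsto_setLIntegral_of_tendsto_measure {α β : Type*} [MeasurableSpace α] {l : Filter β}
    [l.IsCountablyGenerated] {μ : β → Measure α} {ν : Measure α} [∀ i, IsFiniteMeasure (μ i)]
    [IsFiniteMeasure ν] (h : ∀ A, MeasurableSet A → Tendsto (fun i => μ i A) l (𝓝 (ν A)))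
    {f : α → ℝ} (hf : Measurable f) (hf0 : ∀ y, 0 ≤ f y) {K : ℝ} (hK : ∀ y, f y ≤ K) {A : Set α}
    (hA : MeasurableSet A) :
    Tendsto (fun i => ∫⁻ y in A, ENNReal.ofReal (f y) ∂(μ i)) l
      (𝓝 (∫⁻ y in A, ENNReal.ofReal (f y) ∂ν)) := by
  have e : ∀ (m : Measure α) [IsFiniteMeasure m], ∫⁻ y in A, ENNReal.ofReal (f y) ∂m =
      ENNReal.ofReal (∫ y in A, f y ∂m) := fun m _ =>
    (ofReal_integral_eq_lintegral_ofReal (Integrable.of_bound hf.aestronglyMeasurable K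
      (ae_of_all _ fun y => by rw [Real.norm_of_nonneg (hf0 y)]; exact hK y))
      (ae_of_all _ hf0)).symm
  simp_rw [e]
  refine ENNReal.tendsto_ofReal (tendsto_integral_of_tendsto_measure (fun B hB => ?_) hf
    (K := K) fun y => by rw [abs_of_nonneg (hf0 y)]; exact hK y)
  simp_rw [Measure.restrict_apply hB]
  exact h _ (hB.inter hA)

theorem exists_normalization {α : Type*} [MeasurableSpace α] [Nonempty α] (μ : Measure α)
    [IsFiniteMeasure μ] :
    ∃ π : Measure α, IsProbabilityMeasure π ∧ ∀ A, μ Set.univ * π A = μ A := by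
  by_cases h : μ Set.univ = 0
  · refine ⟨Measure.dirac (Classical.arbitrary α), inferInstance, fun A => ?_⟩
    rw [h, zero_mul]
    exact (measure_mono_null (Set.subset_univ A) h).symm
  · refine ⟨(μ Set.univ)⁻¹ • μ, ⟨?_⟩, fun A => ?_⟩
    · rw [Measure.smul_apply, smul_eq_mul, ENNReal.inv_mul_cancel h (measure_ne_top _ _)]
    · rw [Measure.smul_apply, smul_eq_mul, ← mul_assoc,
        ENNReal.mul_inv_cancel h (measure_ne_top _ _), one_mul]

variable {J : ℕ} {c : Fin J → ℝ} {𝒴 : Set ℝ} {Ω : Type*} [MeasurableSpace Ω]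
  {M : Economy J c 𝒴 Ω} {j : Fin J} {κ : Kernel ℝ Ω}

namespace Economy

variable (M) in
/-- The law of the outcome on the event that the set of local preferences is `D`. -/
def obsLaw (μ : Measure Ω) (D : Finset (Choice J × Choice J)) : Measure 𝒴 :=
  (μ.restrict {ω | M.prefSet ω = D}).map M.outcome

theorem obsLaw_apply (μ : Measure Ω) (D : Finset (Choice J × Choice J)) {A : Set 𝒴}
    (hA : MeasurableSet A) : M.obsLaw μ D A = μ (M.obsEvent D A) :=
  M.map_outcome_apply μ D hA

instance (μ : Measure Ω) [IsFiniteMeasure μ] (D : Finset (Choice J × Choice J)) :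
    IsFiniteMeasure (M.obsLaw μ D) := by unfold obsLaw; infer_instance

theorem sum_obsEvent_univ (μ : Measure Ω) [IsProbabilityMeasure μ] :
    ∑ D, μ (M.obsEvent D Set.univ) = 1 := by
  have := M.measure_containEvent μ MeasurableSet.univ Finset.univ
  rw [Finset.powerset_univ] at this
  rw [← this, ← measure_univ (μ := μ)]
  congr 1
  ext ω
  simp [containEvent]

/-- On either side of the cutoff, a candidate that satisfies the inequalities arises from a
measurable split of the sets of local preferences. -/
theorem IsSide.exists_split [IsMarkovKernel κ] {l : Filter ℝ} [l.IsCountablyGenerated]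
    {sel : Choice J × Choice J → Choice J} {Λ : Set (Finset (Choice J × Choice J))}
    (h : M.IsSide j κ l sel Λ) {n : Choice J × Choice J → Measure 𝒴} [∀ q, IsFiniteMeasure (n q)]
    (hmass : ∑ q, n q Set.univ = 1)
    (hineq : ∀ A : Set 𝒴, MeasurableSet A → ∀ B ∈ unionClass Λ, ∃ L : ℝ≥0∞,
      Tendsto (fun s => κ s (M.containEvent A B)) l (𝓝 L) ∧ L ≤ ∑ q ∈ B, n q A) :
    ∃ f : Finset (Choice J × Choice J) → Choice J × Choice J → 𝒴 → ℝ,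
      (∀ D q, Measurable (f D q)) ∧ (∀ D q y, 0 ≤ f D q y) ∧
      (∀ D q, q ∉ D → ∀ y, f D q y = 0) ∧ (∀ D, D.Nonempty → ∀ y, ∑ q, f D q y = 1) ∧
      (∀ q A, MeasurableSet A → Tendsto
        (fun s => ∑ D, ∫⁻ y in A, ENNReal.ofReal (f D q y) ∂(M.obsLaw (κ s) D)) l (𝓝 (n q A))) ∧
      ∀ q, (∀ D ∈ Λ, q ∉ D) → n q = 0 := by
  classical
  have hne : l.NeBot := ⟨fun hl => by
    have := h.frequently (fun _ => True) (ae_of_all _ fun _ => trivial)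
    simp [hl] at this⟩
  have hex : ∀ D, ∃ μ : Measure 𝒴, IsFiniteMeasure μ ∧ (D ∉ Λ → μ = 0) ∧
      ∀ A, MeasurableSet A → Tendsto (fun s => M.obsLaw (κ s) D A) l (𝓝 (μ A)) := by
    intro D
    by_cases hD : D ∈ Λ
    · have hL : ∀ A : Set 𝒴, ∃ L : ℝ≥0∞, MeasurableSet A →
          Tendsto (fun s => κ s (M.obsEvent D A)) l (𝓝 L) := fun A => by
        by_cases hA : MeasurableSet A
        · obtain ⟨L, hL⟩ := h.exists_limit D hA
          exact ⟨L, fun _ => hL⟩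
        · exact ⟨0, fun h => absurd h hA⟩
      choose L hL using hL
      -- The inequality for `D` itself dominates the setwise limit by a finite measure, so the limit
      -- is a measure.
      have hDu : D ∈ unionClass Λ := ⟨{D}, by simp, by simpa using hD, by simp⟩
      obtain ⟨μ, hμ, hμL⟩ := exists_measure_of_tendsto (l := l) (μ := fun s => M.obsLaw (κ s) D)
        (N := ∑ q ∈ D, n q) (L := L)
        (fun A hA => by simp_rw [obsLaw_apply _ D hA]; exact hL A hA) (fun A hA => by
          obtain ⟨L', hL', hle⟩ := hineq A hA D hDu
          rw [Measure.finsetSum_apply]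
          refine (le_of_tendsto_of_tendsto' (hL A hA) hL' fun s => measure_mono ?_).trans hle
          rintro ω ⟨h₁, h₂⟩
          exact ⟨h₂, (show M.prefSet ω = D from h₁).le⟩)
      refine ⟨μ, hμ, fun h => absurd hD h, fun A hA => ?_⟩
      simp_rw [hμL A hA, obsLaw_apply _ D hA]
      exact hL A hA
    · refine ⟨0, inferInstance, fun _ => rfl, fun A hA => ?_⟩
      refine tendsto_const_nhds.congr' ?_
      filter_upwards [h.obsEvent_eq_zero hD] with s hs
      rw [obsLaw_apply _ D hA, hs]; rfl
  choose μ hμfin hμ0 hμ using hex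
  have hmassμ : ∑ D, μ D Set.univ = 1 := by
    refine tendsto_nhds_unique (tendsto_finsetSum _ fun D _ => hμ D _ MeasurableSet.univ) ?_
    simp_rw [obsLaw_apply _ _ MeasurableSet.univ, sum_obsEvent_univ]
    exact tendsto_const_nhds
  have hall : ∀ B A, MeasurableSet A → ∑ D ∈ B.powerset, μ D A ≤ ∑ q ∈ B, n q A := by
    intro B A hA
    -- The inequalities cover only unions of members of `Λ`. Replacing `B` by the union of those
    -- inside it keeps all the mass and only reduces capacity.
    let C := B.powerset.filter fun D => D ∈ Λ
    have hC : ∑ D ∈ B.powerset, μ D A = ∑ D ∈ C, μ D A := by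
      refine (Finset.sum_subset (Finset.filter_subset _ _) fun D hD hDC => ?_).symm
      rw [hμ0 D fun hΛ => hDC (Finset.mem_filter.2 ⟨hD, hΛ⟩)]
      rfl
    rw [hC]
    rcases C.eq_empty_or_nonempty with hC0 | hCne
    · rw [hC0, Finset.sum_empty]; exact zero_le
    · have hB' : C.biUnion id ∈ unionClass Λ :=
        ⟨C, hCne, fun D hD => (Finset.mem_filter.1 hD).2, fun x => by simp⟩
      have hB'B : C.biUnion id ⊆ B := Finset.biUnion_subset.2 fun D hD =>
        Finset.mem_powerset.1 (Finset.mem_filter.1 hD).1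
      obtain ⟨L, hL, hle⟩ := hineq A hA _ hB'
      simp_rw [measure_containEvent _ _ hA, ← obsLaw_apply _ _ hA] at hL
      have hLe := tendsto_nhds_unique hL (tendsto_finsetSum _ fun D _ => hμ D A hA)
      calc ∑ D ∈ C, μ D A ≤ ∑ D ∈ (C.biUnion id).powerset, μ D A :=
            Finset.sum_le_sum_of_subset fun D hD =>
              Finset.mem_powerset.2 (Finset.subset_biUnion_of_mem id hD)
        _ = L := hLe.symm
        _ ≤ ∑ q ∈ C.biUnion id, n q A := hle
        _ ≤ ∑ q ∈ B, n q A := Finset.sum_le_sum_of_subset hB'B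
  obtain ⟨f, hf, hf0, hfD, hf1, hfn⟩ := exists_transport μ n hall (hmassμ.trans hmass.symm)
  refine ⟨f, hf, hf0, hfD, hf1, fun q A hA => ?_, fun q hq => ?_⟩
  · rw [← hfn q A hA]
    refine tendsto_finsetSum _ fun D _ => ?_
    refine tendsto_setLIntegral_of_tendsto_measure (hμ D) (hf D q) (hf0 D q) (K := 1)
      (fun y => ?_) hA
    by_cases hD : q ∈ D
    · rw [← hf1 D ⟨q, hD⟩ y]
      exact Finset.single_le_sum (fun q _ => hf0 D q y) (Finset.mem_univ q)
    · rw [hfD D q hD]; exact zero_le_one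
  · rw [← Measure.measure_univ_eq_zero, ← hfn q _ MeasurableSet.univ]
    refine Finset.sum_eq_zero fun D _ => ?_
    by_cases hD : D ∈ Λ
    · simp [hfD D q (hq D hD)]
    · simp [hμ0 D hD]

variable (M j) in
/-- A set of local preferences that occurs in `M` only with local preferences that have positive
probability. -/
def Relevant (D : Finset (Choice J × Choice J)) : Prop :=
  D.Nonempty ∧ ∀ q ∈ D, M.P {ω | M.localPref j ω = q} ≠ 0

/-- A set that occurs contains `Q_j`, so it is nonempty; by sharpness each member has positive
conditional probability, which null local preferences lack at almost every score. -/
theorem ae_relevant (hκ : M.IsCondVersion j κ) (hsharp : M.SharpSets κ j) :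
    ∀ᵐ s ∂(M.P.map (M.score j)), ∀ D, ¬ M.Relevant j D → κ s {ω | M.prefSet ω = D} = 0 := by
  have hbad : ∀ᵐ s ∂(M.P.map (M.score j)), ∀ q, M.P {ω | M.localPref j ω = q} = 0 →
      κ s {ω | M.localPref j ω = q} = 0 := by
    rw [ae_all_iff]
    intro q
    by_cases hq : M.P {ω | M.localPref j ω = q} = 0
    · have h := hq
      rw [hκ.measure_eq (M.measurableSet_localPref j q),
        lintegral_eq_zero_iff (κ.measurable_coe (M.measurableSet_localPref j q))] at h
      exact h.mono fun s hs _ => hs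
    · exact ae_of_all _ fun s h => absurd h hq
  filter_upwards [hbad, hκ.ae_ae hsharp.1, hsharp.2] with s h₁ h₂ h₃ D hD
  by_contra hne
  refine hD ⟨Finset.nonempty_iff_ne_empty.2 ?_, fun q hq hq0 => ?_⟩
  · rintro rfl
    refine hne (measure_mono_null (fun ω hω => ?_) h₂)
    have hω' : M.prefSet ω = ∅ := hω
    change ¬ (M.localPref j ω ∈ M.prefSet ω)
    simp [hω']
  · refine ((h₃ D (pos_iff_ne_zero.2 hne) q).2 hq).ne' ?_
    exact measure_mono_null (fun ω hω => hω.1) (h₁ q hq0)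

/-- Near the cutoff the support is constantly `Λ`, so one good score is enough for every member of
`Λ`. -/
theorem IsSide.relevant {l : Filter ℝ} {sel : Choice J × Choice J → Choice J}
    {Λ : Set (Finset (Choice J × Choice J))} (h : M.IsSide j κ l sel Λ)
    (hκ : M.IsCondVersion j κ) (hsharp : M.SharpSets κ j) {D : Finset (Choice J × Choice J)}
    (hD : D ∈ Λ) : M.Relevant j D := by
  obtain ⟨s, h₁, h₂⟩ := ((h.frequently _ (ae_relevant hκ hsharp)).and_eventually h.support).exists
  by_contra hn
  rw [← h₂] at hD
  exact (show 0 < κ s {ω | M.prefSet ω = D} from hD).ne' (h₁ D hn)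

variable (M j κ) in
/-- The scores at which only relevant sets of local preferences occur. -/
def relevantScores : Set ℝ := {s | ∀ D, ¬ M.Relevant j D → κ s {ω | M.prefSet ω = D} = 0}

theorem measurableSet_relevantScores : MeasurableSet (M.relevantScores j κ) := by
  simp only [relevantScores, Set.ofPred_forall]
  exact MeasurableSet.iInter fun D => MeasurableSet.iInter fun _ =>
    κ.measurable_coe (M.measurableSet_prefSet D) (measurableSet_singleton 0)

theorem mem_relevantScores_of_setSupport {s : ℝ} {Λ : Set (Finset (Choice J × Choice J))}
    (hs : M.setSupport κ s = Λ) (hΛ : ∀ D ∈ Λ, M.Relevant j D) : s ∈ M.relevantScores j κ := by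
  intro D hD
  by_contra hne
  refine hD (hΛ D ?_)
  rw [← hs]
  exact pos_iff_ne_zero.2 hne

variable (M j κ) in
/-- The conditional law of the outcome on the event that the set of local preferences is `D`,
modified on a null set. -/
def obsKernel (D : Finset (Choice J × Choice J)) : Kernel ℝ 𝒴 :=
  open Classical in
  Kernel.piecewise (measurableSet_relevantScores (M := M) (j := j) (κ := κ))
    ((κ.restrict (M.measurableSet_prefSet D)).map M.outcome)
    (Kernel.const ℝ (M.obsLaw (κ (c j)) D))

theorem obsKernel_apply_of_mem {s : ℝ} (hs : s ∈ M.relevantScores j κ)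
    (D : Finset (Choice J × Choice J)) : M.obsKernel j κ D s = M.obsLaw (κ s) D := by
  classical
  rw [obsKernel, Kernel.piecewise_apply, if_pos hs, Kernel.map_apply _ M.measurable_outcome,
    Kernel.restrict_apply]
  rfl

/-- Properties of the observed law at relevant scores thus hold for the modified kernel at every
score, as the pointwise fields of `Split` require. -/
theorem exists_obsKernel_eq (hc : c j ∈ M.relevantScores j κ) (s : ℝ) :
    ∃ s' ∈ M.relevantScores j κ, ∀ D, M.obsKernel j κ D s = M.obsLaw (κ s') D := by
  classical
  by_cases hs : s ∈ M.relevantScores j κ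
  · exact ⟨s, hs, obsKernel_apply_of_mem hs⟩
  · refine ⟨c j, hc, fun D => ?_⟩
    rw [obsKernel, Kernel.piecewise_apply, if_neg hs, Kernel.const_apply]

instance [IsMarkovKernel κ] (D : Finset (Choice J × Choice J)) :
    IsFiniteKernel (M.obsKernel j κ D) := by
  classical
  unfold obsKernel
  infer_instance

theorem sum_obsKernel [IsMarkovKernel κ] (hc : c j ∈ M.relevantScores j κ) (s : ℝ) :
    ∑ D, M.obsKernel j κ D s Set.univ = 1 := by
  obtain ⟨s', -, h⟩ := exists_obsKernel_eq hc s
  simp_rw [h, obsLaw_apply _ _ MeasurableSet.univ]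
  exact sum_obsEvent_univ _

theorem obsKernel_eq_zero (hc : c j ∈ M.relevantScores j κ) (s : ℝ)
    {D : Finset (Choice J × Choice J)} (hD : ¬ M.Relevant j D) : M.obsKernel j κ D s = 0 := by
  obtain ⟨s', hs', h⟩ := exists_obsKernel_eq hc s
  rw [h, ← Measure.measure_univ_eq_zero, obsLaw_apply _ _ MeasurableSet.univ, obsEvent_univ]
  exact hs' D hD

end Economy

/-! ### Perturbed shares that make every member of a set possible. -/

section Weight

/-- The distance to the cutoff, truncated. -/
def gap (a s : ℝ) : ℝ := min 1 |s - a|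

theorem gap_nonneg (a s : ℝ) : 0 ≤ gap a s := le_min zero_le_one (abs_nonneg _)

theorem gap_le_one (a s : ℝ) : gap a s ≤ 1 := min_le_left _ _

theorem gap_pos {a s : ℝ} (h : s ≠ a) : 0 < gap a s :=
  lt_min one_pos (abs_pos.2 (sub_ne_zero.2 h))

theorem continuous_gap (a : ℝ) : Continuous (gap a) := by unfold gap; fun_prop

theorem gap_self (a : ℝ) : gap a a = 0 := by simp [gap]

variable {ι : Type*} [DecidableEq ι]

/-- The uniform weights on `D`. -/
def uniformWeight (D : Finset ι) (q : ι) : ℝ := if q ∈ D then (D.card : ℝ)⁻¹ else 0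

theorem uniformWeight_nonneg (D : Finset ι) (q : ι) : 0 ≤ uniformWeight D q := by
  unfold uniformWeight
  split_ifs
  · exact inv_nonneg.2 (Nat.cast_nonneg _)
  · exact le_rfl

theorem uniformWeight_pos {D : Finset ι} {q : ι} (h : q ∈ D) : 0 < uniformWeight D q := by
  rw [uniformWeight, if_pos h]
  exact inv_pos.2 (Nat.cast_pos.2 (Finset.card_pos.2 ⟨q, h⟩))

theorem sum_uniformWeight [Fintype ι] {D : Finset ι} (h : D.Nonempty) :
    ∑ q, uniformWeight D q = 1 := by
  simp only [uniformWeight, Finset.sum_ite_mem, Finset.univ_inter, Finset.sum_const, nsmul_eq_mul]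
  exact mul_inv_cancel₀ (by exact_mod_cast h.card_ne_zero)

/-- The share of the local preference `q` in the set `D` at the score `s`: the split on the
respective side of the cutoff, with a small uniform component that vanishes at the cutoff. -/
def share {α : Type*} (a : ℝ) (f g : Finset ι → ι → α → ℝ) (D : Finset ι) (q : ι) (s : ℝ) (y : α) :
    ℝ :=
  (1 - gap a s) * (if a < s then f D q y else g D q y) + gap a s * uniformWeight D q

variable {α : Type*} {f g : Finset ι → ι → α → ℝ} {a : ℝ}

theorem share_nonneg (hf : ∀ D q y, 0 ≤ f D q y) (hg : ∀ D q y, 0 ≤ g D q y) (D : Finset ι)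
    (q : ι) (s : ℝ) (y : α) : 0 ≤ share a f g D q s y := by
  refine add_nonneg (mul_nonneg (sub_nonneg.2 (gap_le_one a s)) ?_)
    (mul_nonneg (gap_nonneg a s) (uniformWeight_nonneg D q))
  split_ifs
  · exact hf D q y
  · exact hg D q y

theorem share_eq_zero (hf : ∀ D q, q ∉ D → ∀ y, f D q y = 0) (hg : ∀ D q, q ∉ D → ∀ y, g D q y = 0)
    {D : Finset ι} {q : ι} (h : q ∉ D) (s : ℝ) (y : α) : share a f g D q s y = 0 := by
  simp [share, hf D q h, hg D q h, uniformWeight, h]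

/-- Off the cutoff this lower bound is positive for `q ∈ D`; it delivers sharpness even where the
transport ships nothing to `q`. -/
theorem le_share (hf : ∀ D q y, 0 ≤ f D q y) (hg : ∀ D q y, 0 ≤ g D q y) (D : Finset ι)
    (q : ι) (s : ℝ) (y : α) : gap a s * uniformWeight D q ≤ share a f g D q s y := by
  refine le_add_of_nonneg_left (mul_nonneg (sub_nonneg.2 (gap_le_one a s)) ?_)
  split_ifs
  · exact hf D q y
  · exact hg D q y

theorem sum_share [Fintype ι] (hf : ∀ D, D.Nonempty → ∀ y, ∑ q, f D q y = 1)
    (hg : ∀ D, D.Nonempty → ∀ y, ∑ q, g D q y = 1) {D : Finset ι} (h : D.Nonempty) (s : ℝ) (y : α) :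
    ∑ q, share a f g D q s y = 1 := by
  simp only [share, Finset.sum_add_distrib, ← Finset.mul_sum]
  rw [sum_uniformWeight h]
  split_ifs
  · rw [hf D h]; ring
  · rw [hg D h]; ring

variable [MeasurableSpace α]

theorem measurable_share (hf : ∀ D q, Measurable (f D q)) (hg : ∀ D q, Measurable (g D q))
    (D : Finset ι) (q : ι) :
    Measurable (Function.uncurry fun s y => ENNReal.ofReal (share a f g D q s y)) := by
  have hgap := (continuous_gap a).measurable
  refine Measurable.ennreal_ofReal ?_
  change Measurable fun x : ℝ × α => (1 - gap a x.1) * (if a < x.1 then f D q x.2 else g D q x.2) +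
    gap a x.1 * uniformWeight D q
  refine (Measurable.mul (by fun_prop) (Measurable.ite ?_ ?_ ?_)).add (by fun_prop)
  · exact measurableSet_lt measurable_const measurable_fst
  · exact (hf D q).comp measurable_snd
  · exact (hg D q).comp measurable_snd

theorem setLIntegral_share (hf : ∀ D q, Measurable (f D q)) (hg : ∀ D q, Measurable (g D q))
    (hf0 : ∀ D q y, 0 ≤ f D q y) (hg0 : ∀ D q y, 0 ≤ g D q y) (D : Finset ι) (q : ι) (s : ℝ)
    (μ : Measure α) (A : Set α) :
    ∫⁻ y in A, ENNReal.ofReal (share a f g D q s y) ∂μ =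
      ENNReal.ofReal (1 - gap a s) *
        (if a < s then ∫⁻ y in A, ENNReal.ofReal (f D q y) ∂μ
          else ∫⁻ y in A, ENNReal.ofReal (g D q y) ∂μ) +
      ENNReal.ofReal (gap a s * uniformWeight D q) * μ A := by
  have h1 := sub_nonneg.2 (gap_le_one a s)
  have hu := mul_nonneg (gap_nonneg a s) (uniformWeight_nonneg D q)
  split_ifs with hs
  · simp_rw [share, if_pos hs, ENNReal.ofReal_add (mul_nonneg h1 (hf0 D q _)) hu,
      ENNReal.ofReal_mul h1]
    rw [lintegral_add_right _ measurable_const, lintegral_const_mul _ (hf D q).ennreal_ofReal,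
      setLIntegral_const]
  · simp_rw [share, if_neg hs, ENNReal.ofReal_add (mul_nonneg h1 (hg0 D q _)) hu,
      ENNReal.ofReal_mul h1]
    rw [lintegral_add_right _ measurable_const, lintegral_const_mul _ (hg D q).ennreal_ofReal,
      setLIntegral_const]

end Weight

end LocalPref
namespace LocalPref

variable {J : ℕ} {c : Fin J → ℝ} {𝒴 : Set ℝ} {Ω : Type*} [MeasurableSpace Ω]
  {M : Economy J c 𝒴 Ω} {j : Fin J} {κ : Kernel ℝ Ω}

/-! ### The split realizing a candidate. -/

section SplitKernel

variable (M j κ) in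
/-- Away from the cutoff, the conditional law of the observables is split with the weights `share`;
at the cutoff, the local preference has the candidate law and the set of local preferences is
independent, with law `u`. -/
def splitKernel [IsMarkovKernel κ] (n : Choice J × Choice J → Measure 𝒴)
    (u : Finset (Choice J × Choice J) → ℝ≥0∞)
    (f g : Finset (Choice J × Choice J) → Choice J × Choice J → 𝒴 → ℝ)
    (D : Finset (Choice J × Choice J)) (q : Choice J × Choice J) : Kernel ℝ 𝒴 :=
  open Classical in
  Kernel.piecewise (measurableSet_singleton (c j)) (Kernel.const ℝ (u D • n q))
    ((M.obsKernel j κ D).withDensity fun s y => ENNReal.ofReal (share (c j) f g D q s y))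

variable [IsMarkovKernel κ] {n : Choice J × Choice J → Measure 𝒴}
  {u : Finset (Choice J × Choice J) → ℝ≥0∞}
  {f g : Finset (Choice J × Choice J) → Choice J × Choice J → 𝒴 → ℝ}
  {D : Finset (Choice J × Choice J)} {q : Choice J × Choice J}

theorem splitKernel_cutoff : splitKernel M j κ n u f g D q (c j) = u D • n q := by
  classical
  rw [splitKernel, Kernel.piecewise_apply, if_pos (Set.mem_singleton _), Kernel.const_apply]

theorem splitKernel_apply (hf : ∀ D q, Measurable (f D q)) (hg : ∀ D q, Measurable (g D q))
    {s : ℝ} (hs : s ≠ c j) {A : Set 𝒴} (hA : MeasurableSet A) :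
    splitKernel M j κ n u f g D q s A =
      ∫⁻ y in A, ENNReal.ofReal (share (c j) f g D q s y) ∂(M.obsKernel j κ D s) := by
  classical
  rw [splitKernel, Kernel.piecewise_apply, if_neg (by simpa using hs),
    Kernel.withDensity_apply _ (measurable_share hf hg D q), withDensity_apply _ hA]

theorem sum_splitKernel_apply (hc : c j ∈ M.relevantScores j κ)
    (hf : ∀ D q, Measurable (f D q)) (hg : ∀ D q, Measurable (g D q))
    (hf0 : ∀ D q y, 0 ≤ f D q y) (hg0 : ∀ D q y, 0 ≤ g D q y)
    (hf1 : ∀ D, D.Nonempty → ∀ y, ∑ q, f D q y = 1)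
    (hg1 : ∀ D, D.Nonempty → ∀ y, ∑ q, g D q y = 1)
    {s : ℝ} (hs : s ≠ c j) {A : Set 𝒴} (hA : MeasurableSet A) :
    ∑ q, splitKernel M j κ n u f g D q s A = M.obsKernel j κ D s A := by
  simp_rw [splitKernel_apply hf hg hs hA]
  by_cases hD : M.Relevant j D
  · have hm : ∀ q, Measurable fun y => ENNReal.ofReal (share (c j) f g D q s y) := fun q =>
      Measurable.of_uncurry_left (measurable_share hf hg D q)
    have h1 : ∀ y, ∑ q, ENNReal.ofReal (share (c j) f g D q s y) = 1 := fun y => by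
      rw [← ENNReal.ofReal_sum_of_nonneg fun q _ => share_nonneg hf0 hg0 D q s y,
        sum_share hf1 hg1 hD.1, ENNReal.ofReal_one]
    have h2 := lintegral_finsetSum (μ := (M.obsKernel j κ D s).restrict A) Finset.univ
      fun q _ => hm q
    rw [← h2, lintegral_congr h1, setLIntegral_one]
  · simp [M.obsKernel_eq_zero hc s hD]

theorem isFiniteKernel_splitKernel (hf0 : ∀ D q y, 0 ≤ f D q y) (hg0 : ∀ D q y, 0 ≤ g D q y)
    (hf1 : ∀ D, D.Nonempty → ∀ y, ∑ q, f D q y = 1)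
    (hg1 : ∀ D, D.Nonempty → ∀ y, ∑ q, g D q y = 1)
    (hfD : ∀ D q, q ∉ D → ∀ y, f D q y = 0) (hgD : ∀ D q, q ∉ D → ∀ y, g D q y = 0)
    [∀ q, IsFiniteMeasure (n q)] (hu : ∀ D, u D ≠ ∞) :
    IsFiniteKernel (splitKernel M j κ n u f g D q) := by
  have h₁ : IsFiniteMeasure (u D • n q) := (n q).smul_finite (hu D)
  have h₂ : IsFiniteKernel ((M.obsKernel j κ D).withDensity
      fun s y => ENNReal.ofReal (share (c j) f g D q s y)) := by
    refine Kernel.isFiniteKernel_withDensity_of_bounded _ (B := 1) ENNReal.one_ne_top fun s y => ?_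
    rw [← ENNReal.ofReal_one]
    refine ENNReal.ofReal_le_ofReal ?_
    by_cases hq : q ∈ D
    · rw [← sum_share (a := c j) hf1 hg1 ⟨q, hq⟩ s y]
      exact Finset.single_le_sum (fun q _ => share_nonneg hf0 hg0 D q s y) (Finset.mem_univ q)
    · rw [share_eq_zero hfD hgD hq]; exact zero_le_one
  classical
  unfold splitKernel
  infer_instance

/-- The uniform component is bounded by multiples of `gap`, which tends to zero, so the limit is
that of the pure transport split. -/
theorem tendsto_sum_splitKernel {l : Filter ℝ} (hl : l ≤ 𝓝 (c j))
    (hne : ∀ᶠ s in l, s ≠ c j) (hrel : ∀ᶠ s in l, s ∈ M.relevantScores j κ)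
    (hf : ∀ D q, Measurable (f D q)) (hg : ∀ D q, Measurable (g D q))
    (hf0 : ∀ D q y, 0 ≤ f D q y) (hg0 : ∀ D q y, 0 ≤ g D q y)
    {h : Finset (Choice J × Choice J) → Choice J × Choice J → 𝒴 → ℝ}
    (hh : ∀ᶠ s in l, (if c j < s then f else g) = h) {A : Set 𝒴} (hA : MeasurableSet A)
    {L : ℝ≥0∞} (hL : Tendsto
      (fun s => ∑ D, ∫⁻ y in A, ENNReal.ofReal (h D q y) ∂(M.obsLaw (κ s) D)) l (𝓝 L)) :
    Tendsto (fun s => ∑ D, splitKernel M j κ n u f g D q s A) l (𝓝 L) := by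
  have hgap : Tendsto (gap (c j)) l (𝓝 0) := by
    have := (continuous_gap (c j)).tendsto (c j)
    rw [gap_self] at this
    exact this.mono_left hl
  have h₁ : Tendsto (fun s => ENNReal.ofReal (1 - gap (c j) s) *
      ∑ D, ∫⁻ y in A, ENNReal.ofReal (h D q y) ∂(M.obsLaw (κ s) D)) l (𝓝 L) := by
    have h1 : Tendsto (fun s => ENNReal.ofReal (1 - gap (c j) s)) l (𝓝 1) := by
      have := ENNReal.tendsto_ofReal (hgap.const_sub 1)
      simpa using this
    have := ENNReal.Tendsto.mul h1 (Or.inl one_ne_zero) hL (Or.inr ENNReal.one_ne_top)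
    rwa [one_mul] at this
  have h₂ : Tendsto (fun s => ∑ D : Finset (Choice J × Choice J),
      ENNReal.ofReal (gap (c j) s * uniformWeight D q) * M.obsLaw (κ s) D A) l (𝓝 0) := by
    have h0 : Tendsto (fun s => ∑ D : Finset (Choice J × Choice J),
        ENNReal.ofReal (gap (c j) s * uniformWeight D q)) l (𝓝 0) := by
      have := tendsto_finsetSum (Finset.univ : Finset (Finset (Choice J × Choice J))) fun D _ =>
        ENNReal.tendsto_ofReal (hgap.mul_const (uniformWeight D q))
      simpa using this
    refine tendsto_of_tendsto_of_tendsto_of_le_of_le tendsto_const_nhds h0 (fun _ => zero_le)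
      fun s => Finset.sum_le_sum fun D _ => ?_
    refine mul_le_of_le_one_right' ?_
    rw [Economy.obsLaw_apply _ D hA]
    exact prob_le_one
  have := h₁.add h₂
  rw [add_zero] at this
  refine this.congr' ?_
  filter_upwards [hne, hrel, hh] with s hs hs' hh
  rw [Finset.mul_sum, ← Finset.sum_add_distrib]
  refine Finset.sum_congr rfl fun D _ => ?_
  rw [splitKernel_apply hf hg hs hA, setLIntegral_share hf hg hf0 hg0,
    M.obsKernel_apply_of_mem hs', ← hh]
  split_ifs <;> rfl

end SplitKernel

/-- A candidate that satisfies the inequalities belongs to the sharp set. -/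
theorem IsCandidate.inSharpSet {𝒢 : Set (ℝ → ℝ)} {Λp Λm : Set (Finset (Choice J × Choice J))}
    {ν : Choice J × Choice J → Choice J → Measure 𝒴} (hν : IsCandidate ν)
    (hineq : Inequalities M κ j Λp Λm ν) (h𝒴 : IsCompact 𝒴) (h𝒢 : IsTestClass 𝒴 𝒢)
    (hκ : M.IsCondVersion j κ) (hsharp : M.SharpSets κ j) (hreg : M.RegularSets κ j 𝒢 Λp Λm) :
    InSharpSet M j 𝒢 Λp Λm ν := by
  classical
  have := hκ.1
  have hR := Economy.isSide_right h𝒴 h𝒢 hκ hreg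
  have hL := Economy.isSide_left h𝒴 h𝒢 hκ hreg
  obtain ⟨ω₀⟩ : Nonempty Ω := nonempty_of_isProbabilityMeasure M.P
  let y₀ : 𝒴 := M.potential none ω₀
  have : Nonempty 𝒴 := ⟨y₀⟩
  have hfin₁ : ∀ q, IsFiniteMeasure (ν q q.1) := fun q => ⟨by
    refine lt_of_le_of_lt ?_ ENNReal.one_lt_top
    rw [← hν.2]
    exact Finset.single_le_sum (f := fun q => ν q q.1 Set.univ) (fun _ _ => zero_le)
      (Finset.mem_univ q)⟩
  have hfin₂ : ∀ q, IsFiniteMeasure (ν q q.2) := fun q => ⟨by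
    rw [← hν.1 q]; exact measure_lt_top _ _⟩
  have hmass₂ : ∑ q, ν q q.2 Set.univ = 1 := by simp_rw [← hν.1]; exact hν.2
  obtain ⟨f, hf, hf0, hfD, hf1, hflim, hfz⟩ := hR.exists_split (n := fun q => ν q q.1) hν.2 hineq.1
  obtain ⟨g, hg, hg0, hgD, hg1, hglim, -⟩ := hL.exists_split (n := fun q => ν q q.2) hmass₂ hineq.2
  -- To the right `q.1` is observed, so the counterfactual law is the normalized `ν q q.2`; to the
  -- left the roles are exchanged.
  choose ρ₂ hρ₂ hρ₂e using fun q => exists_normalization (ν q q.2)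
  choose ρ₁ hρ₁ hρ₁e using fun q => exists_normalization (ν q q.1)
  have hΛp : ∀ D ∈ Λp, M.Relevant j D := fun D hD => hR.relevant hκ hsharp hD
  have hΛm : ∀ D ∈ Λm, M.Relevant j D := fun D hD => hL.relevant hκ hsharp hD
  have hcsupp : M.setSupport κ (c j) = Λp := by
    obtain ⟨ε, hε, hp, -⟩ := hreg.1
    simpa using hp 0 le_rfl hε
  have hc : c j ∈ M.relevantScores j κ := Economy.mem_relevantScores_of_setSupport hcsupp hΛp
  have hrelR : ∀ᶠ s in 𝓝[>] (c j), s ∈ M.relevantScores j κ := hR.support.mono fun s hs =>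
    Economy.mem_relevantScores_of_setSupport hs hΛp
  have hrelL : ∀ᶠ s in 𝓝[<] (c j), s ∈ M.relevantScores j κ := hL.support.mono fun s hs =>
    Economy.mem_relevantScores_of_setSupport hs hΛm
  have hrel : ∀ᶠ s in 𝓝[≠] (c j), s ∈ M.relevantScores j κ := by
    rw [← nhdsLT_sup_nhdsGT]
    exact eventually_sup.2 ⟨hrelL, hrelR⟩
  let Λ : Finset (Finset (Choice J × Choice J)) := Finset.univ.filter fun D => D ∈ Λp
  have hΛne : Λ.Nonempty := by
    by_contra hne
    rw [Finset.not_nonempty_iff_eq_empty] at hne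
    have h1 := Economy.sum_obsEvent_univ (M := M) (κ (c j))
    rw [Finset.sum_eq_zero fun D _ => ?_] at h1
    · exact zero_ne_one h1
    · rw [Economy.obsEvent_univ]
      by_contra h0
      have hD : D ∈ Λ := Finset.mem_filter.2 ⟨Finset.mem_univ D, by
        rw [← hcsupp]; exact pos_iff_ne_zero.2 h0⟩
      rw [hne] at hD
      exact absurd hD (Finset.notMem_empty D)
  -- The weights must charge exactly `Λp`, because the support condition includes the cutoff itself.
  -- Membership of `Q_j` in the set may fail there, the cutoff being a null point.
  let u : Finset (Choice J × Choice J) → ℝ≥0∞ := fun D => if D ∈ Λ then (Λ.card : ℝ≥0∞)⁻¹ else 0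
  have hcard0 : (Λ.card : ℝ≥0∞) ≠ 0 := by exact_mod_cast hΛne.card_ne_zero
  have hu : ∀ D, u D ≠ ∞ := fun D => by
    simp only [u]
    split_ifs
    · exact ENNReal.inv_ne_top.2 hcard0
    · exact ENNReal.zero_ne_top
  have hu1 : ∑ D, u D = 1 := by
    simp only [u, Finset.sum_ite_mem, Finset.univ_inter, Finset.sum_const, nsmul_eq_mul]
    exact ENNReal.mul_inv_cancel hcard0 (ENNReal.natCast_ne_top _)
  have hu0 : ∀ D, u D ≠ 0 ↔ D ∈ Λp := fun D => by
    by_cases hD : D ∈ Λp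
    · simp [u, Λ, hD]
    · simp [u, Λ, hD]
  let β := splitKernel M j κ (fun q => ν q q.1) u f g
  have hβsum : ∀ s, s ≠ c j → ∀ D A, MeasurableSet A → ∑ q, β D q s A = M.obsKernel j κ D s A :=
    fun s hs D A hA => sum_splitKernel_apply hc hf hg hf0 hg0 hf1 hg1 hs hA
  have hβobs : ∀ s, s ≠ c j → s ∈ M.relevantScores j κ → ∀ D A, MeasurableSet A →
      ∑ q, β D q s A = κ s (M.obsEvent D A) := fun s hs hs' D A hA => by
    rw [hβsum s hs D A hA, M.obsKernel_apply_of_mem hs', Economy.obsLaw_apply _ D hA]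
  have hae : ∀ᵐ s ∂(M.P.map (M.score j)), s ≠ c j :=
    measure_eq_zero_iff_ae_notMem.1 (M.score_absolutelyContinuous j (measure_singleton (c j)))
  have haerel : ∀ᵐ s ∂(M.P.map (M.score j)), s ∈ M.relevantScores j κ :=
    Economy.ae_relevant hκ hsharp
  have hβD : ∀ s, s ≠ c j → ∀ D q, q ∉ D → β D q s = 0 := fun s hs D q hq => by
    rw [← Measure.measure_univ_eq_zero, splitKernel_apply hf hg hs MeasurableSet.univ]
    simp [share_eq_zero hfD hgD hq]
  have hβc : ∀ D q, β D q (c j) = u D • ν q q.1 := fun D q => splitKernel_cutoff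
  have hβapply : ∀ D q s, s ≠ c j → ∀ A, MeasurableSet A → β D q s A =
      ∫⁻ y in A, ENNReal.ofReal (share (c j) f g D q s y) ∂(M.obsKernel j κ D s) :=
    fun D q s hs A hA => splitKernel_apply hf hg hs hA
  have hβfin : ∀ D q, IsFiniteKernel (β D q) := fun D q =>
    isFiniteKernel_splitKernel hf0 hg0 hf1 hg1 hfD hgD hu
  have hβR : ∀ q A, MeasurableSet A →
      Tendsto (fun s => ∑ D, β D q s A) (𝓝[>] (c j)) (𝓝 (ν q q.1 A)) :=
    fun q A hA => tendsto_sum_splitKernel nhdsWithin_le_nhds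
      (by filter_upwards [self_mem_nhdsWithin] with s hs using (ne_of_gt hs)) hrelR hf hg hf0 hg0
      (by filter_upwards [self_mem_nhdsWithin] with s hs using if_pos hs) hA (hflim q A hA)
  have hβL : ∀ q A, MeasurableSet A →
      Tendsto (fun s => ∑ D, β D q s A) (𝓝[<] (c j)) (𝓝 (ν q q.2 A)) :=
    fun q A hA => tendsto_sum_splitKernel nhdsWithin_le_nhds
      (by filter_upwards [self_mem_nhdsWithin] with s hs using (ne_of_lt hs)) hrelL hf hg hf0 hg0
      (by filter_upwards [self_mem_nhdsWithin] with s hs using if_neg (not_lt.2 (le_of_lt hs)))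
      hA (hglim q A hA)
  clear_value β u
  let S : Split M κ j :=
    { part := β
      finite := hβfin
      right := ρ₂
      left := ρ₁
      right_prob := hρ₂
      left_prob := hρ₁
      part_eq_zero := fun q hq D s => by
        by_cases hs : s = c j
        · rw [hs, hβc]
          -- Members of `Λp` contain no null local preference, and the exact transport leaves no
          -- capacity at a `q` that belongs to none of them.
          have : ν q q.1 = 0 := hfz q fun D hD hqD => (hΛp D hD).2 q hqD hq
          rw [this, smul_zero]
        · by_cases hqD : q ∈ D
          · rw [← Measure.measure_univ_eq_zero, hβapply D q s hs _ MeasurableSet.univ,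
              M.obsKernel_eq_zero hc s fun hD => hD.2 q hqD hq]
            simp
          · exact hβD s hs D q hqD
      sum_part := fun s => by
        by_cases hs : s = c j
        · simp_rw [hs, hβc, Measure.smul_apply, smul_eq_mul, ← Finset.mul_sum]
          rw [hν.2]
          simpa only [mul_one] using hu1
        · simp_rw [hβsum s hs _ _ MeasurableSet.univ]
          exact M.sum_obsKernel hc s
      ae_obs := by
        filter_upwards [hae, haerel] with s hs hs' using hβobs s hs hs'
      ae_notMem := by
        filter_upwards [hae] with s hs using hβD s hs
      ae_mem := by
        filter_upwards [hae, haerel] with s hs hs' D q hq h0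
        rw [hβapply D q s hs _ MeasurableSet.univ, M.obsKernel_apply_of_mem hs',
          Measure.restrict_univ]
        have hle : ∫⁻ _, ENNReal.ofReal (gap (c j) s * uniformWeight D q) ∂(M.obsLaw (κ s) D) ≤
            ∫⁻ y, ENNReal.ofReal (share (c j) f g D q s y) ∂(M.obsLaw (κ s) D) :=
          lintegral_mono fun y => ENNReal.ofReal_le_ofReal (le_share hf0 hg0 D q s y)
        rw [lintegral_const, Economy.obsLaw_apply _ D MeasurableSet.univ,
          Economy.obsEvent_univ] at hle
        refine fun hz => ?_
        rw [hz] at hle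
        refine mul_ne_zero ?_ h0 (le_antisymm hle zero_le)
        exact (ENNReal.ofReal_pos.2 (mul_pos (gap_pos hs) (uniformWeight_pos hq))).ne' }
  have hS : S.ConvergesTo ν :=
    { mass := hν.1
      at_cutoff := fun q A _ => by
        change ∑ D, β D q (c j) A = _
        simp_rw [hβc, Measure.smul_apply, smul_eq_mul]
        rw [← Finset.sum_mul, hu1, one_mul]
      from_right := hβR
      from_left := hβL
      right_eq := fun q A _ => by rw [hν.1 q]; exact hρ₂e q A
      left_eq := fun q A _ => hρ₁e q A }
  refine hS.inSharpSet h𝒢 hκ hsharp y₀ hreg ?_ fun D => ?_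
  · filter_upwards [hrel, self_mem_nhdsWithin] with s hs hs' using hβobs s hs' hs
  · change _ ↔ ∑ q, β D q (c j) Set.univ ≠ 0
    simp_rw [hβc, Measure.smul_apply, smul_eq_mul, ← Finset.mul_sum]
    rw [hν.2, mul_one, hu0]

end LocalPref

end

theorem mainTheorem7 {J : ℕ} {c : Fin J → ℝ} {𝒴 : Set ℝ} (h𝒴 : IsCompact 𝒴)
    {Ω : Type*} [MeasurableSpace Ω] (M : LocalPref.Economy J c 𝒴 Ω)
    (j k : Fin J) (κ : ProbabilityTheory.Kernel ℝ Ω) (hκ : M.IsCondVersion j κ)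
    (hjk : M.Comparable κ j k)
    (𝒢 : Set (ℝ → ℝ)) (h𝒢 : LocalPref.IsTestClass 𝒴 𝒢)
    (hcont : M.ContinuousTypes κ j 𝒢) (hsharp : M.SharpSets κ j)
    (Λp Λm : Set (Finset (LocalPref.Choice J × LocalPref.Choice J)))
    (hreg : M.RegularSets κ j 𝒢 Λp Λm) :
    (LocalPref.IsCandidate (M.jointLaw κ j) ∧
      LocalPref.Inequalities M κ j Λp Λm (M.jointLaw κ j)) ∧
    ∀ ν : LocalPref.Choice J × LocalPref.Choice J → LocalPref.Choice J → MeasureTheory.Measure 𝒴,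
      LocalPref.InSharpSet M j 𝒢 Λp Λm ν ↔
        LocalPref.IsCandidate ν ∧ LocalPref.Inequalities M κ j Λp Λm ν := by
  have := hκ.1
  exact ⟨⟨M.isCandidate_jointLaw κ j,
    LocalPref.Economy.inequalities_jointLaw h𝒴 h𝒢 hκ hcont hsharp hreg⟩,
    fun ν => ⟨fun hν => hν.isCandidate_and_inequalities h𝒴 h𝒢 hκ hreg,
      fun hν => hν.1.inSharpSet hν.2 h𝒴 h𝒢 hκ hsharp hreg⟩⟩
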